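/- Let $0<R_0<R_1<R_2$ and let $c_->0$, $c_+>0$ satisfy $$\frac{c_-}{R_1^2}<\frac{c_+}{R_2^2}.$$ Let $B_R\subset\mathbb R^2$ be the open disc of radius $R$ centred at $0$, and put $\mathcal M=\overline{B}_{R_2}\setminus B_{R_0}$, $\Omega_-=B_{R_1}\setminus\overline{B}_{R_0}$, $\Omega_+=B_{R_2}\setminus\overline{B}_{R_1}$, $S=\partial B_{R_1}$, $c=\mathbf 1_{\Omega_-}c_-+\mathbf 1_{\Omega_+}c_+$. Consider the operator $-\Delta_c=-\operatorname{div}(c\nabla\,\cdot)$ (in the sense of distributions in the interior of $\mathcal M$) with domain $$\mathcal A=\Big\{u\in H^1_0(\mathcal M)\;:\; u_\pm:=u|_{\Omega_\pm}\in H^2(\Omega_\pm),\ \ u_-|_S=u_+|_S,\ \ c_-\,\partial_\nu u_-|_S=c_+\,\partial_\nu u_+|_S\Big\},$$ where functions are complex valued, $\nu$ is the unit normal to $S$ pointing into $\Omega_+$, and restrictions to $S$ are traces. Put $E_0=c_- /R_1^2>0$. Then there exist a sequence of real numbers $(\lambda_n)_{n\in\mathbb N}$ and a sequence $(u_n)_{n\in\mathbb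 N}$ in $\mathcal A$, of the form $u_n(r\cos\theta,r\sin\theta)=e^{in\theta}\psi_n(r)$ for $R_0<r<R_2$, $\theta\in\mathbb R$, with functions $\psi_n:(R_0,R_2)\to\mathbb C$, such that $$-\Delta_c u_n=\lambda_n u_n,\qquad \|u_n\|_{L^2(\mathcal M)}=1\quad\text{for all } n\in\mathbb N,\qquad \lambda_n\sim E_0\,n^2\quad (n\to\infty),$$ and such that for every $\omega\subset\mathcal M$ with $\operatorname{dist}(\overline\omega,S)>0$ there exist constants $C,d>0$ with $$\|u_n\|_{L^2(\omega)}\le C e^{-dn}\qquad\text{for all } n\in\mathbb N.$$ -/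

import Mathlib

open MeasureTheory Filter Topology Asymptotics
open scoped ContDiff ENNReal

noncomputable section

namespace AnnulusTransmission

/-- The Euclidean plane. -/
abbrev Plane : Type := EuclideanSpace ℝ (Fin 2)

/-! ### Geometry -/

/-- The point with polar coordinates `(r, θ)`. -/
def polarPoint (r θ : ℝ) : Plane := !₂[r * Real.cos θ, r * Real.sin θ]

/-- The open annulus `B_b \ closure B_a`. -/
def openAnnulus (a b : ℝ) : Set Plane := Metric.ball 0 b \ Metric.closedBall 0 a

/-- The closed annulus `closure B_b \ B_a`. -/
def closedAnnulus (a b : ℝ) : Set Plane := Metric.closedBall 0 b \ Metric.ball 0 a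

/-- The coefficient `c = 1_{Ω₋} c₋ + 1_{Ω₊} c₊`, where `Ω₋ = openAnnulus R₀ R₁` and
`Ω₊ = openAnnulus R₁ R₂`. -/
def coeff (R₀ R₁ R₂ cm cp : ℝ) (x : Plane) : ℝ :=
  (openAnnulus R₀ R₁).indicator (fun _ => cm) x + (openAnnulus R₁ R₂).indicator (fun _ => cp) x

/-! ### Sobolev spaces on an open set of the plane

All notions below depend only on the almost everywhere class of the functions on `U`. -/

/-- The classical partial derivative `∂ᵢ f`. -/
def partialDeriv (i : Fin 2) (f : Plane → ℂ) (x : Plane) : ℂ :=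
  fderiv ℝ f x (EuclideanSpace.single i (1 : ℝ))

/-- `φ ∈ C_c^∞(U)`. -/
def IsTestFunction (U : Set Plane) (φ : Plane → ℂ) : Prop :=
  ContDiff ℝ ∞ φ ∧ HasCompactSupport φ ∧ tsupport φ ⊆ U

/-- `u ∈ H¹(U)`, with weak gradient `G`. -/
structure HasWeakGradient (U : Set Plane) (u : Plane → ℂ) (G : Fin 2 → Plane → ℂ) : Prop where
  memLp : MemLp u 2 (volume.restrict U)
  memLp_grad : ∀ i, MemLp (G i) 2 (volume.restrict U)
  integral_eq : ∀ i, ∀ φ, IsTestFunction U φ →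
    ∫ x in U, u x * partialDeriv i φ x = -∫ x in U, G i x * φ x

/-- `u ∈ H¹(U)`. -/
def MemH1 (U : Set Plane) (u : Plane → ℂ) : Prop :=
  ∃ G, HasWeakGradient U u G

/-- `u ∈ H²(U)`. -/
def MemH2 (U : Set Plane) (u : Plane → ℂ) : Prop :=
  ∃ G, HasWeakGradient U u G ∧ ∀ i, MemH1 U (G i)

/-- The `C¹` functions `w k` converge in `H¹(U)` to the function `u` with weak gradient `G`. -/
def TendstoH1 (U : Set Plane) (w : ℕ → Plane → ℂ) (u : Plane → ℂ) (G : Fin 2 → Plane → ℂ) : Prop :=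
  Tendsto (fun k => eLpNorm (fun x => w k x - u x) 2 (volume.restrict U)) atTop (𝓝 0) ∧
  ∀ i, Tendsto (fun k => eLpNorm (fun x => partialDeriv i (w k) x - G i x) 2 (volume.restrict U))
    atTop (𝓝 0)

/-- `u ∈ H¹₀(U)`, the closure of `C_c^∞(U)` in `H¹(U)`. -/
def MemH10 (U : Set Plane) (u : Plane → ℂ) : Prop :=
  ∃ G, HasWeakGradient U u G ∧
    ∃ φ : ℕ → Plane → ℂ, (∀ k, IsTestFunction U (φ k)) ∧ TendstoH1 U φ u G

/-! ### Traces on a circle and transmission conditions -/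

/-- The angular measure on one period. -/
def angleMeasure : Measure ℝ := volume.restrict (Set.Ioc 0 (2 * Real.pi))

/-- `g ∈ L²` (a function of the polar angle) is the trace on the circle of radius `R` of
`v ∈ H¹(U)`, where `U` is an annulus having this circle as a boundary component: the value at `v`
of the continuous extension to `H¹(U)` of the restriction map `w ↦ w(R cos θ, R sin θ)`, defined
for `w` of class `C¹` up to the boundary. -/
def HasTrace (U : Set Plane) (R : ℝ) (v : Plane → ℂ) (g : ℝ → ℂ) : Prop :=
  MemLp g 2 angleMeasure ∧
  ∃ G, HasWeakGradient U v G ∧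
    ∃ w : ℕ → Plane → ℂ, (∀ k, ContDiff ℝ 1 (w k)) ∧ TendstoH1 U w v G ∧
      Tendsto (fun k => eLpNorm (fun θ => w k (polarPoint R θ) - g θ) 2 angleMeasure) atTop (𝓝 0)

/-- `g` is the trace on the circle of radius `R` of the radial derivative `∂_ν v`, where
`ν = (cos θ, sin θ)` is the unit normal pointing away from the origin and `v ∈ H²(U)`. -/
def HasNormalTrace (U : Set Plane) (R : ℝ) (v : Plane → ℂ) (g : ℝ → ℂ) : Prop :=
  ∃ G, HasWeakGradient U v G ∧ ∃ t : Fin 2 → ℝ → ℂ, (∀ i, HasTrace U R (G i) (t i)) ∧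
    ∀ᵐ θ ∂angleMeasure, g θ = Real.cos θ * t 0 θ + Real.sin θ * t 1 θ

/-- The transmission conditions `u₋ = u₊` and `c₋ ∂_ν u₋ = c₊ ∂_ν u₊` on the circle `r = R₁`,
in the sense of traces. -/
def TransmissionConditions (R₀ R₁ R₂ cm cp : ℝ) (u : Plane → ℂ) : Prop :=
  (∃ gm gp : ℝ → ℂ, HasTrace (openAnnulus R₀ R₁) R₁ u gm ∧ HasTrace (openAnnulus R₁ R₂) R₁ u gp ∧
    ∀ᵐ θ ∂angleMeasure, gm θ = gp θ) ∧
  (∃ gm gp : ℝ → ℂ, HasNormalTrace (openAnnulus R₀ R₁) R₁ u gm ∧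
    HasNormalTrace (openAnnulus R₁ R₂) R₁ u gp ∧
    ∀ᵐ θ ∂angleMeasure, (cm : ℂ) * gm θ = (cp : ℂ) * gp θ)

/-! ### The operator `-div(c ∇ ·)` -/

/-- The domain of `-div(c ∇ ·)` with Dirichlet boundary conditions: `u ∈ H¹₀`, with restrictions to
`Ω₋` and `Ω₊` in `H²`, and satisfying the transmission conditions. (The condition `u₋ = u₊` on the
interface is automatic for `u ∈ H¹₀`; it is recorded for definiteness.) -/
structure MemDomain (R₀ R₁ R₂ cm cp : ℝ) (u : Plane → ℂ) : Prop where
  memH10 : MemH10 (openAnnulus R₀ R₂) u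
  memH2_inner : MemH2 (openAnnulus R₀ R₁) u
  memH2_outer : MemH2 (openAnnulus R₁ R₂) u
  transmission : TransmissionConditions R₀ R₁ R₂ cm cp u

/-- `-div(c ∇u) = f` in `𝓓'(U)`, with `u ∈ H¹(U)` and `f ∈ L²(U)`. -/
def NegDivGradEq (U : Set Plane) (c : Plane → ℝ) (u f : Plane → ℂ) : Prop :=
  MemLp f 2 (volume.restrict U) ∧
  ∃ G, HasWeakGradient U u G ∧ ∀ φ, IsTestFunction U φ →
    ∫ x in U, (c x : ℂ) * ∑ i, G i x * partialDeriv i φ x = ∫ x in U, f x * φ x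

end AnnulusTransmission

end

open AnnulusTransmission

/-!
In the variable `s = log r`, a function `e^{inθ} y(log r)` satisfies `-c Δ v = λ v` if and only if
`y'' = (n² - (λ / c) e^{2s}) y`, and the transmission conditions say that `y` and `c y'` are
continuous at the interface. The potential `c n² / r²` takes its infimum over the annulus,
`E₀ n²` with `E₀ = c₋ / R₁²`, only when the interface is approached from the inside: this is where
`c₋ / R₁² < c₊ / R₂²` enters. The ground state of the radial problem is therefore trapped at the
interface as `n → ∞`, and it is the mode constructed here.

*Existence and eigenvalue.* The solution with `y = 0`, `y' = 1` at the inner boundary depends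
continuously on `λ` (`exists_linearODE_solution`). It has no zero beyond the inner boundary for
`λ = E₀ n²`, because `q = n² - (λ / c) e^{2s}` is then nonnegative, and by Sturm comparison with a
sine it has one for `λ = E₀ e^{2δ} (n² + π² / δ²)`, because then `q ≤ -(π / δ)²` on the interval of
length `δ` before the interface. For the least `λ ≥ E₀ n²` with such a zero, the solution is
nonnegative and vanishes at the outer boundary (`exists_isRadialMode`). With `δ` of order `n^{-1/2}`
both bounds are asymptotic to `E₀ n²`.

*Decay.* Away from the interface `q ≥ (β n)²` for large `n`, and a nonnegative solution of `y'' = q y`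
that vanishes at a boundary point grows at least like `e^{βns}` away from that point
(`IsRadialSol.exp_growth`, `IsRadialSol.exp_decay`). So the mode is exponentially smaller far from
the interface than on a ring near it, where the `L²` normalization controls it.

*Function spaces.* Each branch of the mode extends to a smooth function `zⁿ g(|z|²)` on the plane, so
traces and second derivatives on either side of the interface are classical. What happens across a
circle rests on one estimate (`exists_bound_circleCutoffDeriv_mul`): a cutoff rising in a layer of
width `1 / k` along a circle has derivative of order `k`, and times a function vanishing on the
circle this stays bounded and tends to `0` almost everywhere. By dominated convergence it gives the
`H¹` approximation by test functions (`IsRadialEigenfunction.memH10`), the weak gradient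
(`hasWeakGradient_exterior`) and the divergence theorem for the flux jump
(`integral_divergence_exterior`), without any surface integral.
-/

namespace AnnulusTransmission

/-! ### Linear differential equations with a parameter -/

section LinearODE

variable {E : Type*} [NormedAddCommGroup E] [NormedSpace ℝ E]

/-- The `k`-th term of the Picard (Dyson) series of the linear equation `x' = A l t x` with initial
value `x₀ l` at time `t₀`; here `l` is a real parameter. -/
noncomputable def picardTerm (A : ℝ → ℝ → E →L[ℝ] E) (t₀ : ℝ) (x₀ : ℝ → E) : ℕ → ℝ → ℝ → E
  | 0 => fun l _ => x₀ l
  | k + 1 => fun l t => ∫ τ in t₀..t, A l τ (picardTerm A t₀ x₀ k l τ)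

variable {A : ℝ → ℝ → E →L[ℝ] E} {t₀ : ℝ} {x₀ : ℝ → E}

lemma continuous_picardTerm (hA : Continuous (Function.uncurry A)) (hx₀ : Continuous x₀) (k : ℕ) :
    Continuous (Function.uncurry (picardTerm A t₀ x₀ k)) := by
  induction k with
  | zero => exact hx₀.comp continuous_fst
  | succ k ih =>
    have h : Continuous (Function.uncurry fun (q : ℝ × ℝ) (τ : ℝ) =>
        A q.1 τ (picardTerm A t₀ x₀ k q.1 τ)) := by
      have h1 : Continuous fun z : (ℝ × ℝ) × ℝ => A z.1.1 z.2 :=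
        hA.comp (by fun_prop : Continuous fun z : (ℝ × ℝ) × ℝ => (z.1.1, z.2))
      have h2 : Continuous fun z : (ℝ × ℝ) × ℝ => picardTerm A t₀ x₀ k z.1.1 z.2 :=
        ih.comp (by fun_prop : Continuous fun z : (ℝ × ℝ) × ℝ => (z.1.1, z.2))
      exact h1.clm_apply h2
    exact intervalIntegral.continuous_parametric_intervalIntegral_of_continuous h continuous_snd

lemma hasDerivAt_picardTerm [CompleteSpace E]
    (hA : Continuous (Function.uncurry A)) (hx₀ : Continuous x₀)
    (k : ℕ) (l t : ℝ) :
    HasDerivAt (picardTerm A t₀ x₀ (k + 1) l) (A l t (picardTerm A t₀ x₀ k l t)) t := by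
  have h1 : Continuous fun τ => A l τ := hA.comp (by fun_prop : Continuous fun τ : ℝ => (l, τ))
  have h2 : Continuous fun τ => picardTerm A t₀ x₀ k l τ :=
    (continuous_picardTerm hA hx₀ k).comp (by fun_prop : Continuous fun τ : ℝ => (l, τ))
  have h3 := h1.clm_apply h2
  exact intervalIntegral.integral_hasDerivAt_right (h3.intervalIntegrable _ _)
    h3.stronglyMeasurable.stronglyMeasurableAtFilter h3.continuousAt

lemma norm_picardTerm_le {a C R l : ℝ}
    (ha : ∀ t, |t - t₀| ≤ R → ‖A l t‖ ≤ a) (hC : ‖x₀ l‖ ≤ C) (k : ℕ) :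
    ∀ t, |t - t₀| ≤ R → ‖picardTerm A t₀ x₀ k l t‖ ≤ C * a ^ k * |t - t₀| ^ k / k.factorial := by
  induction k with
  | zero => intro t _; simpa [picardTerm] using hC
  | succ k ih =>
    intro t ht
    have hC0 : 0 ≤ C := (norm_nonneg _).trans hC
    have ha0 : 0 ≤ a := (norm_nonneg _).trans (ha t ht)
    have hsub : ∀ τ ∈ Set.uIoc t₀ t, |τ - t₀| ≤ R := fun τ hτ =>
      (Set.abs_sub_left_of_mem_uIcc (Set.uIoc_subset_uIcc hτ)).trans ht
    have hint : IntegrableOn (fun τ => C * a ^ (k + 1) / k.factorial * |τ - t₀| ^ k)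
        (Set.uIoc t₀ t) := by
      have : Continuous fun τ : ℝ => C * a ^ (k + 1) / k.factorial * |τ - t₀| ^ k := by fun_prop
      exact (this.intervalIntegrable t₀ t).def'
    calc ‖picardTerm A t₀ x₀ (k + 1) l t‖
        ≤ ∫ τ in Set.uIoc t₀ t, ‖A l τ (picardTerm A t₀ x₀ k l τ)‖ :=
          intervalIntegral.norm_integral_le_integral_norm_uIoc
      _ ≤ ∫ τ in Set.uIoc t₀ t, C * a ^ (k + 1) / k.factorial * |τ - t₀| ^ k := by
          apply integral_mono_of_nonneg (Eventually.of_forall fun _ => norm_nonneg _) hint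
          filter_upwards [ae_restrict_mem measurableSet_uIoc] with τ hτ
          calc ‖A l τ (picardTerm A t₀ x₀ k l τ)‖
              ≤ ‖A l τ‖ * ‖picardTerm A t₀ x₀ k l τ‖ := ContinuousLinearMap.le_opNorm _ _
            _ ≤ a * (C * a ^ k * |τ - t₀| ^ k / k.factorial) :=
                mul_le_mul (ha τ (hsub τ hτ)) (ih τ (hsub τ hτ)) (norm_nonneg _) ha0
            _ = C * a ^ (k + 1) / k.factorial * |τ - t₀| ^ k := by ring
      _ = C * a ^ (k + 1) * |t - t₀| ^ (k + 1) / (k + 1).factorial := by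
          rw [integral_const_mul, integral_pow_abs_sub_uIoc, Nat.factorial_succ]
          push_cast
          field_simp

/-- Bounds for the Picard terms, uniform on compact sets and summable. -/
lemma exists_summable_bound_picardTerm
    (hA : Continuous (Function.uncurry A)) (hx₀ : Continuous x₀) (R : ℝ) :
    ∃ (u : ℕ → ℝ) (a : ℝ), Summable u ∧ 0 ≤ a ∧ ∀ l t, |l| ≤ R → |t - t₀| ≤ R →
      ‖A l t‖ ≤ a ∧ ∀ k, ‖picardTerm A t₀ x₀ k l t‖ ≤ u k := by
  have hK : IsCompact (Metric.closedBall (0 : ℝ) R ×ˢ Metric.closedBall t₀ R) :=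
    (isCompact_closedBall _ _).prod (isCompact_closedBall _ _)
  obtain ⟨a, ha⟩ := hK.exists_bound_of_continuousOn hA.continuousOn
  obtain ⟨C, hC⟩ := (isCompact_closedBall (0 : ℝ) R).exists_bound_of_continuousOn hx₀.continuousOn
  have ha' : ∀ l t, |l| ≤ R → |t - t₀| ≤ R → ‖A l t‖ ≤ |a| := fun l t hl ht =>
    (ha (l, t) ⟨by simpa using hl, by simpa [Real.dist_eq] using ht⟩).trans (le_abs_self a)
  refine ⟨fun k => |C| * ((|a| * |R|) ^ k / k.factorial), |a|,
    (Real.summable_pow_div_factorial _).mul_left _, abs_nonneg a, fun l t hl ht =>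
      ⟨ha' l t hl ht, fun k => ?_⟩⟩
  have h := norm_picardTerm_le (fun t ht => ha' l t hl ht)
    ((hC l (by simpa using hl)).trans (le_abs_self C)) k t ht
  refine h.trans ?_
  have h1 : |t - t₀| ^ k ≤ |R| ^ k := pow_le_pow_left₀ (abs_nonneg _) (ht.trans (le_abs_self R)) k
  calc |C| * |a| ^ k * |t - t₀| ^ k / k.factorial ≤ |C| * |a| ^ k * |R| ^ k / k.factorial := by
        gcongr
    _ = |C| * ((|a| * |R|) ^ k / k.factorial) := by rw [mul_pow]; ring

/-- Global existence for linear equations, with continuous dependence on a parameter. -/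
theorem exists_linearODE_solution [CompleteSpace E]
    (hA : Continuous (Function.uncurry A)) (hx₀ : Continuous x₀) (t₀ : ℝ) :
    ∃ X : ℝ → ℝ → E, Continuous (Function.uncurry X) ∧ (∀ l, X l t₀ = x₀ l) ∧
      ∀ l t, HasDerivAt (X l) (A l t (X l t)) t := by
  refine ⟨fun l t => ∑' k, picardTerm A t₀ x₀ k l t, ?_, ?_, ?_⟩
  · refine continuous_iff_continuousAt.2 fun ⟨l, t⟩ => ?_
    obtain ⟨u, a, hu, -, hb⟩ := exists_summable_bound_picardTerm (t₀ := t₀) hA hx₀ (|l| + |t - t₀| + 1)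
    have hcont : ContinuousOn (fun q : ℝ × ℝ => ∑' k, picardTerm A t₀ x₀ k q.1 q.2)
        (Metric.closedBall (0 : ℝ) (|l| + |t - t₀| + 1) ×ˢ
          Metric.closedBall t₀ (|l| + |t - t₀| + 1)) := by
      refine continuousOn_tsum (fun k => (continuous_picardTerm hA hx₀ k).continuousOn) hu ?_
      rintro k ⟨l', t'⟩ ⟨h1, h2⟩
      exact (hb l' t' (by simpa using h1) (by simpa [Real.dist_eq] using h2)).2 k
    refine hcont.continuousAt (prod_mem_nhds ?_ ?_)
    · refine mem_of_superset (Metric.isOpen_ball.mem_nhds (x := l) ?_) Metric.ball_subset_closedBall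
      simp only [Metric.mem_ball, Real.dist_eq, sub_zero]
      linarith [abs_nonneg (t - t₀)]
    · refine mem_of_superset (Metric.isOpen_ball.mem_nhds (x := t) ?_) Metric.ball_subset_closedBall
      simp only [Metric.mem_ball, Real.dist_eq]
      linarith [abs_nonneg l]
  · intro l
    beta_reduce
    rw [tsum_eq_single 0]
    · rfl
    · rintro (_ | k) hk
      · exact absurd rfl hk
      · simp [picardTerm]
  · intro l t
    obtain ⟨u, a, hu, ha, hb⟩ := exists_summable_bound_picardTerm (t₀ := t₀) hA hx₀ (|l| + |t - t₀| + 1)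
    have hl : |l| ≤ |l| + |t - t₀| + 1 := by linarith [abs_nonneg (t - t₀)]
    have ht : |t - t₀| < |l| + |t - t₀| + 1 := by linarith [abs_nonneg l]
    have hsum : ∀ t', |t' - t₀| ≤ |l| + |t - t₀| + 1 →
        Summable fun k => picardTerm A t₀ x₀ k l t' := fun t' ht' =>
      Summable.of_norm_bounded hu fun k => (hb l t' hl ht').2 k
    let g' : ℕ → ℝ → E := fun k t =>
      Nat.casesOn k 0 fun j => A l t (picardTerm A t₀ x₀ j l t)
    have key : HasDerivAt (fun z => ∑' k, picardTerm A t₀ x₀ k l z) (∑' k, g' k t) t := by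
      refine hasDerivAt_tsum_of_isPreconnected
        (u := fun k => Nat.casesOn k 0 fun j => a * u j) (t := Metric.ball t₀ (|l| + |t - t₀| + 1))
        (y₀ := t) ?_ Metric.isOpen_ball ?_ ?_ ?_ ?_ ?_ ?_
      · exact (summable_nat_add_iff 1).1 (hu.mul_left a)
      · exact (convex_ball _ _).isPreconnected
      · rintro (_ | k) y -
        · exact hasDerivAt_const _ _
        · exact hasDerivAt_picardTerm hA hx₀ k l y
      · rintro (_ | k) y hy
        · simp [g']
        · have hb' := hb l y hl (by simpa [Real.dist_eq] using (Metric.mem_ball.1 hy).le)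
          exact (ContinuousLinearMap.le_opNorm _ _).trans
            (mul_le_mul hb'.1 (hb'.2 k) (norm_nonneg _) ha)
      · simpa [Real.dist_eq] using ht
      · exact hsum t ht.le
      · simpa [Real.dist_eq] using ht
    have hs : Summable fun k => g' k t :=
      (summable_nat_add_iff 1).1 ((A l t).summable (hsum t ht.le))
    convert key using 1
    rw [hs.tsum_eq_zero_add, (A l t).map_tsum (hsum t ht.le)]
    simp [g']

end LinearODE

/-! ### The radial equation -/

/-- `y`, with derivative `p`, solves the radial equation `y'' = (n² - κ e^{2s}) y`, where `s = log r`.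
For `κ = λ / c` it says that `r ↦ e^{inθ} y (log r)` satisfies `-c Δ v = λ v`. -/
structure IsRadialSol (n : ℕ) (κ : ℝ) (y p : ℝ → ℝ) : Prop where
  hasDerivAt_fst : ∀ s, HasDerivAt y (p s) s
  hasDerivAt_snd : ∀ s, HasDerivAt p (((n : ℝ) ^ 2 - κ * Real.exp (2 * s)) * y s) s

lemma exists_isRadialSol (n : ℕ) (c t₀ : ℝ) {a b : ℝ → ℝ} (ha : Continuous a) (hb : Continuous b) :
    ∃ y p : ℝ → ℝ → ℝ, Continuous (Function.uncurry y) ∧ Continuous (Function.uncurry p) ∧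
      (∀ l, y l t₀ = a l) ∧ (∀ l, p l t₀ = b l) ∧ ∀ l, IsRadialSol n (l / c) (y l) (p l) := by
  let A : ℝ → ℝ → (ℝ × ℝ) →L[ℝ] (ℝ × ℝ) := fun l s =>
    (ContinuousLinearMap.snd ℝ ℝ ℝ).prod 0 + ((n : ℝ) ^ 2 - l / c * Real.exp (2 * s)) •
      (0 : (ℝ × ℝ) →L[ℝ] ℝ).prod (ContinuousLinearMap.fst ℝ ℝ ℝ)
  have hA : Continuous (Function.uncurry A) := by
    have : Continuous fun q : ℝ × ℝ => (n : ℝ) ^ 2 - q.1 / c * Real.exp (2 * q.2) := by fun_prop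
    exact continuous_const.add (this.smul continuous_const)
  obtain ⟨X, hX, hX0, hX'⟩ := exists_linearODE_solution hA (ha.prodMk hb) t₀
  refine ⟨fun l s => (X l s).1, fun l s => (X l s).2, continuous_fst.comp hX, continuous_snd.comp hX,
    fun l => by simp [hX0], fun l => by simp [hX0], fun l => ⟨fun s => ?_, fun s => ?_⟩⟩
  · have h := hasFDerivAt_fst.comp_hasDerivAt s (hX' l s)
    exact h.congr_deriv (by simp [A])
  · have h := hasFDerivAt_snd.comp_hasDerivAt s (hX' l s)
    exact h.congr_deriv (by simp [A])

namespace IsRadialSol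

variable {n : ℕ} {κ : ℝ} {y p w r : ℝ → ℝ}

lemma continuous_fst (h : IsRadialSol n κ y p) : Continuous y :=
  continuous_iff_continuousAt.2 fun s => (h.hasDerivAt_fst s).continuousAt

lemma continuous_snd (h : IsRadialSol n κ y p) : Continuous p :=
  continuous_iff_continuousAt.2 fun s => (h.hasDerivAt_snd s).continuousAt

lemma wronskian_eq (h : IsRadialSol n κ y p) (h' : IsRadialSol n κ w r) (s t : ℝ) :
    y s * r s - p s * w s = y t * r t - p t * w t := by
  have hd : ∀ s, HasDerivAt (fun s => y s * r s - p s * w s) 0 s := fun s => by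
    refine HasDerivAt.congr_deriv (((h.hasDerivAt_fst s).mul (h'.hasDerivAt_snd s)).sub
      ((h.hasDerivAt_snd s).mul (h'.hasDerivAt_fst s))) ?_
    ring
  exact is_const_of_deriv_eq_zero (fun s => (hd s).differentiableAt) (fun s => (hd s).deriv) s t

lemma eq_zero_of_double_zero (h : IsRadialSol n κ y p) {t : ℝ} (hy : y t = 0) (hp : p t = 0)
    (s : ℝ) : y s = 0 ∧ p s = 0 := by
  have aux : ∀ a b : ℝ, y s * b - p s * a = 0 := fun a b => by
    obtain ⟨w, r, -, -, hw, hr, hs⟩ := exists_isRadialSol n 1 s (a := fun _ => a) (b := fun _ => b)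
      continuous_const continuous_const
    have hs' := hs κ
    rw [div_one] at hs'
    have := h.wronskian_eq hs' s t
    rw [hy, hp, hw, hr] at this
    simpa using this
  exact ⟨by simpa using aux 0 1, by simpa using aux 1 0⟩

/-- Both `(y y')' = y'² + q y²` and `(y²)' = 2 y y'` are nonnegative where `q ≥ 0` and
`y y' ≥ 0`. -/
lemma monotoneOn_of_coeff_nonneg (h : IsRadialSol n κ y p) {a b : ℝ}
    (hq : ∀ s ∈ Set.Icc a b, 0 ≤ (n : ℝ) ^ 2 - κ * Real.exp (2 * s)) (h0 : 0 ≤ y a * p a) :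
    (∀ s ∈ Set.Icc a b, 0 ≤ y s * p s) ∧ MonotoneOn (fun s => y s ^ 2) (Set.Icc a b) := by
  have hd : ∀ s, HasDerivAt (fun s => y s * p s)
      (p s * p s + y s * (((n : ℝ) ^ 2 - κ * Real.exp (2 * s)) * y s)) s := fun s =>
    (h.hasDerivAt_fst s).mul (h.hasDerivAt_snd s)
  have hmono : MonotoneOn (fun s => y s * p s) (Set.Icc a b) := by
    refine monotoneOn_of_hasDerivWithinAt_nonneg (convex_Icc a b)
      (fun s _ => (hd s).continuousAt.continuousWithinAt)
      (fun s _ => (hd s).hasDerivWithinAt) fun s hs => ?_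
    have := hq s (interior_subset hs)
    nlinarith [mul_self_nonneg (p s), mul_nonneg this (mul_self_nonneg (y s))]
  have hnn : ∀ s ∈ Set.Icc a b, 0 ≤ y s * p s := fun s hs =>
    h0.trans (hmono (Set.left_mem_Icc.2 (hs.1.trans hs.2)) hs hs.1)
  refine ⟨hnn, ?_⟩
  have hd2 : ∀ s, HasDerivAt (fun s => y s ^ 2) (2 * (y s * p s)) s := fun s => by
    refine HasDerivAt.congr_deriv ((h.hasDerivAt_fst s).pow 2) ?_
    simp; ring
  exact monotoneOn_of_hasDerivWithinAt_nonneg (convex_Icc a b)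
    (fun s _ => (hd2 s).continuousAt.continuousWithinAt)
    (fun s _ => (hd2 s).hasDerivWithinAt) fun s hs => by linarith [hnn s (interior_subset hs)]

lemma pos_of_coeff_nonneg (h : IsRadialSol n κ y p) {a b : ℝ}
    (hq : ∀ s ∈ Set.Icc a b, 0 ≤ (n : ℝ) ^ 2 - κ * Real.exp (2 * s)) (h0 : 0 < y a)
    (hp : 0 ≤ p a) : ∀ s ∈ Set.Icc a b, 0 < y s ∧ 0 ≤ p s := by
  intro s hs
  obtain ⟨h1, h2⟩ := h.monotoneOn_of_coeff_nonneg hq (mul_nonneg h0.le hp)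
  have hne : ∀ t ∈ Set.Icc a b, y t ≠ 0 := fun t ht h3 => by
    have := h2 (Set.left_mem_Icc.2 (ht.1.trans ht.2)) ht ht.1
    simp only [h3] at this
    nlinarith
  have hpos : 0 < y s := by
    by_contra! hcon
    obtain ⟨t, ht, ht0⟩ := intermediate_value_Icc' hs.1 h.continuous_fst.continuousOn ⟨hcon, h0.le⟩
    exact hne t ⟨ht.1, ht.2.trans hs.2⟩ ht0
  exact ⟨hpos, nonneg_of_mul_nonneg_right (h1 s hs) hpos⟩

lemma pos_of_coeff_nonneg_of_eq_zero (h : IsRadialSol n κ y p) {a b : ℝ}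
    (hq : ∀ s ∈ Set.Icc a b, 0 ≤ (n : ℝ) ^ 2 - κ * Real.exp (2 * s)) (h0 : y a = 0)
    (hp : 0 < p a) : ∀ s ∈ Set.Ioc a b, 0 < y s ∧ 0 ≤ p s := by
  intro s hs
  have h1 : ∀ᶠ t in 𝓝[>] a, 0 < p t :=
    (h.continuous_snd.continuousAt.eventually (lt_mem_nhds hp)).filter_mono nhdsWithin_le_nhds
  obtain ⟨u, hu, hup⟩ := (mem_nhdsGT_iff_exists_Ioo_subset).1 h1
  have hu' : a < u := hu
  obtain ⟨t, hat, htu⟩ := exists_between (lt_min hu' hs.1)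
  have hyt : 0 < y t := by
    have hm : StrictMonoOn y (Set.Icc a t) := by
      refine strictMonoOn_of_deriv_pos (convex_Icc a t) h.continuous_fst.continuousOn fun x hx => ?_
      rw [interior_Icc] at hx
      rw [(h.hasDerivAt_fst x).deriv]
      exact hup ⟨hx.1, hx.2.trans (htu.trans_le (min_le_left _ _))⟩
    have := hm (Set.left_mem_Icc.2 hat.le) (Set.right_mem_Icc.2 hat.le) hat
    rwa [h0] at this
  have hts : t < s := htu.trans_le (min_le_right _ _)
  exact h.pos_of_coeff_nonneg (fun x hx => hq x ⟨hat.le.trans hx.1, hx.2⟩) hyt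
    (hup ⟨hat, htu.trans_le (min_le_left _ _)⟩ : 0 < p t).le s ⟨hts.le, hs.2⟩

lemma const_mul (h : IsRadialSol n κ y p) (t : ℝ) :
    IsRadialSol n κ (fun s => t * y s) (fun s => t * p s) :=
  ⟨fun s => (h.hasDerivAt_fst s).const_mul t, fun s => by
    refine HasDerivAt.congr_deriv ((h.hasDerivAt_snd s).const_mul t) ?_
    ring⟩

lemma neg (h : IsRadialSol n κ y p) : IsRadialSol n κ (fun s => -y s) (fun s => -p s) :=
  ⟨fun s => (h.hasDerivAt_fst s).neg, fun s => by
    refine HasDerivAt.congr_deriv ((h.hasDerivAt_snd s).neg) ?_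
    ring⟩

/-- Comparison with `sin (π (s - b + δ) / δ)`: where `y'' = q y` with `q ≤ -(π / δ)²`, every interval
of length `δ` contains a zero. -/
lemma exists_zero_of_coeff_le (h : IsRadialSol n κ y p) {b δ : ℝ} (hδ : 0 < δ)
    (hq : ∀ s ∈ Set.Icc (b - δ) b, (n : ℝ) ^ 2 - κ * Real.exp (2 * s) ≤ -(Real.pi / δ) ^ 2) :
    ∃ s ∈ Set.Icc (b - δ) b, y s = 0 := by
  have main : ∀ y p : ℝ → ℝ, IsRadialSol n κ y p → ¬ ∀ s ∈ Set.Icc (b - δ) b, 0 < y s := by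
    intro y p h hpos
    have hsin : ∀ s, HasDerivAt (fun s => Real.sin (Real.pi / δ * (s - b + δ)))
        (Real.cos (Real.pi / δ * (s - b + δ)) * (Real.pi / δ)) s := fun s => by
      have h1 : HasDerivAt (fun s => Real.pi / δ * (s - b + δ)) (Real.pi / δ) s := by
        simpa using (((hasDerivAt_id s).sub_const b).add_const δ).const_mul (Real.pi / δ)
      exact h1.sin
    have hcos : ∀ s, HasDerivAt (fun s => Real.cos (Real.pi / δ * (s - b + δ)) * (Real.pi / δ))
        (-Real.sin (Real.pi / δ * (s - b + δ)) * (Real.pi / δ) * (Real.pi / δ)) s := fun s => by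
      have h1 : HasDerivAt (fun s => Real.pi / δ * (s - b + δ)) (Real.pi / δ) s := by
        simpa using (((hasDerivAt_id s).sub_const b).add_const δ).const_mul (Real.pi / δ)
      exact h1.cos.mul_const _
    have hd : ∀ s, HasDerivAt (fun s => y s * (Real.cos (Real.pi / δ * (s - b + δ)) * (Real.pi / δ))
        - p s * Real.sin (Real.pi / δ * (s - b + δ)))
        ((-(Real.pi / δ) ^ 2 - ((n : ℝ) ^ 2 - κ * Real.exp (2 * s))) * y s *
          Real.sin (Real.pi / δ * (s - b + δ))) s := fun s => by
      refine HasDerivAt.congr_deriv (((h.hasDerivAt_fst s).mul (hcos s)).sub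
        ((h.hasDerivAt_snd s).mul (hsin s))) ?_
      ring
    have hmono : MonotoneOn (fun s => y s * (Real.cos (Real.pi / δ * (s - b + δ)) * (Real.pi / δ))
        - p s * Real.sin (Real.pi / δ * (s - b + δ))) (Set.Icc (b - δ) b) := by
      refine monotoneOn_of_hasDerivWithinAt_nonneg (convex_Icc _ _)
        (fun s _ => (hd s).continuousAt.continuousWithinAt)
        (fun s _ => (hd s).hasDerivWithinAt) fun s hs => ?_
      have hs := interior_subset hs
      refine mul_nonneg (mul_nonneg (by linarith [hq s hs]) (hpos s hs).le)
        (Real.sin_nonneg_of_nonneg_of_le_pi ?_ ?_)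
      · exact mul_nonneg (by positivity) (by linarith [hs.1])
      · calc Real.pi / δ * (s - b + δ) ≤ Real.pi / δ * δ := by gcongr; linarith [hs.2]
          _ = Real.pi := by field_simp
    have hle := hmono (Set.left_mem_Icc.2 (by linarith)) (Set.right_mem_Icc.2 (by linarith))
      (by linarith : b - δ ≤ b)
    have e1 : Real.pi / δ * (b - b + δ) = Real.pi := by rw [sub_self, zero_add]; field_simp
    have e2 : Real.pi / δ * (b - δ - b + δ) = 0 := by ring
    simp only [e1, e2, Real.cos_pi, Real.sin_pi, Real.cos_zero, Real.sin_zero] at hle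
    have h1 := hpos b (Set.right_mem_Icc.2 (by linarith))
    have h2 := hpos (b - δ) (Set.left_mem_Icc.2 (by linarith))
    have h3 : 0 < Real.pi / δ := by positivity
    nlinarith [mul_pos h1 h3, mul_pos h2 h3]
  by_contra! hne
  have hbb : b ∈ Set.Icc (b - δ) b := Set.right_mem_Icc.2 (by linarith)
  rcases lt_or_gt_of_ne (hne b hbb) with hb | hb
  · refine main _ _ h.neg fun s hs => ?_
    by_contra! hcon
    obtain ⟨t, ht, ht0⟩ := intermediate_value_Icc' hs.2 h.continuous_fst.continuousOn
      ⟨hb.le, by linarith⟩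
    exact hne t ⟨hs.1.trans ht.1, ht.2⟩ ht0
  · refine main _ _ h fun s hs => ?_
    by_contra! hcon
    obtain ⟨t, ht, ht0⟩ := intermediate_value_Icc hs.2 h.continuous_fst.continuousOn ⟨hcon, hb.le⟩
    exact hne t ⟨hs.1.trans ht.1, ht.2⟩ ht0

/-- Growth away from a zero where `y'' ≥ m² y`: the function `(y' - m y) e^{ms}` is nondecreasing
and is nonnegative at the zero. -/
lemma exp_growth (h : IsRadialSol n κ y p) {a b m : ℝ}
    (hq : ∀ s ∈ Set.Icc a b, m ^ 2 ≤ (n : ℝ) ^ 2 - κ * Real.exp (2 * s))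
    (hy : ∀ s ∈ Set.Icc a b, 0 ≤ y s) (h0 : y a = 0) (hp : 0 ≤ p a) {s t : ℝ} (has : a ≤ s)
    (hst : s ≤ t) (htb : t ≤ b) : y s ≤ Real.exp (-(m * (t - s))) * y t := by
  have hexp : ∀ k s : ℝ, HasDerivAt (fun s => Real.exp (k * s)) (Real.exp (k * s) * k) s :=
    fun k s => by simpa using ((hasDerivAt_id s).const_mul k).exp
  have hd : ∀ s, HasDerivAt (fun s => (p s - m * y s) * Real.exp (m * s))
      (((n : ℝ) ^ 2 - κ * Real.exp (2 * s) - m ^ 2) * y s * Real.exp (m * s)) s := fun s => by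
    refine HasDerivAt.congr_deriv (((h.hasDerivAt_snd s).sub ((h.hasDerivAt_fst s).const_mul m)).mul
      (hexp m s)) ?_
    simp only [Pi.sub_apply]
    ring
  have h1 : MonotoneOn (fun s => (p s - m * y s) * Real.exp (m * s)) (Set.Icc a b) :=
    monotoneOn_of_hasDerivWithinAt_nonneg (convex_Icc _ _)
      (fun s _ => (hd s).continuousAt.continuousWithinAt)
      (fun s _ => (hd s).hasDerivWithinAt) fun s hs => by
        have hs := interior_subset hs
        exact mul_nonneg (mul_nonneg (by linarith [hq s hs]) (hy s hs)) (Real.exp_pos _).le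
  have h2 : ∀ s ∈ Set.Icc a b, 0 ≤ p s - m * y s := fun s hs => by
    have := h1 (Set.left_mem_Icc.2 (hs.1.trans hs.2)) hs hs.1
    simp only [h0, mul_zero, sub_zero] at this
    exact nonneg_of_mul_nonneg_left ((mul_nonneg hp (Real.exp_pos _).le).trans this)
      (Real.exp_pos _)
  have hd3 : ∀ s, HasDerivAt (fun s => y s * Real.exp (-m * s))
      ((p s - m * y s) * Real.exp (-m * s)) s := fun s => by
    refine HasDerivAt.congr_deriv ((h.hasDerivAt_fst s).mul (hexp (-m) s)) ?_
    ring
  have h3 : MonotoneOn (fun s => y s * Real.exp (-m * s)) (Set.Icc a b) :=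
    monotoneOn_of_hasDerivWithinAt_nonneg (convex_Icc _ _)
      (fun s _ => (hd3 s).continuousAt.continuousWithinAt)
      (fun s _ => (hd3 s).hasDerivWithinAt) fun s hs =>
        mul_nonneg (h2 s (interior_subset hs)) (Real.exp_pos _).le
  have h4 := h3 ⟨has, hst.trans htb⟩ ⟨has.trans hst, htb⟩ hst
  simp only at h4
  calc y s = y s * Real.exp (-m * s) * Real.exp (m * s) := by
        rw [mul_assoc, ← Real.exp_add]; simp
    _ ≤ y t * Real.exp (-m * t) * Real.exp (m * s) := by gcongr
    _ = Real.exp (-(m * (t - s))) * y t := by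
        rw [mul_assoc, ← Real.exp_add, mul_comm]; ring_nf

/-- The mirror image of `exp_growth`: decay towards a zero at the right end. -/
lemma exp_decay (h : IsRadialSol n κ y p) {a b m : ℝ}
    (hq : ∀ s ∈ Set.Icc a b, m ^ 2 ≤ (n : ℝ) ^ 2 - κ * Real.exp (2 * s))
    (hy : ∀ s ∈ Set.Icc a b, 0 ≤ y s) (h0 : y b = 0) (hp : p b ≤ 0) {s t : ℝ} (has : a ≤ s)
    (hst : s ≤ t) (htb : t ≤ b) : y t ≤ Real.exp (-(m * (t - s))) * y s := by
  have hexp : ∀ k s : ℝ, HasDerivAt (fun s => Real.exp (k * s)) (Real.exp (k * s) * k) s :=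
    fun k s => by simpa using ((hasDerivAt_id s).const_mul k).exp
  have hd : ∀ s, HasDerivAt (fun s => (p s + m * y s) * Real.exp (-m * s))
      (((n : ℝ) ^ 2 - κ * Real.exp (2 * s) - m ^ 2) * y s * Real.exp (-m * s)) s := fun s => by
    refine HasDerivAt.congr_deriv (((h.hasDerivAt_snd s).add ((h.hasDerivAt_fst s).const_mul m)).mul
      (hexp (-m) s)) ?_
    simp only [Pi.add_apply]
    ring
  have h1 : MonotoneOn (fun s => (p s + m * y s) * Real.exp (-m * s)) (Set.Icc a b) :=
    monotoneOn_of_hasDerivWithinAt_nonneg (convex_Icc _ _)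
      (fun s _ => (hd s).continuousAt.continuousWithinAt)
      (fun s _ => (hd s).hasDerivWithinAt) fun s hs => by
        have hs := interior_subset hs
        exact mul_nonneg (mul_nonneg (by linarith [hq s hs]) (hy s hs)) (Real.exp_pos _).le
  have h2 : ∀ s ∈ Set.Icc a b, p s + m * y s ≤ 0 := fun s hs => by
    have := h1 hs (Set.right_mem_Icc.2 (hs.1.trans hs.2)) hs.2
    simp only [h0, mul_zero, add_zero] at this
    by_contra! hcon
    linarith [mul_pos hcon (Real.exp_pos (-m * s)),
      mul_nonneg (neg_nonneg.2 hp) (Real.exp_pos (-m * b)).le]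
  have hd3 : ∀ s, HasDerivAt (fun s => y s * Real.exp (m * s))
      ((p s + m * y s) * Real.exp (m * s)) s := fun s => by
    refine HasDerivAt.congr_deriv ((h.hasDerivAt_fst s).mul (hexp m s)) ?_
    ring
  have h3 : AntitoneOn (fun s => y s * Real.exp (m * s)) (Set.Icc a b) :=
    antitoneOn_of_hasDerivWithinAt_nonpos (convex_Icc _ _)
      (fun s _ => (hd3 s).continuousAt.continuousWithinAt)
      (fun s _ => (hd3 s).hasDerivWithinAt) fun s hs =>
        mul_nonpos_of_nonpos_of_nonneg (h2 s (interior_subset hs)) (Real.exp_pos _).le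
  have h4 := h3 ⟨has, hst.trans htb⟩ ⟨has.trans hst, htb⟩ hst
  simp only at h4
  calc y t = y t * Real.exp (m * t) * Real.exp (-m * t) := by
        rw [mul_assoc, ← Real.exp_add]; simp
    _ ≤ y s * Real.exp (m * s) * Real.exp (-m * t) := by gcongr
    _ = Real.exp (-(m * (t - s))) * y s := by
        rw [mul_assoc, ← Real.exp_add, mul_comm]; ring_nf

lemma contDiff_fst (h : IsRadialSol n κ y p) : ContDiff ℝ ∞ y := by
  have hy : deriv y = p := funext fun s => (h.hasDerivAt_fst s).deriv
  have hp : deriv p = fun s => ((n : ℝ) ^ 2 - κ * Real.exp (2 * s)) * y s :=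
    funext fun s => (h.hasDerivAt_snd s).deriv
  have key : ∀ k : ℕ, ContDiff ℝ k y ∧ ContDiff ℝ k p := by
    intro k
    induction k with
    | zero => exact ⟨contDiff_zero.2 h.continuous_fst, contDiff_zero.2 h.continuous_snd⟩
    | succ k ih =>
      refine ⟨?_, ?_⟩
      · rw [Nat.cast_succ, contDiff_succ_iff_deriv]
        exact ⟨fun s => (h.hasDerivAt_fst s).differentiableAt, by simp, hy ▸ ih.2⟩
      · rw [Nat.cast_succ, contDiff_succ_iff_deriv]
        refine ⟨fun s => (h.hasDerivAt_snd s).differentiableAt, by simp, ?_⟩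
        rw [hp]
        have := ih.1
        fun_prop
  exact contDiff_infty.2 fun k => (key k).1

end IsRadialSol

lemma nonpos_of_hasDerivAt_of_nonneg_left {y : ℝ → ℝ} {a b d : ℝ} (hab : a < b)
    (h : HasDerivAt y d b) (hb : y b = 0) (hy : ∀ s ∈ Set.Icc a b, 0 ≤ y s) : d ≤ 0 := by
  have h1 := hasDerivWithinAt_iff_tendsto_slope' (s := Set.Iio b) (by simp) |>.1
    (h.hasDerivWithinAt (s := Set.Iio b))
  refine le_of_tendsto h1 ?_
  filter_upwards [Ioo_mem_nhdsLT hab] with s hs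
  rw [slope_def_field, hb]
  exact div_nonpos_of_nonneg_of_nonpos (by linarith [hy s ⟨hs.1.le, hs.2.le⟩]) (by linarith [hs.2])

lemma nonneg_of_hasDerivAt_of_nonneg_right {y : ℝ → ℝ} {a b d : ℝ} (hab : a < b)
    (h : HasDerivAt y d a) (ha : y a = 0) (hy : ∀ s ∈ Set.Icc a b, 0 ≤ y s) : 0 ≤ d := by
  have h1 := hasDerivWithinAt_iff_tendsto_slope' (s := Set.Ioi a) (by simp) |>.1
    (h.hasDerivWithinAt (s := Set.Ioi a))
  refine ge_of_tendsto h1 ?_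
  filter_upwards [Ioo_mem_nhdsGT hab] with s hs
  rw [slope_def_field, ha]
  exact div_nonneg (by linarith [hy s ⟨hs.1.le, hs.2.le⟩]) (by linarith [hs.1])

/-! ### Radial eigenfunctions by shooting -/

/-- A radial eigenfunction of angular momentum `n` with eigenvalue `l`, in the variable `s = log r`:
the pair `(ym, pm)` is the function and its derivative on `[s₀, S]`, the pair `(yp, pp)` on
`[S, s₂]`, where `S = log R₁` is the interface. Both branches are defined on the whole line. -/
structure IsRadialEigenfunction (s₀ S s₂ cm cp : ℝ) (n : ℕ) (l : ℝ) (ym pm yp pp : ℝ → ℝ) :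
    Prop where
  sol_inner : IsRadialSol n (l / cm) ym pm
  sol_outer : IsRadialSol n (l / cp) yp pp
  inner_left : ym s₀ = 0
  outer_right : yp s₂ = 0
  continuity : ym S = yp S
  flux : cm * pm S = cp * pp S

/-- A nonnegative radial eigenfunction, nontrivial because of its slope at the inner boundary. -/
structure IsRadialMode (s₀ S s₂ cm cp : ℝ) (n : ℕ) (l : ℝ) (ym pm yp pp : ℝ → ℝ) : Prop
    extends IsRadialEigenfunction s₀ S s₂ cm cp n l ym pm yp pp where
  inner_left_deriv : 0 < pm s₀
  inner_nonneg : ∀ s ∈ Set.Icc s₀ S, 0 ≤ ym s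
  outer_nonneg : ∀ s ∈ Set.Icc S s₂, 0 ≤ yp s

section Shooting

variable {s₀ S s₂ cm cp : ℝ}

lemma IsRadialEigenfunction.const_mul {n : ℕ} {l : ℝ} {ym pm yp pp : ℝ → ℝ}
    (h : IsRadialEigenfunction s₀ S s₂ cm cp n l ym pm yp pp) (t : ℝ) :
    IsRadialEigenfunction s₀ S s₂ cm cp n l (fun s => t * ym s) (fun s => t * pm s)
      (fun s => t * yp s) (fun s => t * pp s) where
  sol_inner := h.sol_inner.const_mul t
  sol_outer := h.sol_outer.const_mul t
  inner_left := by rw [h.inner_left, mul_zero]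
  outer_right := by rw [h.outer_right, mul_zero]
  continuity := by rw [h.continuity]
  flux := by linear_combination t * h.flux

lemma IsRadialMode.const_mul {n : ℕ} {l : ℝ} {ym pm yp pp : ℝ → ℝ}
    (h : IsRadialMode s₀ S s₂ cm cp n l ym pm yp pp) {t : ℝ} (ht : 0 < t) :
    IsRadialMode s₀ S s₂ cm cp n l (fun s => t * ym s) (fun s => t * pm s)
      (fun s => t * yp s) (fun s => t * pp s) where
  toIsRadialEigenfunction := h.toIsRadialEigenfunction.const_mul t
  inner_left_deriv := mul_pos ht h.inner_left_deriv
  inner_nonneg s hs := mul_nonneg ht.le (h.inner_nonneg s hs)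
  outer_nonneg s hs := mul_nonneg ht.le (h.outer_nonneg s hs)

/-- For `l ≤ E₀ n²` the coefficient `n² - (l / c) r²` is nonnegative on both sides of the
interface. -/
lemma coeff_nonneg_of_le (hcm : 0 < cm)
    (hc : cm / Real.exp (2 * S) < cp / Real.exp (2 * s₂)) {n : ℕ} {l : ℝ}
    (hl : l ≤ cm / Real.exp (2 * S) * (n : ℝ) ^ 2) (hl0 : 0 ≤ l) (hcp : 0 < cp) :
    (∀ s ≤ S, 0 ≤ (n : ℝ) ^ 2 - l / cm * Real.exp (2 * s)) ∧
    (∀ s ≤ s₂, 0 ≤ (n : ℝ) ^ 2 - l / cp * Real.exp (2 * s)) := by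
  refine ⟨fun s hs => ?_, fun s hs => ?_⟩
  · have h1 : Real.exp (2 * s) ≤ Real.exp (2 * S) := Real.exp_le_exp.2 (by linarith)
    have h2 : l / cm * Real.exp (2 * s) ≤ l / cm * Real.exp (2 * S) := by gcongr
    have h3 : l / cm * Real.exp (2 * S) ≤
        (cm / Real.exp (2 * S) * (n : ℝ) ^ 2) / cm * Real.exp (2 * S) := by gcongr
    have h4 : (cm / Real.exp (2 * S) * (n : ℝ) ^ 2) / cm * Real.exp (2 * S) = (n : ℝ) ^ 2 := by
      field_simp
    linarith
  · have h1 : Real.exp (2 * s) ≤ Real.exp (2 * s₂) := Real.exp_le_exp.2 (by linarith)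
    have h2 : l / cp * Real.exp (2 * s) ≤ l / cp * Real.exp (2 * s₂) := by gcongr
    have h3 : l / cp * Real.exp (2 * s₂) ≤
        (cp / Real.exp (2 * s₂) * (n : ℝ) ^ 2) / cp * Real.exp (2 * s₂) := by
      gcongr
      exact hl.trans (by gcongr)
    have h4 : (cp / Real.exp (2 * s₂) * (n : ℝ) ^ 2) / cp * Real.exp (2 * s₂) = (n : ℝ) ^ 2 := by
      field_simp
    linarith

/-- Existence of a nonnegative mode by shooting from the inner boundary. Among the parameters
`l ≥ E₀ n²` for which the solution vanishes somewhere in `(s₀, s₂]`, take the least one: there the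
solution is nonnegative, and its zero can only be at the right end, since an interior zero would be
a double one. The Sturm comparison theorem on an interval of length `δ` to the left of the
interface bounds that parameter from above. -/
theorem exists_isRadialMode (hS₀ : s₀ < S) (hS₂ : S < s₂) (hcm : 0 < cm)
    (hc : cm / Real.exp (2 * S) < cp / Real.exp (2 * s₂)) (n : ℕ) {δ : ℝ} (hδ : 0 < δ)
    (hδS : δ < S - s₀) :
    ∃ (l : ℝ) (ym pm yp pp : ℝ → ℝ), IsRadialMode s₀ S s₂ cm cp n l ym pm yp pp ∧
      cm / Real.exp (2 * S) * (n : ℝ) ^ 2 ≤ l ∧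
      l ≤ cm / Real.exp (2 * S) * Real.exp (2 * δ) * ((n : ℝ) ^ 2 + (Real.pi / δ) ^ 2) := by
  have hE : 0 < cm / Real.exp (2 * S) := by positivity
  have hcp : 0 < cp := by
    by_contra! h
    exact absurd (hE.trans hc) (not_lt.2 (div_nonpos_of_nonpos_of_nonneg h (Real.exp_pos _).le))
  set a := cm / Real.exp (2 * S) * (n : ℝ) ^ 2 with ha
  set b := cm / Real.exp (2 * S) * Real.exp (2 * δ) * ((n : ℝ) ^ 2 + (Real.pi / δ) ^ 2) with hb
  have ha0 : 0 ≤ a := by positivity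
  have hab : a ≤ b := by
    have h1 : (1 : ℝ) ≤ Real.exp (2 * δ) := Real.one_le_exp (by positivity)
    have h2 : (n : ℝ) ^ 2 ≤ (n : ℝ) ^ 2 + (Real.pi / δ) ^ 2 := by linarith [sq_nonneg (Real.pi / δ)]
    calc a = cm / Real.exp (2 * S) * 1 * (n : ℝ) ^ 2 := by rw [ha]; ring
      _ ≤ b := by rw [hb]; gcongr
  obtain ⟨ym, pm, hymc, hpmc, hym0, hpm0, hm⟩ := exists_isRadialSol n cm s₀
    (a := fun _ => 0) (b := fun _ => 1) continuous_const continuous_const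
  have hymS : Continuous fun l => ym l S :=
    hymc.comp (by fun_prop : Continuous fun l : ℝ => (l, S))
  have hpmS : Continuous fun l => cm / cp * pm l S :=
    continuous_const.mul (hpmc.comp (by fun_prop : Continuous fun l : ℝ => (l, S)))
  obtain ⟨yp, pp, hypc, hppc, hyp0, hpp0, hp⟩ := exists_isRadialSol n cp S hymS hpmS
  -- the solution launched from the inner boundary, as a function of the parameter and of `s`
  let Y : ℝ × ℝ → ℝ := fun z => if z.2 ≤ S then ym z.1 z.2 else yp z.1 z.2
  have hY : Continuous Y := by
    refine Continuous.if_le hymc hypc continuous_snd continuous_const ?_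
    rintro ⟨l, s⟩ (rfl : s = S)
    exact (hyp0 l).symm
  have hYm : ∀ l s, s ≤ S → Y (l, s) = ym l s := fun l s h => if_pos h
  have hYp : ∀ l s, S ≤ s → Y (l, s) = yp l s := fun l s h => by
    rcases h.eq_or_lt with rfl | h
    · rw [hYm l S le_rfl, hyp0]
    · exact if_neg (not_le.2 h)
  have hflux : ∀ l, cm * pm l S = cp * pp l S := fun l => by rw [hpp0]; field_simp
  -- the solution vanishes only at `s₀` near `s₀`, uniformly in the parameter
  obtain ⟨ε, hε, hεS, hεpos⟩ : ∃ ε > 0, ε < S - δ - s₀ ∧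
      ∀ l ∈ Set.Icc a b, ∀ s ∈ Set.Ioc s₀ (s₀ + ε), 0 < Y (l, s) := by
    have h1 : ∀ᶠ s in 𝓝 s₀, ∀ l ∈ Set.Icc a b, 0 < pm l s := by
      refine isCompact_Icc.eventually_forall_of_forall_eventually fun l _ => ?_
      have : ContinuousAt (fun z : ℝ × ℝ => pm z.2 z.1) (s₀, l) :=
        (hpmc.comp continuous_swap).continuousAt
      exact this.eventually (lt_mem_nhds (by simp [hpm0]))
    obtain ⟨r, hr, hr'⟩ := Metric.eventually_nhds_iff.1 h1
    have hr2 : 0 < min (r / 2) ((S - δ - s₀) / 2) := lt_min (by linarith) (by linarith)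
    refine ⟨min (r / 2) ((S - δ - s₀) / 2), hr2, (min_le_right _ _).trans_lt (by linarith), ?_⟩
    intro l hl s hs
    have hsr : s ≤ s₀ + r / 2 := hs.2.trans (by gcongr; exact min_le_left _ _)
    have hsS : s ≤ s₀ + (S - δ - s₀) / 2 := hs.2.trans (by gcongr; exact min_le_right _ _)
    rw [hYm l s (by linarith)]
    have hmono : StrictMonoOn (ym l) (Set.Icc s₀ s) := by
      refine strictMonoOn_of_deriv_pos (convex_Icc s₀ s) (hm l).continuous_fst.continuousOn ?_
      intro x hx
      rw [interior_Icc] at hx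
      rw [((hm l).hasDerivAt_fst x).deriv]
      refine hr' ?_ l hl
      rw [Real.dist_eq, abs_of_pos (by linarith [hx.1])]
      linarith [hx.2]
    have := hmono (Set.left_mem_Icc.2 hs.1.le) (Set.right_mem_Icc.2 hs.1.le) hs.1
    rwa [hym0] at this
  let T : Set (ℝ × ℝ) := (Set.Icc a b ×ˢ Set.Icc (s₀ + ε) s₂) ∩ Y ⁻¹' {0}
  have hT : IsCompact T :=
    (isCompact_Icc.prod isCompact_Icc).inter_right (isClosed_singleton.preimage hY)
  have hTne : T.Nonempty := by
    obtain ⟨s, hs, hs0⟩ := (hm b).exists_zero_of_coeff_le (b := S) hδ fun s hs => by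
      have h1 : Real.exp (2 * (S - δ)) ≤ Real.exp (2 * s) :=
        Real.exp_le_exp.2 (by linarith [hs.1])
      have h2 : b / cm * Real.exp (2 * (S - δ)) = (n : ℝ) ^ 2 + (Real.pi / δ) ^ 2 := by
        rw [hb, show 2 * (S - δ) = 2 * S - 2 * δ by ring, Real.exp_sub]
        field_simp
      have h3 : 0 ≤ b / cm := div_nonneg (ha0.trans hab) hcm.le
      have h4 := mul_le_mul_of_nonneg_left h1 h3
      linarith
    exact ⟨(b, s), ⟨Set.right_mem_Icc.2 hab, by linarith [hs.1], by linarith [hs.2]⟩, by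
      simp [hYm b s hs.2, hs0]⟩
  obtain ⟨⟨l, t⟩, ⟨⟨hl, ht⟩, hlt⟩, hmin⟩ := hT.exists_isMinOn hTne continuous_fst.continuousOn
  have hlt : Y (l, t) = 0 := hlt
  have hl : l ∈ Set.Icc a b := hl
  have ht : t ∈ Set.Icc (s₀ + ε) s₂ := ht
  have hs₀t : s₀ < t := by linarith [ht.1]
  have hpos : ∀ l' ∈ Set.Ico a l, ∀ s ∈ Set.Ioc s₀ s₂, 0 < Y (l', s) := by
    intro l' hl' s hs
    have hl'b : l' ∈ Set.Icc a b := ⟨hl'.1, hl'.2.le.trans hl.2⟩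
    rcases le_or_gt s (s₀ + ε) with h | h
    · exact hεpos l' hl'b s ⟨hs.1, h⟩
    · by_contra! hcon
      have hcont : ContinuousOn (fun s => Y (l', s)) (Set.Icc (s₀ + ε) s) :=
        (hY.comp (by fun_prop : Continuous fun s : ℝ => (l', s))).continuousOn
      obtain ⟨x, hx, hx0⟩ := intermediate_value_Icc' h.le hcont
        ⟨hcon, (hεpos l' hl'b _ ⟨by linarith, le_rfl⟩).le⟩
      have := hmin (show (l', x) ∈ T from ⟨⟨hl'b, hx.1, hx.2.trans hs.2⟩, hx0⟩)
      exact absurd this (not_le.2 hl'.2)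
  have hal : a < l := by
    refine lt_of_le_of_ne hl.1 fun hal => ?_
    obtain ⟨hq1, hq2⟩ := coeff_nonneg_of_le hcm hc (n := n) (l := l) hal.ge (ha0.trans hl.1) hcp
    have h1 := (hm l).pos_of_coeff_nonneg_of_eq_zero (b := S) (fun s hs => hq1 s hs.2) (hym0 l)
      (by rw [hpm0]; norm_num)
    have hSS := h1 S ⟨hS₀, le_rfl⟩
    rcases le_or_gt t S with h | h
    · exact (h1 t ⟨hs₀t, h⟩).1.ne' (by rw [← hYm l t h, hlt])
    · have h2 := (hp l).pos_of_coeff_nonneg (b := s₂) (fun s hs => hq2 s hs.2)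
        (by rw [hyp0]; exact hSS.1) (by rw [hpp0]; exact mul_nonneg (by positivity) hSS.2)
      exact (h2 t ⟨h.le, ht.2⟩).1.ne' (by rw [← hYp l t h.le, hlt])
  have hnonneg : ∀ s ∈ Set.Icc s₀ s₂, 0 ≤ Y (l, s) := by
    intro s hs
    rcases hs.1.eq_or_lt with rfl | h
    · rw [hYm _ _ hS₀.le, hym0]
    · have hcont : Tendsto (fun l' => Y (l', s)) (𝓝[<] l) (𝓝 (Y (l, s))) :=
        ((hY.comp (by fun_prop : Continuous fun l : ℝ => (l, s))).continuousAt).mono_left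
          nhdsWithin_le_nhds
      refine ge_of_tendsto hcont ?_
      filter_upwards [Ico_mem_nhdsLT hal] with l' hl'
      exact (hpos l' hl' s ⟨h, hs.2⟩).le
  have hmn : ∀ s ∈ Set.Icc s₀ S, 0 ≤ ym l s := fun s hs => by
    rw [← hYm l s hs.2]; exact hnonneg s ⟨hs.1, hs.2.trans hS₂.le⟩
  have hpn : ∀ s ∈ Set.Icc S s₂, 0 ≤ yp l s := fun s hs => by
    rw [← hYp l s hs.1]; exact hnonneg s ⟨hS₀.le.trans hs.1, hs.2⟩
  have hnot : ∀ t, ym l t = 0 → pm l t ≠ 0 := fun t h1 h2 => by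
    have := ((hm l).eq_zero_of_double_zero h1 h2 s₀).2
    rw [hpm0] at this
    exact one_ne_zero this
  have hnotS : yp l S = 0 → pp l S ≠ 0 := fun h1 h2 => by
    refine hnot S (by rw [← hyp0, h1]) ?_
    have := hflux l
    rw [h2, mul_zero] at this
    exact (mul_eq_zero.1 this).resolve_left hcm.ne'
  have hts₂ : t = s₂ := by
    by_contra hne
    have htlt : t < s₂ := lt_of_le_of_ne ht.2 hne
    rcases lt_trichotomy t S with h | h | h
    · have h0 : ym l t = 0 := by rw [← hYm l t h.le, hlt]
      refine hnot t h0 (IsLocalMin.hasDerivAt_eq_zero ?_ ((hm l).hasDerivAt_fst t))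
      filter_upwards [Icc_mem_nhds hs₀t h] with s hs
      rw [h0]; exact hmn s hs
    · subst h
      have h0 : ym l t = 0 := by rw [← hYm l t le_rfl, hlt]
      have h1 := nonpos_of_hasDerivAt_of_nonneg_left hS₀ ((hm l).hasDerivAt_fst t) h0 hmn
      have h2 := nonneg_of_hasDerivAt_of_nonneg_right hS₂ ((hp l).hasDerivAt_fst t)
        (by rw [hyp0, h0]) hpn
      have h3 := hflux l
      have h4 : pm l t = 0 := by nlinarith [mul_nonneg hcp.le h2]
      exact hnot t h0 h4
    · have h0 : yp l t = 0 := by rw [← hYp l t h.le, hlt]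
      have h1 : pp l t = 0 := by
        refine IsLocalMin.hasDerivAt_eq_zero ?_ ((hp l).hasDerivAt_fst t)
        filter_upwards [Icc_mem_nhds h htlt] with s hs
        rw [h0]; exact hpn s hs
      obtain ⟨h2, h3⟩ := (hp l).eq_zero_of_double_zero h0 h1 S
      exact hnotS h2 h3
  refine ⟨l, ym l, pm l, yp l, pp l, ⟨⟨hm l, hp l, hym0 l, ?_, (hyp0 l).symm, hflux l⟩,
    by rw [hpm0]; exact one_pos, hmn, hpn⟩, hl.1, hl.2⟩
  rw [← hYp l s₂ hS₂.le, ← hts₂, hlt]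

end Shooting

/-! ### Partial derivatives and integration by parts -/

section PartialDeriv

variable {f g : Plane → ℂ} {x : Plane} {i : Fin 2}

lemma partialDeriv_mul (hf : DifferentiableAt ℝ f x) (hg : DifferentiableAt ℝ g x) :
    partialDeriv i (fun x => f x * g x) x = f x * partialDeriv i g x + partialDeriv i f x * g x := by
  simp only [partialDeriv]
  rw [fderiv_fun_mul hf hg]
  simp [mul_comm]

lemma partialDeriv_add (hf : DifferentiableAt ℝ f x) (hg : DifferentiableAt ℝ g x) :
    partialDeriv i (fun x => f x + g x) x = partialDeriv i f x + partialDeriv i g x := by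
  simp only [partialDeriv]
  rw [fderiv_fun_add hf hg]
  simp

lemma partialDeriv_sub (hf : DifferentiableAt ℝ f x) (hg : DifferentiableAt ℝ g x) :
    partialDeriv i (fun x => f x - g x) x = partialDeriv i f x - partialDeriv i g x := by
  simp only [partialDeriv]
  rw [fderiv_fun_sub hf hg]
  simp

lemma partialDeriv_const_mul (c : ℂ) (hf : DifferentiableAt ℝ f x) :
    partialDeriv i (fun x => c * f x) x = c * partialDeriv i f x := by
  simp only [partialDeriv]
  rw [fderiv_const_mul hf]
  simp

lemma continuous_partialDeriv (hf : ContDiff ℝ 1 f) (i : Fin 2) :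
    Continuous (partialDeriv i f) :=
  (hf.continuous_fderiv (by simp)).clm_apply continuous_const

lemma contDiff_partialDeriv {m k : WithTop ℕ∞} (hf : ContDiff ℝ m f) (hk : k + 1 ≤ m) (i : Fin 2) :
    ContDiff ℝ k (partialDeriv i f) :=
  (hf.fderiv_right hk).clm_apply contDiff_const

lemma tsupport_partialDeriv_subset (i : Fin 2) (f : Plane → ℂ) :
    tsupport (partialDeriv i f) ⊆ tsupport f :=
  (closure_mono fun x hx => by
    rw [Function.mem_support] at hx ⊢
    exact fun h => hx (by simp [partialDeriv, h])).trans
    ((tsupport_fderiv_subset ℝ (f := f)))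

lemma hasCompactSupport_partialDeriv (hf : HasCompactSupport f) (i : Fin 2) :
    HasCompactSupport (partialDeriv i f) :=
  hf.mono' ((subset_tsupport _).trans (tsupport_partialDeriv_subset i f))

lemma integral_partialDeriv_eq_zero (hf : ContDiff ℝ 1 f) (hc : HasCompactSupport f) (i : Fin 2) :
    ∫ x, partialDeriv i f x = 0 := by
  have h := integral_smul_fderiv_eq_neg_fderiv_smul_of_integrable (μ := (volume : Measure Plane))
    (f := fun _ : Plane => (1 : ℝ)) (g := f) (v := EuclideanSpace.single i (1 : ℝ)) (𝕜 := ℝ)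
    (by simp) ?_ ?_ ?_ ?_
  · simpa [partialDeriv] using h
  · simp only [one_smul]
    exact (continuous_partialDeriv hf i).integrable_of_hasCompactSupport
      (hasCompactSupport_partialDeriv hc i)
  · simp only [one_smul]
    exact hf.continuous.integrable_of_hasCompactSupport hc
  · exact fun x _ => differentiableAt_const _
  · exact fun x _ => (hf.differentiable one_ne_zero) x

end PartialDeriv

/-! ### Cutting off along a circle -/

/-- The cutoff rises from `0` to `1` in a layer of width of order `1 / k` around the circle of
radius `R`; the parameter `b` fixes the position of the layer. -/
noncomputable def circleCutoff (R b : ℝ) (k : ℕ) (x : Plane) : ℝ :=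
  Real.smoothTransition (k * (‖x‖ ^ 2 - R ^ 2) + b)

/-- The derivative of `circleCutoff` with respect to `‖x‖²`. -/
noncomputable def circleCutoffDeriv (R b : ℝ) (k : ℕ) (x : Plane) : ℝ :=
  k * deriv Real.smoothTransition (k * (‖x‖ ^ 2 - R ^ 2) + b)

section Cutoff

variable {R b : ℝ}

lemma contDiff_circleCutoff (R b : ℝ) (k : ℕ) {m : ℕ∞} : ContDiff ℝ m (circleCutoff R b k) := by
  have h : ContDiff ℝ m fun x : Plane => (k : ℝ) * (‖x‖ ^ 2 - R ^ 2) + b :=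
    (contDiff_const.mul ((contDiff_norm_sq ℝ).sub contDiff_const)).add contDiff_const
  exact Real.smoothTransition.contDiff.comp h

lemma partialDeriv_circleCutoff (R b : ℝ) (k : ℕ) (i : Fin 2) (x : Plane) :
    partialDeriv i (fun x => (circleCutoff R b k x : ℂ)) x =
      (circleCutoffDeriv R b k x * (2 * x i) : ℝ) := by
  have h1 : HasFDerivAt (fun x : Plane => (k : ℝ) * (‖x‖ ^ 2 - R ^ 2) + b)
      ((k : ℝ) • (2 • (innerSL ℝ x))) x :=
    (((hasStrictFDerivAt_norm_sq x).hasFDerivAt.sub_const _).const_mul _).add_const _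
  have h2 : HasDerivAt Real.smoothTransition
      (deriv Real.smoothTransition (k * (‖x‖ ^ 2 - R ^ 2) + b)) (k * (‖x‖ ^ 2 - R ^ 2) + b) :=
    ((Real.smoothTransition.contDiff (n := 1)).differentiable one_ne_zero _).hasDerivAt
  have h3 := h2.comp_hasFDerivAt x h1
  have h4 : HasFDerivAt (fun x => (circleCutoff R b k x : ℂ)) _ x :=
    Complex.ofRealCLM.hasFDerivAt.comp x h3
  rw [partialDeriv, h4.fderiv]
  simp [circleCutoffDeriv, EuclideanSpace.inner_single_right]
  ring

lemma circleCutoff_nonneg (k : ℕ) (x : Plane) : 0 ≤ circleCutoff R b k x :=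
  Real.smoothTransition.nonneg _

lemma circleCutoff_le_one (k : ℕ) (x : Plane) : circleCutoff R b k x ≤ 1 :=
  Real.smoothTransition.le_one _

lemma deriv_smoothTransition_of_neg {t : ℝ} (ht : t < 0) : deriv Real.smoothTransition t = 0 := by
  have : Real.smoothTransition =ᶠ[𝓝 t] fun _ => 0 := by
    filter_upwards [gt_mem_nhds ht] with s hs using Real.smoothTransition.zero_of_nonpos hs.le
  rw [this.deriv_eq]; simp

lemma deriv_smoothTransition_of_one_lt {t : ℝ} (ht : 1 < t) :
    deriv Real.smoothTransition t = 0 := by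
  have : Real.smoothTransition =ᶠ[𝓝 t] fun _ => 1 := by
    filter_upwards [lt_mem_nhds ht] with s hs using Real.smoothTransition.one_of_one_le hs.le
  rw [this.deriv_eq]; simp

lemma exists_bound_deriv_smoothTransition : ∃ C, ∀ t, |deriv Real.smoothTransition t| ≤ C := by
  have hc : Continuous (deriv Real.smoothTransition) :=
    (Real.smoothTransition.contDiff (n := 1)).continuous_deriv le_rfl
  obtain ⟨C, hC⟩ := (isCompact_Icc (a := (0 : ℝ)) (b := 1)).exists_bound_of_continuousOn
    hc.continuousOn
  refine ⟨max C 0, fun t => ?_⟩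
  rcases lt_or_ge t 0 with h | h
  · simp [deriv_smoothTransition_of_neg h]
  rcases lt_or_ge 1 t with h' | h'
  · simp [deriv_smoothTransition_of_one_lt h']
  · exact (hC t ⟨h, h'⟩).trans (le_max_left _ _)

lemma tendsto_circleCutoff_arg {x : Plane} :
    (‖x‖ ^ 2 < R ^ 2 → Tendsto (fun k : ℕ => (k : ℝ) * (‖x‖ ^ 2 - R ^ 2) + b) atTop atBot) ∧
    (R ^ 2 < ‖x‖ ^ 2 → Tendsto (fun k : ℕ => (k : ℝ) * (‖x‖ ^ 2 - R ^ 2) + b) atTop atTop) :=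
  ⟨fun h => tendsto_atBot_add_const_right _ _
      (tendsto_natCast_atTop_atTop.atTop_mul_const_of_neg (by linarith)),
    fun h => tendsto_atTop_add_const_right _ _
      (tendsto_natCast_atTop_atTop.atTop_mul_const (by linarith))⟩

lemma eventually_circleCutoff_eq (hR : 0 < R) {x : Plane} (hx : ‖x‖ ≠ R) :
    ∀ᶠ k in atTop, circleCutoff R b k x = (if R < ‖x‖ then 1 else 0) ∧
      circleCutoffDeriv R b k x = 0 := by
  rcases lt_or_gt_of_ne hx with h | h
  · have h2 : ‖x‖ ^ 2 < R ^ 2 := by gcongr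
    filter_upwards [(tendsto_circleCutoff_arg (b := b)).1 h2 |>.eventually_lt_atBot 0] with k hk
    exact ⟨by rw [if_neg (not_lt.2 h.le)]; exact Real.smoothTransition.zero_of_nonpos hk.le,
      by simp [circleCutoffDeriv, deriv_smoothTransition_of_neg hk]⟩
  · have h2 : R ^ 2 < ‖x‖ ^ 2 := by gcongr
    filter_upwards [(tendsto_circleCutoff_arg (b := b)).2 h2 |>.eventually_gt_atTop 1] with k hk
    exact ⟨by rw [if_pos h]; exact Real.smoothTransition.one_of_one_le hk.le,
      by simp [circleCutoffDeriv, deriv_smoothTransition_of_one_lt hk]⟩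

lemma ae_norm_ne (hR : 0 < R) (U : Set Plane) : ∀ᵐ x ∂(volume.restrict U), ‖x‖ ≠ R := by
  refine ae_restrict_of_ae ?_
  have h : (volume : Measure Plane) (Metric.sphere 0 R) = 0 :=
    Measure.addHaar_sphere_of_ne_zero _ _ hR.ne'
  filter_upwards [compl_mem_ae_iff.2 h] with x hx
  simpa using hx

/-- The distance from a point to the circle is attained by radial projection. -/
lemma exists_norm_eq_norm_sub_eq (hR : 0 < R) (x : Plane) :
    ∃ z : Plane, ‖z‖ = R ∧ ‖x - z‖ = |‖x‖ - R| := by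
  rcases eq_or_ne x 0 with rfl | hx0
  · refine ⟨EuclideanSpace.single 0 R, ?_, ?_⟩ <;> simp [abs_of_pos hR]
  · have hn : ‖x‖ ≠ 0 := norm_ne_zero_iff.2 hx0
    refine ⟨(R / ‖x‖) • x, ?_, ?_⟩
    · rw [norm_smul, Real.norm_of_nonneg (by positivity)]; field_simp
    · rw [show x - (R / ‖x‖) • x = (1 - R / ‖x‖) • x by rw [sub_smul, one_smul], norm_smul,
        Real.norm_eq_abs, ← abs_of_nonneg (norm_nonneg x), ← abs_mul, abs_of_nonneg (norm_nonneg x)]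
      congr 1; field_simp

/-- A `C¹` function vanishing on the circle is at most of the order of the distance to the
circle. -/
lemma exists_norm_le_of_eq_zero_on_circle (hR : 0 < R) {F : Plane → ℂ} (hF : ContDiff ℝ 1 F)
    (h0 : ∀ x, ‖x‖ = R → F x = 0) (M : ℝ) :
    ∃ C, 0 ≤ C ∧ ∀ x, ‖x‖ ≤ M → ‖F x‖ ≤ C * |‖x‖ ^ 2 - R ^ 2| := by
  have hcomp : IsCompact (Metric.closedBall (0 : Plane) (max M R)) := isCompact_closedBall _ _
  obtain ⟨K, hK⟩ := (hF.locallyLipschitz.locallyLipschitzOn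
    (s := Metric.closedBall (0 : Plane) (max M R))).exists_lipschitzOnWith_of_compact hcomp
  refine ⟨K / R, by positivity, fun x hx => ?_⟩
  obtain ⟨z, hz, hxz⟩ := exists_norm_eq_norm_sub_eq hR x
  have h1 := hK.dist_le_mul x (by simpa using hx.trans (le_max_left _ _)) z (by simp [hz])
  rw [h0 z hz, dist_zero_right, dist_eq_norm, hxz] at h1
  have h2 : |‖x‖ ^ 2 - R ^ 2| = |‖x‖ - R| * (‖x‖ + R) := by
    rw [show ‖x‖ ^ 2 - R ^ 2 = (‖x‖ - R) * (‖x‖ + R) by ring, abs_mul,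
      abs_of_nonneg (by positivity : 0 ≤ ‖x‖ + R)]
  rw [h2]
  calc ‖F x‖ ≤ K * |‖x‖ - R| := h1
    _ = K / R * (|‖x‖ - R| * R) := by field_simp
    _ ≤ K / R * (|‖x‖ - R| * (‖x‖ + R)) := by gcongr; linarith [norm_nonneg x]

/-- The derivative of the cutoff is of order `k`, in a layer of width of order `1 / k`, so its product
with a function vanishing on the circle stays bounded. -/
lemma exists_bound_circleCutoffDeriv_mul (hR : 0 < R) (b : ℝ) {F : Plane → ℂ}
    (hF : ContDiff ℝ 1 F) (h0 : ∀ x, ‖x‖ = R → F x = 0) (M : ℝ) :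
    ∃ C, 0 ≤ C ∧ ∀ k x, ‖x‖ ≤ M → ‖(circleCutoffDeriv R b k x : ℂ) * F x‖ ≤ C := by
  obtain ⟨C₁, hC₁, hF1⟩ := exists_norm_le_of_eq_zero_on_circle hR hF h0 M
  obtain ⟨C₂, hC₂⟩ := exists_bound_deriv_smoothTransition
  have hC₂0 : 0 ≤ C₂ := (abs_nonneg _).trans (hC₂ 0)
  refine ⟨C₂ * (C₁ * (1 + |b|)), by positivity, fun k x hx => ?_⟩
  rw [norm_mul, Complex.norm_real, Real.norm_eq_abs, circleCutoffDeriv]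
  set t := (k : ℝ) * (‖x‖ ^ 2 - R ^ 2) + b with ht
  by_cases h : 0 ≤ t ∧ t ≤ 1
  · have h1 : (k : ℝ) * |‖x‖ ^ 2 - R ^ 2| ≤ 1 + |b| := by
      rw [← Nat.abs_cast (R := ℝ) k, ← abs_mul,
        show (k : ℝ) * (‖x‖ ^ 2 - R ^ 2) = t - b by rw [ht]; ring]
      exact (abs_sub _ _).trans (by gcongr; rw [abs_of_nonneg h.1]; exact h.2)
    rw [abs_mul, Nat.abs_cast]
    calc (k : ℝ) * |deriv Real.smoothTransition t| * ‖F x‖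
        ≤ (k : ℝ) * C₂ * (C₁ * |‖x‖ ^ 2 - R ^ 2|) := by
          gcongr
          · exact hC₂ t
          · exact hF1 x hx
      _ = C₂ * (C₁ * ((k : ℝ) * |‖x‖ ^ 2 - R ^ 2|)) := by ring
      _ ≤ C₂ * (C₁ * (1 + |b|)) := by gcongr
  · have : deriv Real.smoothTransition t = 0 := by
      rw [not_and_or, not_le, not_le] at h
      exact h.elim deriv_smoothTransition_of_neg deriv_smoothTransition_of_one_lt
    rw [this]
    simp only [mul_zero, abs_zero, zero_mul]
    positivity

end Cutoff

lemma measurableSet_norm_gt (R : ℝ) : MeasurableSet {x : Plane | R < ‖x‖} :=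
  measurableSet_lt measurable_const measurable_norm

lemma aestronglyMeasurable_exterior {f : Plane → ℂ} (hf : Continuous f) (R : ℝ)
    (μ : Measure Plane) : AEStronglyMeasurable (fun x => if R < ‖x‖ then f x else 0) μ :=
  (StronglyMeasurable.ite (measurableSet_norm_gt R) hf.stronglyMeasurable
    stronglyMeasurable_zero).aestronglyMeasurable

lemma integrable_exterior {f : Plane → ℂ} (hf : Integrable f) (R : ℝ) :
    Integrable fun x => if R < ‖x‖ then f x else 0 :=
  (integrable_indicator_iff (measurableSet_norm_gt R)).2 hf.integrableOn

lemma norm_ite_zero_le (P : Prop) [Decidable P] (z : ℂ) : ‖if P then z else 0‖ ≤ ‖z‖ := by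
  split_ifs <;> simp

section Test

variable {U : Set Plane} {φ : Plane → ℂ}

lemma IsTestFunction.contDiff_one (h : IsTestFunction U φ) : ContDiff ℝ 1 φ :=
  h.1.of_le (by exact_mod_cast le_top)

lemma IsTestFunction.eq_zero (h : IsTestFunction U φ) {x : Plane} (hx : x ∉ U) : φ x = 0 :=
  image_eq_zero_of_notMem_tsupport fun h' => hx (h.2.2 h')

lemma IsTestFunction.partialDeriv_eq_zero (h : IsTestFunction U φ) (i : Fin 2) {x : Plane}
    (hx : x ∉ U) : partialDeriv i φ x = 0 :=
  image_eq_zero_of_notMem_tsupport fun h' => hx (h.2.2 (tsupport_partialDeriv_subset i φ h'))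

end Test

/-! ### The divergence theorem outside a circle -/

section Divergence

variable {R : ℝ}

/-- The divergence theorem outside a disc, for a field tangent to the boundary circle. Multiplying
the field by `circleCutoff` leaves an error term that is bounded and tends to `0` off the circle. -/
lemma integral_divergence_exterior (hR : 0 < R) {E : Fin 2 → Plane → ℂ}
    (hE : ∀ i, ContDiff ℝ 1 (E i)) (hc : ∀ i, HasCompactSupport (E i))
    (htan : ∀ x, ‖x‖ = R → ∑ i, (x i : ℂ) * E i x = 0) :
    ∫ x, (if R < ‖x‖ then ∑ i, partialDeriv i (E i) x else 0) = 0 := by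
  set N : Plane → ℂ := fun x => ∑ i, (x i : ℂ) * E i x with hN
  have hNd : ContDiff ℝ 1 N := by
    refine ContDiff.sum fun i _ => ContDiff.mul ?_ (hE i)
    exact Complex.ofRealCLM.contDiff.comp (by fun_prop)
  obtain ⟨M, hM⟩ : ∃ M, ∀ i x, M < ‖x‖ → E i x = 0 := by
    have : ∀ i, ∃ M, ∀ x, M < ‖x‖ → E i x = 0 := fun i => by
      obtain ⟨M, hM⟩ := (hc i).isCompact.isBounded.subset_closedBall (0 : Plane)
      refine ⟨M, fun x hx => image_eq_zero_of_notMem_tsupport fun h => ?_⟩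
      have := hM h
      rw [mem_closedBall_zero_iff] at this
      linarith
    choose M hM using this
    exact ⟨max (M 0) (M 1), fun i x hx => hM i x (lt_of_le_of_lt (by fin_cases i <;> simp) hx)⟩
  obtain ⟨C, hC0, hC⟩ := exists_bound_circleCutoffDeriv_mul hR 0 hNd htan M
  set div : Plane → ℂ := fun x => ∑ i, partialDeriv i (E i) x with hdiv
  have hdivc : Continuous div := by
    refine continuous_finsetSum _ fun i _ => continuous_partialDeriv (hE i) i
  have hdivi : Integrable div := by
    refine integrable_finsetSum _ fun i _ => ?_
    exact (continuous_partialDeriv (hE i) i).integrable_of_hasCompactSupport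
      (hasCompactSupport_partialDeriv (hc i) i)
  have hχ : ∀ k, ContDiff ℝ 1 fun x => (circleCutoff R 0 k x : ℂ) := fun k =>
    Complex.ofRealCLM.contDiff.comp (contDiff_circleCutoff R 0 k (m := 1))
  have hprod : ∀ k i, ContDiff ℝ 1 fun x => (circleCutoff R 0 k x : ℂ) * E i x := fun k i =>
    (hχ k).mul (hE i)
  have hcs : ∀ k i, HasCompactSupport fun x => (circleCutoff R 0 k x : ℂ) * E i x := fun k i =>
    (hc i).mul_left
  have hform : ∀ k x, ∑ i, partialDeriv i (fun x => (circleCutoff R 0 k x : ℂ) * E i x) x =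
      circleCutoff R 0 k x * div x + 2 * (circleCutoffDeriv R 0 k x * N x) := fun k x => by
    have h1 : ∀ i, partialDeriv i (fun x => (circleCutoff R 0 k x : ℂ) * E i x) x =
        circleCutoff R 0 k x * partialDeriv i (E i) x +
          (circleCutoffDeriv R 0 k x * (2 * x i) : ℝ) * E i x := fun i => by
      rw [partialDeriv_mul ((hχ k).differentiable one_ne_zero x)
        ((hE i).differentiable one_ne_zero x), partialDeriv_circleCutoff]
    simp only [h1, hdiv, hN, Fin.sum_univ_two]
    push_cast
    ring
  have hzero : ∀ k, ∫ x, (circleCutoff R 0 k x * div x + 2 * (circleCutoffDeriv R 0 k x * N x)) =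
      0 := fun k => by
    simp only [← hform]
    rw [integral_finsetSum _ fun i _ => ?_]
    · exact Finset.sum_eq_zero fun i _ => integral_partialDeriv_eq_zero (hprod k i) (hcs k i) i
    · exact (continuous_partialDeriv (hprod k i) i).integrable_of_hasCompactSupport
        (hasCompactSupport_partialDeriv (hcs k i) i)
  have hlim : Tendsto (fun k => ∫ x, (circleCutoff R 0 k x * div x +
      2 * (circleCutoffDeriv R 0 k x * N x))) atTop
      (𝓝 (∫ x, (if R < ‖x‖ then div x else 0))) := by
    refine tendsto_integral_of_dominated_convergence
      (fun x => ‖div x‖ + (Metric.closedBall (0 : Plane) M).indicator (fun _ => 2 * C) x)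
      (fun k => ?_) ?_ (fun k => Eventually.of_forall fun x => ?_) ?_
    · simp only [← hform]
      exact (continuous_finsetSum _ fun i _ =>
        continuous_partialDeriv (hprod k i) i).aestronglyMeasurable
    · refine hdivi.norm.add ((integrable_indicator_iff measurableSet_closedBall).2 ?_)
      exact integrableOn_const (isCompact_closedBall _ _).measure_lt_top.ne
    · refine (norm_add_le _ _).trans (add_le_add ?_ ?_)
      · rw [norm_mul, Complex.norm_real, Real.norm_of_nonneg (circleCutoff_nonneg k x)]
        exact mul_le_of_le_one_left (norm_nonneg _) (circleCutoff_le_one k x)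
      · by_cases hx : ‖x‖ ≤ M
        · rw [Set.indicator_of_mem (by simpa using hx), norm_mul]
          simpa using hC k x hx
        · have : N x = 0 := by
            rw [hN]
            exact Finset.sum_eq_zero fun i _ => by rw [hM i x (not_le.1 hx), mul_zero]
          rw [this, Set.indicator_of_notMem (by simpa using hx)]
          simp
    · have := ae_norm_ne hR Set.univ
      rw [Measure.restrict_univ] at this
      filter_upwards [this] with x hx
      refine tendsto_const_nhds.congr' ?_
      filter_upwards [eventually_circleCutoff_eq (b := 0) hR hx] with k hk
      rw [hk.1, hk.2]
      split_ifs <;> simp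
  simp only [hzero] at hlim
  exact (tendsto_nhds_unique hlim tendsto_const_nhds)

variable {U : Set Plane} {φ : Plane → ℂ} {D : Fin 2 → Plane → ℂ}

lemma sum_mul_partialDeriv (hD : ∀ i, ContDiff ℝ 1 (D i)) (hφ : IsTestFunction U φ) (x : Plane) :
    ∑ i, partialDeriv i (fun x => D i x * φ x) x =
      ∑ i, D i x * partialDeriv i φ x + (∑ i, partialDeriv i (D i) x) * φ x := by
  rw [Finset.sum_mul, ← Finset.sum_add_distrib]
  exact Finset.sum_congr rfl fun i _ => partialDeriv_mul ((hD i).differentiable one_ne_zero x)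
    (hφ.contDiff_one.differentiable one_ne_zero x)

lemma integrable_sum_mul_partialDeriv (hD : ∀ i, ContDiff ℝ 1 (D i)) (hφ : IsTestFunction U φ) :
    Integrable (fun x => ∑ i, D i x * partialDeriv i φ x) :=
  integrable_finsetSum _ fun i _ => ((hD i).continuous.mul
    (continuous_partialDeriv hφ.contDiff_one i)).integrable_of_hasCompactSupport
    (hasCompactSupport_partialDeriv hφ.2.1 i).mul_left

lemma integrable_divergence_mul (hD : ∀ i, ContDiff ℝ 1 (D i)) (hφ : IsTestFunction U φ) :
    Integrable (fun x => (∑ i, partialDeriv i (D i) x) * φ x) :=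
  ((continuous_finsetSum _ fun i _ => continuous_partialDeriv (hD i) i).mul
    hφ.1.continuous).integrable_of_hasCompactSupport hφ.2.1.mul_left

lemma setIntegral_sum_mul_partialDeriv (hD : ∀ i, ContDiff ℝ 1 (D i)) (hφ : IsTestFunction U φ) :
    ∫ x in U, ∑ i, D i x * partialDeriv i φ x =
      -∫ x in U, (∑ i, partialDeriv i (D i) x) * φ x := by
  rw [setIntegral_eq_integral_of_forall_compl_eq_zero fun x hx =>
      Finset.sum_eq_zero fun i _ => by rw [hφ.partialDeriv_eq_zero i hx, mul_zero],
    setIntegral_eq_integral_of_forall_compl_eq_zero fun x hx => by rw [hφ.eq_zero hx, mul_zero],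
    eq_neg_iff_add_eq_zero, ← integral_add (integrable_sum_mul_partialDeriv hD hφ)
      (integrable_divergence_mul hD hφ)]
  simp only [← sum_mul_partialDeriv hD hφ]
  have hcs : ∀ i, HasCompactSupport fun x => D i x * φ x := fun i => hφ.2.1.mul_left
  have hcd : ∀ i, ContDiff ℝ 1 fun x => D i x * φ x := fun i => (hD i).mul hφ.contDiff_one
  rw [integral_finsetSum _ fun i _ => ?_]
  · exact Finset.sum_eq_zero fun i _ => integral_partialDeriv_eq_zero (hcd i) (hcs i) i
  · exact (continuous_partialDeriv (hcd i) i).integrable_of_hasCompactSupport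
      (hasCompactSupport_partialDeriv (hcs i) i)

lemma setIntegral_exterior_sum_mul_partialDeriv (hR : 0 < R) (hD : ∀ i, ContDiff ℝ 1 (D i))
    (htan : ∀ x, ‖x‖ = R → ∑ i, (x i : ℂ) * D i x = 0) (hφ : IsTestFunction U φ) :
    ∫ x in U, (if R < ‖x‖ then ∑ i, D i x * partialDeriv i φ x else 0) =
      -∫ x in U, (if R < ‖x‖ then (∑ i, partialDeriv i (D i) x) * φ x else 0) := by
  rw [setIntegral_eq_integral_of_forall_compl_eq_zero fun x hx => by
        rw [Finset.sum_eq_zero fun i _ => by rw [hφ.partialDeriv_eq_zero i hx, mul_zero], ite_self],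
    setIntegral_eq_integral_of_forall_compl_eq_zero fun x hx => by
        rw [hφ.eq_zero hx, mul_zero, ite_self],
    eq_neg_iff_add_eq_zero, ← integral_add (integrable_exterior (integrable_sum_mul_partialDeriv hD hφ) R)
      (integrable_exterior (integrable_divergence_mul hD hφ) R)]
  refine (integral_congr_ae (Eventually.of_forall fun x => ?_)).trans
    (integral_divergence_exterior hR (E := fun i x => D i x * φ x)
    (fun i => (hD i).mul hφ.contDiff_one) (fun i => hφ.2.1.mul_left) fun x hx => by
      rw [← zero_mul (φ x), ← htan x hx, Finset.sum_mul]; simp only [mul_assoc])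
  split_ifs
  · exact (sum_mul_partialDeriv hD hφ x).symm
  · simp

end Divergence

/-! ### Weak gradients, `H¹` approximation and traces of piecewise smooth functions -/

lemma tendsto_eLpNorm_two_of_bounded {α : Type*} [MeasurableSpace α] {μ : Measure α}
    [IsFiniteMeasure μ] {f : ℕ → α → ℂ} {C : ℝ} (hm : ∀ k, AEStronglyMeasurable (f k) μ)
    (hb : ∀ k, ∀ᵐ x ∂μ, ‖f k x‖ ≤ C) (hlim : ∀ᵐ x ∂μ, Tendsto (fun k => f k x) atTop (𝓝 0)) :
    Tendsto (fun k => eLpNorm (f k) 2 μ) atTop (𝓝 0) := by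
  have h1 : Tendsto (fun k => ∫⁻ x, ‖f k x‖ₑ ^ (2 : ℝ) ∂μ) atTop (𝓝 (∫⁻ _, 0 ∂μ)) := by
    refine tendsto_lintegral_of_dominated_convergence' (fun _ => ENNReal.ofReal C ^ (2 : ℝ))
      (fun k => (hm k).enorm.pow_const _) (fun k => ?_) ?_ ?_
    · filter_upwards [hb k] with x hx
      gcongr
      rw [← ofReal_norm]
      exact ENNReal.ofReal_le_ofReal hx
    · rw [lintegral_const]
      exact ENNReal.mul_ne_top (by simp) (measure_ne_top _ _)
    · filter_upwards [hlim] with x hx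
      have := (hx.enorm).ennrpow_const (2 : ℝ)
      simpa using this
  have h2 := h1.ennrpow_const (1 / 2 : ℝ)
  simp only [lintegral_zero] at h2
  rw [ENNReal.zero_rpow_of_pos (by norm_num)] at h2
  refine h2.congr fun k => ?_
  rw [eLpNorm_eq_lintegral_rpow_enorm_toReal (by norm_num) (by norm_num)]
  simp

section Sobolev

variable {U : Set Plane} {M R : ℝ} {f F u v w : Plane → ℂ}

lemma isFiniteMeasure_restrict_of_norm_le (hU : ∀ x ∈ U, ‖x‖ ≤ M) :
    IsFiniteMeasure ((volume : Measure Plane).restrict U) :=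
  isFiniteMeasure_restrict.2 (ne_top_of_le_ne_top
    (isCompact_closedBall (0 : Plane) M).measure_lt_top.ne
    (measure_mono fun x hx => by simpa using hU x hx))

lemma exists_norm_le_of_norm_le (hf : Continuous f) (M : ℝ) :
    ∃ C, 0 ≤ C ∧ ∀ x : Plane, ‖x‖ ≤ M → ‖f x‖ ≤ C := by
  obtain ⟨C, hC⟩ := (isCompact_closedBall (0 : Plane) M).exists_bound_of_continuousOn hf.continuousOn
  exact ⟨max C 0, le_max_right _ _, fun x hx => (hC x (by simpa using hx)).trans (le_max_left _ _)⟩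

lemma memLp_two_of_continuous (hUm : MeasurableSet U) (hU : ∀ x ∈ U, ‖x‖ ≤ M)
    (hf : Continuous f) : MemLp f 2 (volume.restrict U) := by
  have := isFiniteMeasure_restrict_of_norm_le hU
  obtain ⟨C, -, hC⟩ := exists_norm_le_of_norm_le hf M
  refine MemLp.of_bound hf.aestronglyMeasurable C ?_
  filter_upwards [ae_restrict_mem hUm] with x hx using hC x (hU x hx)

lemma memLp_two_exterior (hUm : MeasurableSet U) (hU : ∀ x ∈ U, ‖x‖ ≤ M)
    (hf : Continuous f) (R : ℝ) :
    MemLp (fun x => if R < ‖x‖ then f x else 0) 2 (volume.restrict U) := by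
  have := isFiniteMeasure_restrict_of_norm_le hU
  obtain ⟨C, -, hC⟩ := exists_norm_le_of_norm_le hf M
  refine MemLp.of_bound (aestronglyMeasurable_exterior hf R _) C ?_
  filter_upwards [ae_restrict_mem hUm] with x hx
    using (norm_ite_zero_le _ _).trans (hC x (hU x hx))

lemma HasWeakGradient.congr {G H : Fin 2 → Plane → ℂ} (hUm : MeasurableSet U)
    (h : HasWeakGradient U u G) (huv : ∀ x ∈ U, u x = v x) (hGH : ∀ i, ∀ x ∈ U, G i x = H i x) :
    HasWeakGradient U v H where
  memLp := h.memLp.ae_eq (ae_restrict_of_forall_mem hUm huv)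
  memLp_grad i := (h.memLp_grad i).ae_eq (ae_restrict_of_forall_mem hUm (hGH i))
  integral_eq i φ hφ := by
    have e1 : ∫ x in U, u x * partialDeriv i φ x = ∫ x in U, v x * partialDeriv i φ x :=
      setIntegral_congr_fun hUm fun x hx => by simp only [huv x hx]
    have e2 : ∫ x in U, G i x * φ x = ∫ x in U, H i x * φ x :=
      setIntegral_congr_fun hUm fun x hx => by simp only [hGH i x hx]
    rw [← e1, ← e2, h.integral_eq i φ hφ]

lemma hasWeakGradient_of_contDiff (hUm : MeasurableSet U) (hU : ∀ x ∈ U, ‖x‖ ≤ M)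
    (hw : ContDiff ℝ 1 w) : HasWeakGradient U w (fun i => partialDeriv i w) where
  memLp := memLp_two_of_continuous hUm hU hw.continuous
  memLp_grad i := memLp_two_of_continuous hUm hU (continuous_partialDeriv hw i)
  integral_eq i φ hφ := by
    have h := setIntegral_sum_mul_partialDeriv (D := fun j => if j = i then w else 0)
      (fun j => by split_ifs; exacts [hw, contDiff_const]) hφ
    have h0 : ∀ j x, partialDeriv j (if j = i then w else 0) x =
        if j = i then partialDeriv j w x else 0 := fun j x => by
      split_ifs <;> simp [partialDeriv]
    have h1 : ∀ (j : Fin 2) (x : Plane), (if j = i then w else 0) x = if j = i then w x else 0 :=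
      fun j x => by split_ifs <;> rfl
    simpa only [h0, h1, ite_mul, zero_mul, Finset.sum_ite_eq', Finset.mem_univ, if_true] using h

/-- A `C¹` function vanishing on a circle, extended by zero inside the circle, has as weak gradient
its classical gradient extended by zero. -/
lemma hasWeakGradient_exterior (hUm : MeasurableSet U) (hU : ∀ x ∈ U, ‖x‖ ≤ M) (hR : 0 < R)
    (hF : ContDiff ℝ 1 F) (h0 : ∀ x, ‖x‖ = R → F x = 0) :
    HasWeakGradient U (fun x => if R < ‖x‖ then F x else 0)
      (fun i x => if R < ‖x‖ then partialDeriv i F x else 0) where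
  memLp := memLp_two_exterior hUm hU hF.continuous R
  memLp_grad i := memLp_two_exterior hUm hU (continuous_partialDeriv hF i) R
  integral_eq i φ hφ := by
    have e1 : ∀ (j : Fin 2) (x : Plane), (if j = i then F else 0) x = if j = i then F x else 0 :=
      fun j x => by split_ifs <;> rfl
    have h := setIntegral_exterior_sum_mul_partialDeriv (D := fun j => if j = i then F else 0) hR
      (fun j => by split_ifs; exacts [hF, contDiff_const])
      (fun x hx => Finset.sum_eq_zero fun j _ => by simp [e1, h0 x hx]) hφ
    have e0 : ∀ j x, partialDeriv j (if j = i then F else 0) x =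
        if j = i then partialDeriv j F x else 0 := fun j x => by
      split_ifs <;> simp [partialDeriv]
    simp only [e0, e1, ite_mul, zero_mul, Finset.sum_ite_eq', Finset.mem_univ, if_true] at h
    simpa only [ite_mul, zero_mul] using h

lemma HasWeakGradient.add {G H : Fin 2 → Plane → ℂ} (hu : HasWeakGradient U u G)
    (hv : HasWeakGradient U v H) :
    HasWeakGradient U (fun x => u x + v x) (fun i x => G i x + H i x) where
  memLp := hu.memLp.add hv.memLp
  memLp_grad i := (hu.memLp_grad i).add (hv.memLp_grad i)
  integral_eq i φ hφ := by
    have h1 : MemLp φ 2 (volume.restrict U) :=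
      (hφ.1.continuous.memLp_of_hasCompactSupport hφ.2.1).restrict U
    have h2 : MemLp (partialDeriv i φ) 2 (volume.restrict U) :=
      ((continuous_partialDeriv hφ.contDiff_one i).memLp_of_hasCompactSupport
        (hasCompactSupport_partialDeriv hφ.2.1 i)).restrict U
    have e1 : Integrable (fun x => u x * partialDeriv i φ x) (volume.restrict U) :=
      hu.memLp.integrable_mul h2
    have e2 : Integrable (fun x => v x * partialDeriv i φ x) (volume.restrict U) :=
      hv.memLp.integrable_mul h2
    have e3 : Integrable (fun x => G i x * φ x) (volume.restrict U) :=
      (hu.memLp_grad i).integrable_mul h1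
    have e4 : Integrable (fun x => H i x * φ x) (volume.restrict U) :=
      (hv.memLp_grad i).integrable_mul h1
    simp only [add_mul]
    rw [integral_add e1 e2, integral_add e3 e4, hu.integral_eq i φ hφ, hv.integral_eq i φ hφ]
    ring

lemma tendstoH1_circleCutoff (hUm : MeasurableSet U) (hU : ∀ x ∈ U, ‖x‖ ≤ M) (hR : 0 < R) (b : ℝ)
    (hF : ContDiff ℝ 1 F) (h0 : ∀ x, ‖x‖ = R → F x = 0) :
    TendstoH1 U (fun k x => circleCutoff R b k x * F x) (fun x => if R < ‖x‖ then F x else 0)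
      (fun i x => if R < ‖x‖ then partialDeriv i F x else 0) := by
  have := isFiniteMeasure_restrict_of_norm_le hU
  have hχ : ∀ k, ContDiff ℝ 1 fun x => (circleCutoff R b k x : ℂ) := fun k =>
    Complex.ofRealCLM.contDiff.comp (contDiff_circleCutoff R b k (m := 1))
  have hχ1 : ∀ k x (z : ℂ), ‖(circleCutoff R b k x : ℂ) * z‖ ≤ ‖z‖ := fun k x z => by
    rw [norm_mul, Complex.norm_real, Real.norm_of_nonneg (circleCutoff_nonneg k x)]
    exact mul_le_of_le_one_left (norm_nonneg _) (circleCutoff_le_one k x)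
  refine ⟨?_, fun i => ?_⟩
  · obtain ⟨C, -, hC⟩ := exists_norm_le_of_norm_le hF.continuous M
    refine tendsto_eLpNorm_two_of_bounded (C := C + C) (fun k => ?_) (fun k => ?_) ?_
    · exact ((hχ k).continuous.mul hF.continuous).aestronglyMeasurable.sub
        (aestronglyMeasurable_exterior hF.continuous R _)
    · filter_upwards [ae_restrict_mem hUm] with x hx
      exact (norm_sub_le _ _).trans (add_le_add ((hχ1 k x _).trans (hC x (hU x hx)))
        ((norm_ite_zero_le _ _).trans (hC x (hU x hx))))
    · filter_upwards [ae_norm_ne hR U] with x hx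
      refine tendsto_const_nhds.congr' ?_
      filter_upwards [eventually_circleCutoff_eq (b := b) hR hx] with k hk
      rw [hk.1]
      split_ifs <;> simp
  · have hform : ∀ k x, partialDeriv i (fun x => (circleCutoff R b k x : ℂ) * F x) x =
        circleCutoff R b k x * partialDeriv i F x +
          (2 * x i : ℝ) * (circleCutoffDeriv R b k x * F x) := fun k x => by
      rw [partialDeriv_mul ((hχ k).differentiable one_ne_zero x) (hF.differentiable one_ne_zero x),
        partialDeriv_circleCutoff]
      push_cast; ring
    obtain ⟨C, hC0, hC⟩ := exists_norm_le_of_norm_le (continuous_partialDeriv hF i) M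
    obtain ⟨C', hC'0, hC'⟩ := exists_bound_circleCutoffDeriv_mul hR b hF h0 M
    refine tendsto_eLpNorm_two_of_bounded (C := C + 2 * M * C' + C) (fun k => ?_) (fun k => ?_) ?_
    · exact (continuous_partialDeriv ((hχ k).mul hF) i).aestronglyMeasurable.sub
        (aestronglyMeasurable_exterior (continuous_partialDeriv hF i) R _)
    · filter_upwards [ae_restrict_mem hUm] with x hx
      rw [hform]
      refine (norm_sub_le _ _).trans (add_le_add ((norm_add_le _ _).trans (add_le_add
        ((hχ1 k x _).trans (hC x (hU x hx))) ?_))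
        ((norm_ite_zero_le _ _).trans (hC x (hU x hx))))
      rw [norm_mul, Complex.norm_real, norm_mul, Real.norm_two]
      have h1 : ‖x i‖ ≤ M := (PiLp.norm_apply_le x i).trans (hU x hx)
      have h2 : 0 ≤ M := (norm_nonneg _).trans h1
      gcongr
      exact hC' k x (hU x hx)
    · filter_upwards [ae_norm_ne hR U] with x hx
      refine tendsto_const_nhds.congr' ?_
      filter_upwards [eventually_circleCutoff_eq (b := b) hR hx] with k hk
      rw [hform, hk.1, hk.2]
      split_ifs <;> simp

lemma TendstoH1.add {w₁ w₂ : ℕ → Plane → ℂ} {G H : Fin 2 → Plane → ℂ}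
    (hw₁ : ∀ k, ContDiff ℝ 1 (w₁ k)) (hw₂ : ∀ k, ContDiff ℝ 1 (w₂ k))
    (hu : HasWeakGradient U u G) (hv : HasWeakGradient U v H)
    (h₁ : TendstoH1 U w₁ u G) (h₂ : TendstoH1 U w₂ v H) :
    TendstoH1 U (fun k x => w₁ k x + w₂ k x) (fun x => u x + v x) (fun i x => G i x + H i x) := by
  refine ⟨?_, fun i => ?_⟩
  · refine tendsto_of_tendsto_of_tendsto_of_le_of_le tendsto_const_nhds
      (by simpa using h₁.1.add h₂.1) (fun _ => zero_le) fun k => ?_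
    refine le_trans (le_of_eq ?_) (eLpNorm_add_le
      ((hw₁ k).continuous.aestronglyMeasurable.sub hu.memLp.1)
      ((hw₂ k).continuous.aestronglyMeasurable.sub hv.memLp.1) (by norm_num))
    congr 1; ext x; simp only [Pi.add_apply]; ring
  · refine tendsto_of_tendsto_of_tendsto_of_le_of_le tendsto_const_nhds
      (by simpa using (h₁.2 i).add (h₂.2 i)) (fun _ => zero_le) fun k => ?_
    refine le_trans (le_of_eq ?_) (eLpNorm_add_le
      ((continuous_partialDeriv (hw₁ k) i).aestronglyMeasurable.sub (hu.memLp_grad i).1)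
      ((continuous_partialDeriv (hw₂ k) i).aestronglyMeasurable.sub (hv.memLp_grad i).1)
      (by norm_num))
    congr 1; ext x
    rw [partialDeriv_add ((hw₁ k).differentiable one_ne_zero x)
      ((hw₂ k).differentiable one_ne_zero x)]
    simp only [Pi.add_apply]; ring

lemma TendstoH1.congr {w : ℕ → Plane → ℂ} {G H : Fin 2 → Plane → ℂ} (hUm : MeasurableSet U)
    (h : TendstoH1 U w u G) (huv : ∀ x ∈ U, u x = v x) (hGH : ∀ i, ∀ x ∈ U, G i x = H i x) :
    TendstoH1 U w v H := by
  refine ⟨h.1.congr fun k => eLpNorm_congr_ae (ae_restrict_of_forall_mem hUm fun x hx => ?_),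
    fun i => (h.2 i).congr fun k =>
      eLpNorm_congr_ae (ae_restrict_of_forall_mem hUm fun x hx => ?_)⟩
  · simp only [huv x hx]
  · simp only [hGH i x hx]

lemma hasWeakGradient_of_eqOn (hUm : MeasurableSet U) (hU : ∀ x ∈ U, ‖x‖ ≤ M) (hw : ContDiff ℝ 1 w)
    (h : ∀ x ∈ U, w x = v x) : HasWeakGradient U v (fun i => partialDeriv i w) :=
  (hasWeakGradient_of_contDiff hUm hU hw).congr hUm h fun _ _ _ => rfl

lemma memH2_of_eqOn (hUm : MeasurableSet U) (hU : ∀ x ∈ U, ‖x‖ ≤ M) (hw : ContDiff ℝ 2 w)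
    (h : ∀ x ∈ U, w x = v x) : MemH2 U v :=
  ⟨_, hasWeakGradient_of_eqOn hUm hU (hw.of_le (by norm_num)) h, fun i =>
    ⟨_, hasWeakGradient_of_contDiff hUm hU (contDiff_partialDeriv hw (by norm_num) i)⟩⟩

lemma continuous_polarPoint (R : ℝ) : Continuous (polarPoint R) := by
  unfold polarPoint
  fun_prop

lemma norm_polarPoint (R θ : ℝ) : ‖polarPoint R θ‖ = |R| := by
  rw [EuclideanSpace.norm_eq, Fin.sum_univ_two, ← Real.sqrt_sq_eq_abs]
  congr 1
  simp only [polarPoint, Real.norm_eq_abs, sq_abs]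
  simp
  linear_combination R ^ 2 * Real.cos_sq_add_sin_sq θ

lemma hasTrace_of_eqOn (hUm : MeasurableSet U) (hU : ∀ x ∈ U, ‖x‖ ≤ M) (hw : ContDiff ℝ 1 w)
    (h : ∀ x ∈ U, w x = v x) (R : ℝ) : HasTrace U R v (fun θ => w (polarPoint R θ)) := by
  refine ⟨?_, _, hasWeakGradient_of_eqOn hUm hU hw h, fun _ => w, fun _ => hw, ⟨?_, fun i => ?_⟩, ?_⟩
  · obtain ⟨C, -, hC⟩ := exists_norm_le_of_norm_le hw.continuous |R|
    have : IsFiniteMeasure angleMeasure := by unfold angleMeasure; infer_instance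
    exact MemLp.of_bound
      (hw.continuous.comp (continuous_polarPoint R)).aestronglyMeasurable C
      (Eventually.of_forall fun θ => hC _ (norm_polarPoint R θ).le)
  · refine tendsto_const_nhds.congr fun k => ?_
    have h0 : (fun x => w x - v x) =ᵐ[volume.restrict U] fun _ => 0 :=
      ae_restrict_of_forall_mem hUm fun x hx => by simp only [h x hx, sub_self]
    rw [eLpNorm_congr_ae h0, eLpNorm_zero']
  · simp
  · simp

lemma hasNormalTrace_of_eqOn (hUm : MeasurableSet U) (hU : ∀ x ∈ U, ‖x‖ ≤ M)
    (hw : ContDiff ℝ 2 w) (h : ∀ x ∈ U, w x = v x) (R : ℝ) :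
    HasNormalTrace U R v (fun θ => Real.cos θ * partialDeriv 0 w (polarPoint R θ) +
      Real.sin θ * partialDeriv 1 w (polarPoint R θ)) :=
  ⟨_, hasWeakGradient_of_eqOn hUm hU (hw.of_le (by norm_num)) h,
    fun i θ => partialDeriv i w (polarPoint R θ), fun i =>
      hasTrace_of_eqOn hUm hU (contDiff_partialDeriv hw (by norm_num) i) (fun _ _ => rfl) R,
    Eventually.of_forall fun _ => rfl⟩

end Sobolev

/-! ### Functions of one angular momentum on the plane -/

/-- The complex coordinate `x₀ + i x₁`. -/
noncomputable def complexCoord (x : Plane) : ℂ := x 0 + x 1 * Complex.I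

/-- The partial derivatives `(1, i)` of the complex coordinate. -/
noncomputable def coordDeriv : Fin 2 → ℂ := ![1, Complex.I]

/-- The function `z ^ n g(|z|²)`, of angular momentum `n`. -/
noncomputable def angularFun (n : ℕ) (g : ℝ → ℝ) (x : Plane) : ℂ :=
  complexCoord x ^ n * (g (‖x‖ ^ 2) : ℂ)

section Angular

variable {n : ℕ} {g : ℝ → ℝ}

lemma contDiff_complexCoord {m : WithTop ℕ∞} : ContDiff ℝ m complexCoord := by
  have h : ∀ i : Fin 2, ContDiff ℝ m fun x : Plane => ((x i : ℝ) : ℂ) := fun i =>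
    Complex.ofRealCLM.contDiff.comp (by fun_prop)
  exact (h 0).add ((h 1).mul contDiff_const)

lemma contDiff_angularFun (n : ℕ) {m : WithTop ℕ∞} (hg : ContDiff ℝ m g) :
    ContDiff ℝ m (angularFun n g) :=
  (contDiff_complexCoord.pow n).mul
    (Complex.ofRealCLM.contDiff.comp (hg.comp (contDiff_norm_sq ℝ)))

lemma partialDeriv_complexCoord (i : Fin 2) (x : Plane) :
    partialDeriv i complexCoord x = coordDeriv i := by
  have h : ∀ i : Fin 2, HasFDerivAt (fun x : Plane => ((x i : ℝ) : ℂ))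
      (Complex.ofRealCLM ∘L (EuclideanSpace.proj i : Plane →L[ℝ] ℝ)) x := fun i =>
    (Complex.ofRealCLM ∘L (EuclideanSpace.proj i : Plane →L[ℝ] ℝ)).hasFDerivAt
  have h1 : HasFDerivAt complexCoord _ x := (h 0).add ((h 1).mul_const Complex.I)
  rw [partialDeriv, h1.fderiv]
  fin_cases i <;> simp [coordDeriv]

lemma partialDeriv_complexCoord_pow (i : Fin 2) (n : ℕ) (x : Plane) :
    partialDeriv i (fun x => complexCoord x ^ n) x =
      n * complexCoord x ^ (n - 1) * coordDeriv i := by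
  have h1 : HasFDerivAt complexCoord (fderiv ℝ complexCoord x) x :=
    ((contDiff_complexCoord (m := 1)).differentiable one_ne_zero x).hasFDerivAt
  rw [partialDeriv, (h1.pow n).fderiv, ← partialDeriv_complexCoord i x, partialDeriv]
  simp [mul_assoc]

lemma partialDeriv_comp_norm_sq (i : Fin 2) {x : Plane} (hg : DifferentiableAt ℝ g (‖x‖ ^ 2)) :
    partialDeriv i (fun x => (g (‖x‖ ^ 2) : ℂ)) x = 2 * x i * deriv g (‖x‖ ^ 2) := by
  have h1 : HasFDerivAt (fun x : Plane => ‖x‖ ^ 2) (2 • (innerSL ℝ x)) x :=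
    (hasStrictFDerivAt_norm_sq x).hasFDerivAt
  have h3 : HasFDerivAt (fun x : Plane => (g (‖x‖ ^ 2) : ℂ)) _ x :=
    Complex.ofRealCLM.hasFDerivAt.comp x (hg.hasDerivAt.comp_hasFDerivAt x h1)
  rw [partialDeriv, h3.fderiv]
  simp [EuclideanSpace.inner_single_right]
  ring

lemma differentiableAt_comp_norm_sq {x : Plane} (hg : DifferentiableAt ℝ g (‖x‖ ^ 2)) :
    DifferentiableAt ℝ (fun x : Plane => (g (‖x‖ ^ 2) : ℂ)) x :=
  Complex.ofRealCLM.differentiableAt.comp x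
    (hg.comp x (hasStrictFDerivAt_norm_sq x).hasFDerivAt.differentiableAt)

lemma partialDeriv_angularFun (i : Fin 2) (n : ℕ) {x : Plane}
    (hg : DifferentiableAt ℝ g (‖x‖ ^ 2)) :
    partialDeriv i (angularFun n g) x =
      n * coordDeriv i * angularFun (n - 1) g x + 2 * x i * angularFun n (deriv g) x := by
  have h := partialDeriv_mul (i := i)
    ((contDiff_complexCoord (m := 1).pow n).differentiable one_ne_zero x)
    (differentiableAt_comp_norm_sq hg)
  rw [partialDeriv_complexCoord_pow, partialDeriv_comp_norm_sq i hg] at h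
  refine h.trans ?_
  simp only [angularFun]
  ring

lemma norm_sq_eq (x : Plane) : ‖x‖ ^ 2 = x 0 ^ 2 + x 1 ^ 2 := by
  rw [EuclideanSpace.real_norm_sq_eq, Fin.sum_univ_two]

lemma norm_complexCoord (x : Plane) : ‖complexCoord x‖ = ‖x‖ := by
  rw [complexCoord, Complex.norm_add_mul_I, ← norm_sq_eq, Real.sqrt_sq (norm_nonneg x)]

lemma natCast_mul_pow_sub_one_mul (n : ℕ) (z : ℂ) : n * z ^ (n - 1) * z = n * z ^ n := by
  rcases n with _ | n
  · simp
  · rw [Nat.add_sub_cancel, mul_assoc, ← pow_succ]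

/-- The radial derivative `x · ∇`. -/
lemma sum_mul_partialDeriv_angularFun (n : ℕ) {x : Plane}
    (hg : DifferentiableAt ℝ g (‖x‖ ^ 2)) :
    ∑ i, (x i : ℂ) * partialDeriv i (angularFun n g) x =
      complexCoord x ^ n * (n * g (‖x‖ ^ 2) + 2 * ‖x‖ ^ 2 * deriv g (‖x‖ ^ 2) : ℝ) := by
  simp only [partialDeriv_angularFun _ n hg, Fin.sum_univ_two, coordDeriv, angularFun,
    Matrix.cons_val_zero, Matrix.cons_val_one]
  have h1 : ((‖x‖ : ℝ) : ℂ) ^ 2 = x 0 ^ 2 + x 1 ^ 2 := by exact_mod_cast norm_sq_eq x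
  have h2 := natCast_mul_pow_sub_one_mul n (complexCoord x)
  push_cast
  rw [h1]
  nth_rewrite 2 [complexCoord] at h2
  linear_combination (g (‖x‖ ^ 2) : ℂ) * h2

lemma sum_partialDeriv_partialDeriv_angularFun (n : ℕ) (hg : ContDiff ℝ 2 g) (x : Plane) :
    ∑ i, partialDeriv i (partialDeriv i (angularFun n g)) x =
      complexCoord x ^ n *
        (4 * ‖x‖ ^ 2 * deriv (deriv g) (‖x‖ ^ 2) + 4 * (n + 1) * deriv g (‖x‖ ^ 2) : ℝ) := by
  have hg1 : Differentiable ℝ g := hg.differentiable two_ne_zero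
  have hg' : ContDiff ℝ 1 (deriv g) := by
    have : ContDiff ℝ (1 + 1) g := by rwa [one_add_one_eq_two]
    exact (contDiff_succ_iff_deriv.1 this).2.2
  have hg1' : Differentiable ℝ (deriv g) := hg'.differentiable one_ne_zero
  have hcoord : ∀ i : Fin 2, partialDeriv i (fun x : Plane => 2 * ((x i : ℝ) : ℂ)) x = 2 := fun i => by
    have h : HasFDerivAt (fun x : Plane => 2 * ((x i : ℝ) : ℂ)) _ x :=
      ((Complex.ofRealCLM ∘L (EuclideanSpace.proj i : Plane →L[ℝ] ℝ)).hasFDerivAt).const_mul 2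
    rw [partialDeriv, h.fderiv]
    simp
  have hcd : ∀ i : Fin 2, DifferentiableAt ℝ (fun x : Plane => 2 * ((x i : ℝ) : ℂ)) x := fun i =>
    ((Complex.ofRealCLM ∘L (EuclideanSpace.proj i : Plane →L[ℝ] ℝ)).differentiableAt).const_mul 2
  have hA : ∀ m, DifferentiableAt ℝ (angularFun m g) x := fun m =>
    (contDiff_angularFun m hg).differentiable two_ne_zero x
  have hA' : ∀ m, DifferentiableAt ℝ (angularFun m (deriv g)) x := fun m =>
    (contDiff_angularFun m hg').differentiable one_ne_zero x
  have key : ∀ i, partialDeriv i (partialDeriv i (angularFun n g)) x =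
      n * coordDeriv i * ((n - 1 : ℕ) * coordDeriv i * angularFun (n - 1 - 1) g x +
        2 * x i * angularFun (n - 1) (deriv g) x) +
      (2 * x i * (n * coordDeriv i * angularFun (n - 1) (deriv g) x +
        2 * x i * angularFun n (deriv (deriv g)) x) + 2 * angularFun n (deriv g) x) := fun i => by
    have e : partialDeriv i (angularFun n g) = fun x =>
        n * coordDeriv i * angularFun (n - 1) g x + 2 * x i * angularFun n (deriv g) x :=
      funext fun x => partialDeriv_angularFun i n (hg1 _)
    have hconst : partialDeriv i (fun _ : Plane => (n : ℂ) * coordDeriv i) x = 0 := by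
      simp [partialDeriv]
    rw [e, partialDeriv_add ((hA (n - 1)).const_mul _) ((hcd i).fun_mul (hA' n)),
      partialDeriv_mul (differentiableAt_const _) (hA (n - 1)), hconst,
      partialDeriv_mul (hcd i) (hA' n), hcoord, partialDeriv_angularFun i (n - 1) (hg1 _),
      partialDeriv_angularFun i n (hg1' _)]
    ring
  simp only [key, Fin.sum_univ_two, coordDeriv, angularFun,
    Matrix.cons_val_zero, Matrix.cons_val_one]
  have h1 : ((‖x‖ : ℝ) : ℂ) ^ 2 = x 0 ^ 2 + x 1 ^ 2 := by exact_mod_cast norm_sq_eq x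
  have h2 := natCast_mul_pow_sub_one_mul n (complexCoord x)
  push_cast
  rw [h1]
  nth_rewrite 2 [complexCoord] at h2
  linear_combination 4 * ((deriv g (‖x‖ ^ 2) : ℝ) : ℂ) * h2 +
    n * (n - 1 : ℕ) * complexCoord x ^ (n - 1 - 1) * (g (‖x‖ ^ 2) : ℂ) * Complex.I_sq

end Angular

/-! ### From the radial equation to the Helmholtz equation -/

/-- A smooth function on the line that equals `log √ρ` for `ρ ≥ a`. -/
lemma exists_smooth_log {a : ℝ} (ha : 0 < a) :
    ∃ L : ℝ → ℝ, ContDiff ℝ ∞ L ∧ ∀ ρ, a ≤ ρ → L ρ = Real.log ρ / 2 := by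
  refine ⟨fun ρ => Real.smoothTransition (2 / a * ρ - 1) * (Real.log ρ / 2), ?_, fun ρ hρ => ?_⟩
  · refine contDiff_iff_contDiffAt.2 fun ρ => ?_
    rcases le_or_gt ρ 0 with h | h
    · refine (contDiffAt_const (c := (0 : ℝ))).congr_of_eventuallyEq ?_
      filter_upwards [gt_mem_nhds (show ρ < a / 2 by linarith)] with t ht
      rw [Real.smoothTransition.zero_of_nonpos, zero_mul]
      have : 2 / a * t ≤ 2 / a * (a / 2) := by gcongr
      have e : 2 / a * (a / 2) = 1 := by field_simp
      linarith
    · exact (Real.smoothTransition.contDiffAt.comp ρ (by fun_prop)).mul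
        ((Real.contDiffAt_log.2 h.ne').div_const 2)
  · have : 2 / a * a ≤ 2 / a * ρ := by gcongr
    have e : 2 / a * a = 2 := by field_simp
    simp only
    rw [Real.smoothTransition.one_of_one_le (by linarith), one_mul]

/-- The function `g` of `ρ = r²` for which `z ^ n g(|z|²) = e^{inθ} y(log r)`; here `L ρ = log √ρ`. -/
noncomputable def radialProfile (n : ℕ) (L y : ℝ → ℝ) (ρ : ℝ) : ℝ :=
  Real.exp (-(n * L ρ)) * y (L ρ)

section Profile

variable {n : ℕ} {κ a : ℝ} {L y p : ℝ → ℝ}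

lemma contDiff_radialProfile (hL : ContDiff ℝ ∞ L) (hy : ContDiff ℝ ∞ y) :
    ContDiff ℝ ∞ (radialProfile n L y) :=
  ((contDiff_const.mul hL).neg.exp).mul (hy.comp hL)

lemma hasDerivAt_of_eq_log (ha : 0 < a) (hLa : ∀ ρ, a ≤ ρ → L ρ = Real.log ρ / 2) {ρ : ℝ}
    (hρ : a < ρ) : HasDerivAt L (1 / (2 * ρ)) ρ := by
  have h : HasDerivAt (fun ρ => Real.log ρ / 2) (1 / (2 * ρ)) ρ := by
    refine HasDerivAt.congr_deriv ((Real.hasDerivAt_log (ha.trans hρ).ne').div_const 2) ?_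
    have := ha.trans hρ
    field_simp
  refine h.congr_of_eventuallyEq ?_
  filter_upwards [lt_mem_nhds hρ] with t ht using hLa t ht.le

lemma hasDerivAt_radialProfile {q : ℝ → ℝ} {d : ℝ} (ha : 0 < a)
    (hLa : ∀ ρ, a ≤ ρ → L ρ = Real.log ρ / 2) {ρ : ℝ} (hρ : a < ρ)
    (hq : HasDerivAt q d (L ρ)) :
    HasDerivAt (radialProfile n L q)
      (Real.exp (-(n * L ρ)) * (d - n * q (L ρ)) / (2 * ρ)) ρ := by
  have h1 := hasDerivAt_of_eq_log ha hLa hρ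
  have h2 := ((h1.const_mul (n : ℝ)).neg.exp).mul (hq.comp ρ h1)
  refine h2.congr_deriv ?_
  have := ha.trans hρ
  simp only [Function.comp, Pi.neg_apply]
  field_simp
  ring

lemma deriv_radialProfile (h : IsRadialSol n κ y p) (ha : 0 < a)
    (hLa : ∀ ρ, a ≤ ρ → L ρ = Real.log ρ / 2) {ρ : ℝ} (hρ : a < ρ) :
    2 * ρ * deriv (radialProfile n L y) ρ =
      Real.exp (-(n * L ρ)) * (p (L ρ) - n * y (L ρ)) := by
  rw [(hasDerivAt_radialProfile ha hLa hρ (h.hasDerivAt_fst _)).deriv]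
  have := ha.trans hρ
  field_simp

/-- In terms of `ρ = r²` the radial equation becomes `4 ρ g'' + 4 (n + 1) g' = -κ g`. -/
lemma deriv_deriv_radialProfile (h : IsRadialSol n κ y p) (ha : 0 < a)
    (hLa : ∀ ρ, a ≤ ρ → L ρ = Real.log ρ / 2) {ρ : ℝ} (hρ : a < ρ) :
    4 * ρ * deriv (deriv (radialProfile n L y)) ρ + 4 * (n + 1) * deriv (radialProfile n L y) ρ =
      -κ * radialProfile n L y ρ := by
  have h0 := ha.trans hρ
  have e : deriv (radialProfile n L y) =ᶠ[𝓝 ρ] fun ρ =>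
      radialProfile n L (fun s => p s - n * y s) ρ / (2 * ρ) := by
    filter_upwards [lt_mem_nhds hρ] with t ht
    have h1 := deriv_radialProfile h ha hLa ht
    have := ha.trans ht
    rw [eq_div_iff (by positivity), mul_comm, h1, radialProfile]
  have hd := (h.hasDerivAt_snd (L ρ)).sub ((h.hasDerivAt_fst (L ρ)).const_mul (n : ℝ))
  have hd2 := (hasDerivAt_radialProfile (n := n) ha hLa hρ hd).div
    ((hasDerivAt_id ρ).const_mul 2) (by simpa using h0.ne')
  have hexp : Real.exp (2 * L ρ) = ρ := by
    rw [hLa ρ hρ.le, mul_div_cancel₀ _ two_ne_zero, Real.exp_log h0]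
  rw [e.deriv_eq, e.eq_of_nhds]
  have hd3 : deriv (fun ρ => radialProfile n L (fun s => p s - n * y s) ρ / (2 * ρ)) ρ = _ :=
    hd2.deriv
  rw [hd3]
  simp only [radialProfile, hexp, Pi.sub_apply, id]
  field_simp
  ring

lemma sum_mul_partialDeriv_angularFun_radialProfile (h : IsRadialSol n κ y p) (ha : 0 < a)
    (hL : ContDiff ℝ ∞ L) (hLa : ∀ ρ, a ≤ ρ → L ρ = Real.log ρ / 2) {x : Plane}
    (hx : a < ‖x‖ ^ 2) :
    ∑ i, (x i : ℂ) * partialDeriv i (angularFun n (radialProfile n L y)) x =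
      angularFun n (radialProfile n L p) x := by
  have hg : Differentiable ℝ (radialProfile n L y) :=
    (contDiff_radialProfile hL h.contDiff_fst).differentiable (by simp)
  rw [sum_mul_partialDeriv_angularFun n (hg _), deriv_radialProfile h ha hLa hx, angularFun]
  congr 2
  simp only [radialProfile]
  ring

lemma sum_partialDeriv_partialDeriv_angularFun_radialProfile (h : IsRadialSol n κ y p)
    (ha : 0 < a) (hL : ContDiff ℝ ∞ L) (hLa : ∀ ρ, a ≤ ρ → L ρ = Real.log ρ / 2) {x : Plane}
    (hx : a < ‖x‖ ^ 2) :
    ∑ i, partialDeriv i (partialDeriv i (angularFun n (radialProfile n L y))) x =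
      -κ * angularFun n (radialProfile n L y) x := by
  have hg : ContDiff ℝ 2 (radialProfile n L y) :=
    contDiff_infty.1 (contDiff_radialProfile hL h.contDiff_fst) 2
  rw [sum_partialDeriv_partialDeriv_angularFun n hg, deriv_deriv_radialProfile h ha hLa hx,
    angularFun]
  push_cast
  ring

lemma radialProfile_norm_sq (n : ℕ) (y : ℝ → ℝ) (ha : 0 < a)
    (hLa : ∀ ρ, a ≤ ρ → L ρ = Real.log ρ / 2)
    {x : Plane} (hx : a ≤ ‖x‖ ^ 2) :
    radialProfile n L y (‖x‖ ^ 2) = (‖x‖ ^ n)⁻¹ * y (Real.log ‖x‖) := by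
  have h1 : L (‖x‖ ^ 2) = Real.log ‖x‖ := by
    rw [hLa _ hx, Real.log_pow]; push_cast; ring
  have h0 : 0 < ‖x‖ := by
    by_contra! h
    have : ‖x‖ = 0 := le_antisymm h (norm_nonneg x)
    rw [this] at hx
    norm_num at hx
    linarith
  rw [radialProfile, h1, Real.exp_neg, mul_comm (n : ℝ), Real.exp_mul, Real.exp_log h0,
    Real.rpow_natCast]

lemma norm_angularFun_radialProfile (n : ℕ) (y : ℝ → ℝ) (ha : 0 < a)
    (hLa : ∀ ρ, a ≤ ρ → L ρ = Real.log ρ / 2)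
    {x : Plane} (hx : a ≤ ‖x‖ ^ 2) :
    ‖angularFun n (radialProfile n L y) x‖ = |y (Real.log ‖x‖)| := by
  have h0 : ‖x‖ ≠ 0 := fun h => by
    rw [h] at hx
    norm_num at hx
    linarith
  rw [angularFun, radialProfile_norm_sq n y ha hLa hx, norm_mul, norm_pow, norm_complexCoord,
    Complex.norm_real, Real.norm_eq_abs, abs_mul, abs_of_nonneg (by positivity)]
  field_simp

lemma complexCoord_polarPoint (r θ : ℝ) :
    complexCoord (polarPoint r θ) = r * Complex.exp (Complex.I * θ) := by
  rw [mul_comm Complex.I, Complex.exp_mul_I, complexCoord, polarPoint]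
  simp
  ring

lemma angularFun_radialProfile_polarPoint (n : ℕ) (y : ℝ → ℝ) (ha : 0 < a)
    (hLa : ∀ ρ, a ≤ ρ → L ρ = Real.log ρ / 2)
    {r : ℝ} (hr : 0 < r) (har : a ≤ r ^ 2) (θ : ℝ) :
    angularFun n (radialProfile n L y) (polarPoint r θ) =
      Complex.exp (Complex.I * n * θ) * (y (Real.log r) : ℂ) := by
  have hn : ‖polarPoint r θ‖ = r := by rw [norm_polarPoint, abs_of_pos hr]
  have hr' : (r : ℂ) ≠ 0 := by exact_mod_cast hr.ne'
  rw [angularFun, radialProfile_norm_sq n y ha hLa (by rwa [hn]), complexCoord_polarPoint, mul_pow,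
    ← Complex.exp_nat_mul, hn, show (n : ℂ) * (Complex.I * θ) = Complex.I * n * θ by ring]
  push_cast
  field_simp

end Profile

/-! ### Eigenfunctions on the annulus -/

lemma mem_openAnnulus {a b : ℝ} {x : Plane} : x ∈ openAnnulus a b ↔ a < ‖x‖ ∧ ‖x‖ < b := by
  simp [openAnnulus, and_comm]

lemma mem_closedAnnulus {a b : ℝ} {x : Plane} : x ∈ closedAnnulus a b ↔ a ≤ ‖x‖ ∧ ‖x‖ ≤ b := by
  simp [closedAnnulus, and_comm]

lemma measurableSet_openAnnulus (a b : ℝ) : MeasurableSet (openAnnulus a b) :=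
  measurableSet_ball.diff measurableSet_closedBall

lemma measurableSet_closedAnnulus (a b : ℝ) : MeasurableSet (closedAnnulus a b) :=
  measurableSet_closedBall.diff measurableSet_ball

/-- The function on the plane with polar form `e^{inθ} y(log r)`, with `y = yp` for `r > R₁` and
`y = ym` for `r ≤ R₁`. -/
noncomputable def planarMode (R₁ : ℝ) (n : ℕ) (L ym yp : ℝ → ℝ) (x : Plane) : ℂ :=
  if R₁ < ‖x‖ then angularFun n (radialProfile n L yp) x else angularFun n (radialProfile n L ym) x

lemma planarMode_const_mul (R₁ : ℝ) (n : ℕ) (L ym yp : ℝ → ℝ) (t : ℝ) (x : Plane) :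
    planarMode R₁ n L (fun s => t * ym s) (fun s => t * yp s) x =
      t * planarMode R₁ n L ym yp x := by
  simp only [planarMode, angularFun, radialProfile]
  split_ifs <;> push_cast <;> ring

/-- The gradient of `planarMode` off the circle of radius `R₁`. -/
noncomputable def planarModeGrad (R₁ : ℝ) (n : ℕ) (L ym yp : ℝ → ℝ) (i : Fin 2) (x : Plane) : ℂ :=
  if R₁ < ‖x‖ then partialDeriv i (angularFun n (radialProfile n L yp)) x
  else partialDeriv i (angularFun n (radialProfile n L ym)) x

namespace IsRadialEigenfunction

variable {R₀ R₁ R₂ cm cp l a : ℝ} {n : ℕ} {ym pm yp pp L : ℝ → ℝ}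

lemma contDiff_inner (h : IsRadialEigenfunction (Real.log R₀) (Real.log R₁) (Real.log R₂) cm cp n l
    ym pm yp pp) (hL : ContDiff ℝ ∞ L) : ContDiff ℝ ∞ (angularFun n (radialProfile n L ym)) :=
  contDiff_angularFun n (contDiff_radialProfile hL h.sol_inner.contDiff_fst)

lemma contDiff_outer (h : IsRadialEigenfunction (Real.log R₀) (Real.log R₁) (Real.log R₂) cm cp n l
    ym pm yp pp) (hL : ContDiff ℝ ∞ L) : ContDiff ℝ ∞ (angularFun n (radialProfile n L yp)) :=
  contDiff_angularFun n (contDiff_radialProfile hL h.sol_outer.contDiff_fst)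

lemma inner_eq_zero (h : IsRadialEigenfunction (Real.log R₀) (Real.log R₁) (Real.log R₂) cm cp n l
    ym pm yp pp) (ha : 0 < a) (haR : a < R₀ ^ 2) (hLa : ∀ ρ, a ≤ ρ → L ρ = Real.log ρ / 2)
    {x : Plane} (hx : ‖x‖ = R₀) : angularFun n (radialProfile n L ym) x = 0 := by
  rw [angularFun, radialProfile_norm_sq n ym ha hLa (by rw [hx]; exact haR.le), hx, h.inner_left]
  simp

lemma outer_eq_zero (h : IsRadialEigenfunction (Real.log R₀) (Real.log R₁) (Real.log R₂) cm cp n l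
    ym pm yp pp) (ha : 0 < a) (haR : a < R₂ ^ 2) (hLa : ∀ ρ, a ≤ ρ → L ρ = Real.log ρ / 2)
    {x : Plane} (hx : ‖x‖ = R₂) : angularFun n (radialProfile n L yp) x = 0 := by
  rw [angularFun, radialProfile_norm_sq n yp ha hLa (by rw [hx]; exact haR.le), hx, h.outer_right]
  simp

lemma inner_eq_outer (h : IsRadialEigenfunction (Real.log R₀) (Real.log R₁) (Real.log R₂) cm cp n l
    ym pm yp pp) (ha : 0 < a) (haR : a < R₁ ^ 2) (hLa : ∀ ρ, a ≤ ρ → L ρ = Real.log ρ / 2)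
    {x : Plane} (hx : ‖x‖ = R₁) :
    angularFun n (radialProfile n L ym) x = angularFun n (radialProfile n L yp) x := by
  have h1 : a ≤ ‖x‖ ^ 2 := by rw [hx]; exact haR.le
  rw [angularFun, angularFun, radialProfile_norm_sq n ym ha hLa h1,
    radialProfile_norm_sq n yp ha hLa h1, hx, h.continuity]

lemma flux_eq (h : IsRadialEigenfunction (Real.log R₀) (Real.log R₁) (Real.log R₂) cm cp n l
    ym pm yp pp) (ha : 0 < a) (haR : a < R₁ ^ 2) (hL : ContDiff ℝ ∞ L)
    (hLa : ∀ ρ, a ≤ ρ → L ρ = Real.log ρ / 2) {x : Plane} (hx : ‖x‖ = R₁) :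
    cm * ∑ i, (x i : ℂ) * partialDeriv i (angularFun n (radialProfile n L ym)) x =
      cp * ∑ i, (x i : ℂ) * partialDeriv i (angularFun n (radialProfile n L yp)) x := by
  have h1 : a < ‖x‖ ^ 2 := by rw [hx]; exact haR
  rw [sum_mul_partialDeriv_angularFun_radialProfile h.sol_inner ha hL hLa h1,
    sum_mul_partialDeriv_angularFun_radialProfile h.sol_outer ha hL hLa h1, angularFun, angularFun,
    radialProfile_norm_sq n pm ha hLa h1.le, radialProfile_norm_sq n pp ha hLa h1.le, hx]
  have h2 : (cm : ℂ) * pm (Real.log R₁) = cp * pp (Real.log R₁) := by exact_mod_cast h.flux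
  push_cast
  linear_combination (complexCoord x ^ n * ((R₁ : ℂ) ^ n)⁻¹) * h2

/-- The mode is the sum of three functions, each extended by zero inside a circle on which it
vanishes, and each of these is approximated in `H¹` by cutting off along its circle. The layers
are placed so that the sum of the approximations vanishes near the boundary of the annulus. -/
lemma memH10 (h : IsRadialEigenfunction (Real.log R₀) (Real.log R₁) (Real.log R₂) cm cp n l
    ym pm yp pp) (hR₀ : 0 < R₀) (hR₀₁ : R₀ < R₁) (hR₁₂ : R₁ < R₂) (ha : 0 < a) (haR : a < R₀ ^ 2)
    (hL : ContDiff ℝ ∞ L) (hLa : ∀ ρ, a ≤ ρ → L ρ = Real.log ρ / 2) :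
    HasWeakGradient (openAnnulus R₀ R₂) (planarMode R₁ n L ym yp) (planarModeGrad R₁ n L ym yp) ∧
    MemH10 (openAnnulus R₀ R₂) (planarMode R₁ n L ym yp) := by
  have hR₁ : 0 < R₁ := hR₀.trans hR₀₁
  have hR₂ : 0 < R₂ := hR₁.trans hR₁₂
  have h01 : R₀ ^ 2 < R₁ ^ 2 := by gcongr
  have h12 : R₁ ^ 2 < R₂ ^ 2 := by gcongr
  have hUm := measurableSet_openAnnulus R₀ R₂
  have hU : ∀ x ∈ openAnnulus R₀ R₂, ‖x‖ ≤ R₂ := fun x hx => (mem_openAnnulus.1 hx).2.le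
  set vm := angularFun n (radialProfile n L ym) with hvm
  set vp := angularFun n (radialProfile n L yp) with hvp
  have cvm : ContDiff ℝ ∞ vm := h.contDiff_inner hL
  have cvp : ContDiff ℝ ∞ vp := h.contDiff_outer hL
  have dvm : ContDiff ℝ 1 vm := contDiff_infty.1 cvm 1
  have dvp : ContDiff ℝ 1 vp := contDiff_infty.1 cvp 1
  have z0 : ∀ x, ‖x‖ = R₀ → vm x = 0 := fun x hx => h.inner_eq_zero ha haR hLa hx
  have z1 : ∀ x, ‖x‖ = R₁ → vp x - vm x = 0 := fun x hx =>
    sub_eq_zero.2 (h.inner_eq_outer ha (haR.trans h01) hLa hx).symm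
  have z2 : ∀ x, ‖x‖ = R₂ → -vp x = 0 := fun x hx =>
    neg_eq_zero.2 (h.outer_eq_zero ha (haR.trans (h01.trans h12)) hLa hx)
  have g0 := hasWeakGradient_exterior hUm hU hR₀ dvm z0
  have g1 := hasWeakGradient_exterior hUm hU hR₁ (dvp.sub dvm) z1
  have g2 := hasWeakGradient_exterior hUm hU hR₂ dvp.neg z2
  have t0 := tendstoH1_circleCutoff hUm hU hR₀ (-1) dvm z0
  have t1 := tendstoH1_circleCutoff hUm hU hR₁ (-1) (dvp.sub dvm) z1
  have t2 := tendstoH1_circleCutoff hUm hU hR₂ 2 dvp.neg z2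
  have hχ : ∀ (R b : ℝ) (k : ℕ), ContDiff ℝ ∞ fun x => (circleCutoff R b k x : ℂ) := fun R b k =>
    Complex.ofRealCLM.contDiff.comp (contDiff_circleCutoff R b k (m := ⊤))
  have c0 : ∀ k : ℕ, ContDiff ℝ ∞ fun x => circleCutoff R₀ (-1) k x * vm x := fun k =>
    (hχ _ _ k).mul cvm
  have c1 : ∀ k : ℕ, ContDiff ℝ ∞ fun x => circleCutoff R₁ (-1) k x * (vp x - vm x) := fun k =>
    (hχ _ _ k).mul (cvp.sub cvm)
  have c2 : ∀ k : ℕ, ContDiff ℝ ∞ fun x => circleCutoff R₂ 2 k x * -vp x := fun k =>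
    (hχ _ _ k).mul cvp.neg
  have t01 := TendstoH1.add (fun k => contDiff_infty.1 (c0 k) 1)
    (fun k => contDiff_infty.1 (c1 k) 1) g0 g1 t0 t1
  have t012 := TendstoH1.add (fun k => contDiff_infty.1 ((c0 k).add (c1 k)) 1)
    (fun k => contDiff_infty.1 (c2 k) 1) (g0.add g1) g2 t01 t2
  have eu : ∀ x ∈ openAnnulus R₀ R₂, (if R₀ < ‖x‖ then vm x else 0) +
      (if R₁ < ‖x‖ then vp x - vm x else 0) + (if R₂ < ‖x‖ then -vp x else 0) =
      planarMode R₁ n L ym yp x := fun x hx => by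
    obtain ⟨h1, h2⟩ := mem_openAnnulus.1 hx
    rw [if_pos h1, if_neg (not_lt.2 h2.le), planarMode]
    split_ifs <;> simp [hvm, hvp]
  have eG : ∀ i, ∀ x ∈ openAnnulus R₀ R₂, (if R₀ < ‖x‖ then partialDeriv i vm x else 0) +
      (if R₁ < ‖x‖ then partialDeriv i (fun x => vp x - vm x) x else 0) +
      (if R₂ < ‖x‖ then partialDeriv i (fun x => -vp x) x else 0) =
      planarModeGrad R₁ n L ym yp i x := fun i x hx => by
    obtain ⟨h1, h2⟩ := mem_openAnnulus.1 hx
    rw [if_pos h1, if_neg (not_lt.2 h2.le), planarModeGrad,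
      partialDeriv_sub (dvp.differentiable one_ne_zero x) (dvm.differentiable one_ne_zero x)]
    split_ifs <;> simp [hvm, hvp]
  have hgrad := ((g0.add g1).add g2).congr hUm eu eG
  refine ⟨hgrad, _, hgrad, ?_⟩
  obtain ⟨K, hK⟩ := exists_nat_gt (max (3 / (R₁ ^ 2 - R₀ ^ 2)) (3 / (R₂ ^ 2 - R₁ ^ 2)))
  refine ⟨fun k x => circleCutoff R₀ (-1) (k + K) x * vm x +
    circleCutoff R₁ (-1) (k + K) x * (vp x - vm x) + circleCutoff R₂ 2 (k + K) x * -vp x,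
    fun k => ?_, ?_⟩
  · have hN : (K : ℝ) ≤ ((k + K : ℕ) : ℝ) := by push_cast; linarith [Nat.cast_nonneg (α := ℝ) k]
    set N := k + K
    have hN1 : 3 < (N : ℝ) * (R₁ ^ 2 - R₀ ^ 2) := by
      rw [← div_lt_iff₀ (by linarith)]
      exact ((le_max_left _ _).trans_lt hK).trans_le hN
    have hN2 : 3 < (N : ℝ) * (R₂ ^ 2 - R₁ ^ 2) := by
      rw [← div_lt_iff₀ (by linarith)]
      exact ((le_max_right _ _).trans_lt hK).trans_le hN
    have hN0 : (0 : ℝ) < N := by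
      by_contra! hcon
      nlinarith
    let A : Set Plane := {x | 1 ≤ (N : ℝ) * (‖x‖ ^ 2 - R₀ ^ 2)} ∩
      {x | (N : ℝ) * (‖x‖ ^ 2 - R₂ ^ 2) ≤ -1}
    have hAc : IsClosed A := (isClosed_le (by fun_prop) (by fun_prop)).inter
      (isClosed_le (by fun_prop) (by fun_prop))
    have hAU : A ⊆ openAnnulus R₀ R₂ := fun x hx => by
      have e1 : 1 ≤ (N : ℝ) * (‖x‖ ^ 2 - R₀ ^ 2) := hx.1
      have e2 : (N : ℝ) * (‖x‖ ^ 2 - R₂ ^ 2) ≤ -1 := hx.2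
      refine mem_openAnnulus.2 ⟨lt_of_pow_lt_pow_left₀ 2 (norm_nonneg x) ?_,
        lt_of_pow_lt_pow_left₀ 2 hR₂.le ?_⟩
      · by_contra! hcon
        nlinarith [mul_nonneg hN0.le (sub_nonneg.2 hcon)]
      · by_contra! hcon
        nlinarith [mul_nonneg hN0.le (sub_nonneg.2 hcon)]
    have hAcomp : IsCompact A := (isCompact_closedBall (0 : Plane) R₂).of_isClosed_subset hAc
      fun x hx => by simpa using hU x (hAU hx)
    have hsupp : Function.support (fun x => circleCutoff R₀ (-1) N x * vm x +
        circleCutoff R₁ (-1) N x * (vp x - vm x) + circleCutoff R₂ 2 N x * -vp x) ⊆ A := by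
      intro x hx
      by_contra hxA
      refine hx ?_
      have hxA' : (N : ℝ) * (‖x‖ ^ 2 - R₀ ^ 2) < 1 ∨ -1 < (N : ℝ) * (‖x‖ ^ 2 - R₂ ^ 2) := by
        by_contra! hcon
        exact hxA hcon
      rcases hxA' with hx1 | hx1
      · have e0 : circleCutoff R₀ (-1) N x = 0 :=
          Real.smoothTransition.zero_of_nonpos (by linarith)
        have e1 : circleCutoff R₁ (-1) N x = 0 :=
          Real.smoothTransition.zero_of_nonpos (by nlinarith)
        have e2 : circleCutoff R₂ 2 N x = 0 :=
          Real.smoothTransition.zero_of_nonpos (by nlinarith)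
        simp [e0, e1, e2]
      · have e0 : circleCutoff R₀ (-1) N x = 1 :=
          Real.smoothTransition.one_of_one_le (by nlinarith)
        have e1 : circleCutoff R₁ (-1) N x = 1 :=
          Real.smoothTransition.one_of_one_le (by nlinarith)
        have e2 : circleCutoff R₂ 2 N x = 1 :=
          Real.smoothTransition.one_of_one_le (by linarith)
        simp [e0, e1, e2]
    exact ⟨((c0 N).add (c1 N)).add (c2 N), HasCompactSupport.of_support_subset_isCompact hAcomp hsupp,
      (closure_minimal hsupp hAc).trans hAU⟩
  · have hshift := t012.congr hUm eu eG
    exact ⟨hshift.1.comp (tendsto_add_atTop_nat K),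
      fun i => (hshift.2 i).comp (tendsto_add_atTop_nat K)⟩

lemma memDomain (h : IsRadialEigenfunction (Real.log R₀) (Real.log R₁) (Real.log R₂) cm cp n l
    ym pm yp pp) (hR₀ : 0 < R₀) (hR₀₁ : R₀ < R₁) (hR₁₂ : R₁ < R₂) (ha : 0 < a) (haR : a < R₀ ^ 2)
    (hL : ContDiff ℝ ∞ L) (hLa : ∀ ρ, a ≤ ρ → L ρ = Real.log ρ / 2) :
    MemDomain R₀ R₁ R₂ cm cp (planarMode R₁ n L ym yp) := by
  have hR₁ : 0 < R₁ := hR₀.trans hR₀₁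
  have h01 : R₀ ^ 2 < R₁ ^ 2 := by gcongr
  have cvm : ContDiff ℝ 2 (angularFun n (radialProfile n L ym)) :=
    contDiff_infty.1 (h.contDiff_inner hL) 2
  have cvp : ContDiff ℝ 2 (angularFun n (radialProfile n L yp)) :=
    contDiff_infty.1 (h.contDiff_outer hL) 2
  have hmm := measurableSet_openAnnulus R₀ R₁
  have hmp := measurableSet_openAnnulus R₁ R₂
  have hbm : ∀ x ∈ openAnnulus R₀ R₁, ‖x‖ ≤ R₁ := fun x hx => (mem_openAnnulus.1 hx).2.le
  have hbp : ∀ x ∈ openAnnulus R₁ R₂, ‖x‖ ≤ R₂ := fun x hx => (mem_openAnnulus.1 hx).2.le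
  have hem : ∀ x ∈ openAnnulus R₀ R₁,
      angularFun n (radialProfile n L ym) x = planarMode R₁ n L ym yp x := fun x hx => by
    rw [planarMode, if_neg (not_lt.2 (hbm x hx))]
  have hep : ∀ x ∈ openAnnulus R₁ R₂,
      angularFun n (radialProfile n L yp) x = planarMode R₁ n L ym yp x := fun x hx => by
    rw [planarMode, if_pos (mem_openAnnulus.1 hx).1]
  have hpolar : ∀ θ, ‖polarPoint R₁ θ‖ = R₁ := fun θ => by rw [norm_polarPoint, abs_of_pos hR₁]
  refine ⟨(h.memH10 hR₀ hR₀₁ hR₁₂ ha haR hL hLa).2, memH2_of_eqOn hmm hbm cvm hem,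
    memH2_of_eqOn hmp hbp cvp hep,
    ⟨_, _, hasTrace_of_eqOn hmm hbm (cvm.of_le (by norm_num)) hem R₁,
      hasTrace_of_eqOn hmp hbp (cvp.of_le (by norm_num)) hep R₁,
      Eventually.of_forall fun θ => h.inner_eq_outer ha (haR.trans h01) hLa (hpolar θ)⟩,
    ⟨_, _, hasNormalTrace_of_eqOn hmm hbm cvm hem R₁, hasNormalTrace_of_eqOn hmp hbp cvp hep R₁,
      Eventually.of_forall fun θ => ?_⟩⟩
  have h1 := h.flux_eq ha (haR.trans h01) hL hLa (hpolar θ)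
  have e0 : (polarPoint R₁ θ) 0 = R₁ * Real.cos θ := rfl
  have e1 : (polarPoint R₁ θ) 1 = R₁ * Real.sin θ := rfl
  rw [Fin.sum_univ_two, Fin.sum_univ_two, e0, e1] at h1
  push_cast at h1
  push_cast
  have hR₁' : (R₁ : ℂ) ≠ 0 := by exact_mod_cast hR₁.ne'
  refine mul_left_cancel₀ hR₁' ?_
  linear_combination h1

lemma negDivGradEq (h : IsRadialEigenfunction (Real.log R₀) (Real.log R₁) (Real.log R₂) cm cp n l
    ym pm yp pp) (hcm : cm ≠ 0) (hcp : cp ≠ 0) (hR₀ : 0 < R₀) (hR₀₁ : R₀ < R₁) (hR₁₂ : R₁ < R₂)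
    (ha : 0 < a) (haR : a < R₀ ^ 2)
    (hL : ContDiff ℝ ∞ L) (hLa : ∀ ρ, a ≤ ρ → L ρ = Real.log ρ / 2) :
    NegDivGradEq (openAnnulus R₀ R₂) (coeff R₀ R₁ R₂ cm cp) (planarMode R₁ n L ym yp)
      (fun x => (l : ℂ) * planarMode R₁ n L ym yp x) := by
  have hR₁ : 0 < R₁ := hR₀.trans hR₀₁
  have h01 : R₀ ^ 2 < R₁ ^ 2 := by gcongr
  have hUm := measurableSet_openAnnulus R₀ R₂
  have hgrad := (h.memH10 hR₀ hR₀₁ hR₁₂ ha haR hL hLa).1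
  refine ⟨hgrad.memLp.const_mul _, _, hgrad, fun φ hφ => ?_⟩
  set vm := angularFun n (radialProfile n L ym) with hvm
  set vp := angularFun n (radialProfile n L yp) with hvp
  have dvm : ∀ i, ContDiff ℝ 1 (partialDeriv i vm) :=
    contDiff_partialDeriv (contDiff_infty.1 (h.contDiff_inner hL) 2) (by norm_num)
  have dvp : ∀ i, ContDiff ℝ 1 (partialDeriv i vp) :=
    contDiff_partialDeriv (contDiff_infty.1 (h.contDiff_outer hL) 2) (by norm_num)
  let D₁ : Fin 2 → Plane → ℂ := fun i x => cm * partialDeriv i vm x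
  let D₂ : Fin 2 → Plane → ℂ := fun i x => cp * partialDeriv i vp x - cm * partialDeriv i vm x
  have hD₁ : ∀ i, ContDiff ℝ 1 (D₁ i) := fun i => contDiff_const.mul (dvm i)
  have hD₂ : ∀ i, ContDiff ℝ 1 (D₂ i) := fun i => (contDiff_const.mul (dvp i)).sub (hD₁ i)
  have htan : ∀ x : Plane, ‖x‖ = R₁ → ∑ i, (x i : ℂ) * D₂ i x = 0 := fun x hx => by
    have := h.flux_eq ha (haR.trans h01) hL hLa hx
    rw [Finset.mul_sum, Finset.mul_sum] at this
    rw [← sub_eq_zero.2 this.symm, ← Finset.sum_sub_distrib]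
    exact Finset.sum_congr rfl fun i _ => by simp only [D₂]; ring
  have e1 := setIntegral_sum_mul_partialDeriv hD₁ hφ
  have e2 := setIntegral_exterior_sum_mul_partialDeriv hR₁ hD₂ htan hφ
  have i1 := (integrable_sum_mul_partialDeriv hD₁ hφ).integrableOn (s := openAnnulus R₀ R₂)
  have i2 := (integrable_exterior (integrable_sum_mul_partialDeriv hD₂ hφ) R₁).integrableOn
    (s := openAnnulus R₀ R₂)
  have i3 := (integrable_divergence_mul hD₁ hφ).integrableOn (s := openAnnulus R₀ R₂)
  have i4 := (integrable_exterior (integrable_divergence_mul hD₂ hφ) R₁).integrableOn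
    (s := openAnnulus R₀ R₂)
  have hlhs : ∫ x in openAnnulus R₀ R₂, (coeff R₀ R₁ R₂ cm cp x : ℂ) *
      ∑ i, planarModeGrad R₁ n L ym yp i x * partialDeriv i φ x =
      ∫ x in openAnnulus R₀ R₂, (∑ i, D₁ i x * partialDeriv i φ x +
        if R₁ < ‖x‖ then ∑ i, D₂ i x * partialDeriv i φ x else 0) := by
    refine integral_congr_ae ?_
    filter_upwards [ae_norm_ne hR₁ _, ae_restrict_mem hUm] with x hx hxU
    obtain ⟨hx0, hx2⟩ := mem_openAnnulus.1 hxU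
    rcases lt_or_gt_of_ne hx with hlt | hgt
    · have hc : coeff R₀ R₁ R₂ cm cp x = cm := by
        rw [coeff, Set.indicator_of_mem (mem_openAnnulus.2 ⟨hx0, hlt⟩),
          Set.indicator_of_notMem fun h => not_lt.2 hlt.le (mem_openAnnulus.1 h).1, add_zero]
      simp only [hc, planarModeGrad, if_neg (not_lt.2 hlt.le), D₁, Finset.mul_sum, add_zero]
      exact Finset.sum_congr rfl fun i _ => by ring
    · have hc : coeff R₀ R₁ R₂ cm cp x = cp := by
        rw [coeff, Set.indicator_of_notMem fun h => not_lt.2 hgt.le (mem_openAnnulus.1 h).2,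
          Set.indicator_of_mem (mem_openAnnulus.2 ⟨hgt, hx2⟩), zero_add]
      simp only [hc, planarModeGrad, if_pos hgt, D₁, D₂, Finset.mul_sum, ← Finset.sum_add_distrib]
      exact Finset.sum_congr rfl fun i _ => by ring
  have hdiff : ∀ i x, DifferentiableAt ℝ (partialDeriv i vm) x := fun i x =>
    (dvm i).differentiable one_ne_zero x
  have hdiff' : ∀ i x, DifferentiableAt ℝ (partialDeriv i vp) x := fun i x =>
    (dvp i).differentiable one_ne_zero x
  have hcm' : (cm : ℂ) ≠ 0 := by exact_mod_cast hcm
  have hcp' : (cp : ℂ) ≠ 0 := by exact_mod_cast hcp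
  have hdiv₁ : ∀ x ∈ openAnnulus R₀ R₂, ∑ i, partialDeriv i (D₁ i) x = -(l * vm x) := by
    intro x hx
    have hax : a < ‖x‖ ^ 2 := haR.trans (by gcongr; exact (mem_openAnnulus.1 hx).1)
    have := sum_partialDeriv_partialDeriv_angularFun_radialProfile h.sol_inner ha hL hLa hax
    simp only [D₁, partialDeriv_const_mul _ (hdiff _ x), ← Finset.mul_sum]
    rw [this, ← hvm]
    push_cast
    field_simp
  have hdiv₂ : ∀ x ∈ openAnnulus R₀ R₂, ∑ i, partialDeriv i (D₂ i) x =
      -(l * vp x) + l * vm x := by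
    intro x hx
    have hax : a < ‖x‖ ^ 2 := haR.trans (by gcongr; exact (mem_openAnnulus.1 hx).1)
    have e3 := sum_partialDeriv_partialDeriv_angularFun_radialProfile h.sol_inner ha hL hLa hax
    have e4 := sum_partialDeriv_partialDeriv_angularFun_radialProfile h.sol_outer ha hL hLa hax
    simp only [D₂, partialDeriv_sub ((hdiff' _ x).const_mul _) ((hdiff _ x).const_mul _),
      partialDeriv_const_mul _ (hdiff _ x), partialDeriv_const_mul _ (hdiff' _ x),
      Finset.sum_sub_distrib, ← Finset.mul_sum]
    rw [e3, e4]
    push_cast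
    field_simp
    ring
  rw [hlhs, integral_add i1 i2, e1, e2, ← neg_add, ← integral_add i3 i4, ← integral_neg]
  refine setIntegral_congr_fun hUm fun x hx => ?_
  simp only [hdiv₁ x hx, hdiv₂ x hx, planarMode]
  split_ifs
  · ring
  · ring

end IsRadialEigenfunction

/-! ### Normalization and exponential decay -/

section Decay

variable {R₀ R₁ R₂ cm cp l a : ℝ} {n : ℕ} {ym pm yp pp L : ℝ → ℝ}

lemma measurable_planarMode (R₁ : ℝ) (n : ℕ) {L ym yp : ℝ → ℝ} (hL : Continuous L)
    (hm : Continuous ym) (hp : Continuous yp) : Measurable (planarMode R₁ n L ym yp) := by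
  have h : ∀ y : ℝ → ℝ, Continuous y → Continuous (angularFun n (radialProfile n L y)) := by
    intro y hy
    have h1 : Continuous (radialProfile n L y) :=
      (Real.continuous_exp.comp (by fun_prop)).mul (hy.comp hL)
    exact ((contDiff_complexCoord (m := 0)).continuous.pow n).mul
      (Complex.continuous_ofReal.comp (h1.comp (by fun_prop)))
  exact Measurable.ite (measurableSet_norm_gt R₁) (h yp hp).measurable (h ym hm).measurable

lemma norm_planarMode (R₁ : ℝ) (n : ℕ) (ym yp : ℝ → ℝ) (ha : 0 < a)
    (hLa : ∀ ρ, a ≤ ρ → L ρ = Real.log ρ / 2) {x : Plane} (hx : a ≤ ‖x‖ ^ 2) :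
    ‖planarMode R₁ n L ym yp x‖ =
      if R₁ < ‖x‖ then |yp (Real.log ‖x‖)| else |ym (Real.log ‖x‖)| := by
  rw [planarMode]
  split_ifs
  · exact norm_angularFun_radialProfile n yp ha hLa hx
  · exact norm_angularFun_radialProfile n ym ha hLa hx

lemma volume_openAnnulus_pos {r r' : ℝ} (hr : 0 ≤ r) (h : r < r') :
    0 < (volume : Measure Plane) (openAnnulus r r') := by
  refine IsOpen.measure_pos _ (Metric.isOpen_ball.sdiff Metric.isClosed_closedBall)
    ⟨polarPoint ((r + r') / 2) 0, ?_⟩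
  rw [mem_openAnnulus, norm_polarPoint, abs_of_nonneg (by linarith)]
  constructor <;> linarith

lemma volume_openAnnulus_ne_top (r r' : ℝ) : (volume : Measure Plane) (openAnnulus r r') ≠ ⊤ :=
  ne_top_of_le_ne_top (measure_ball_lt_top (x := (0 : Plane)) (r := r')).ne
    (measure_mono Set.sdiff_subset)

/-- Chebyshev's inequality: a lower bound for `|f|` on `A` is at most `(vol A)^{-1/2}` if the `L²` norm
of `f` is at most `1`. -/
lemma mul_sqrt_volume_le_one {f : Plane → ℂ} {A B : Set Plane} (hA : MeasurableSet A) (hAB : A ⊆ B)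
    {c : ℝ} (hc : 0 ≤ c) (hf : ∀ x ∈ A, c ≤ ‖f x‖)
    (hB : eLpNorm f 2 (volume.restrict B) ≤ 1) : c * √((volume : Measure Plane) A).toReal ≤ 1 := by
  have h1 : eLpNorm (fun _ : Plane => c) 2 (volume.restrict A) ≤ 1 := by
    refine le_trans (eLpNorm_mono_ae (g := f) ?_)
      ((eLpNorm_mono_measure f (Measure.restrict_mono_set _ hAB)).trans hB)
    filter_upwards [ae_restrict_mem hA] with x hx
    rw [Real.norm_of_nonneg hc]
    exact hf x hx
  rw [eLpNorm_const' _ (by norm_num) (by norm_num), Measure.restrict_apply_univ] at h1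
  have h2 := ENNReal.toReal_mono ENNReal.one_ne_top h1
  rw [ENNReal.toReal_mul, toReal_enorm, Real.norm_of_nonneg hc, ← ENNReal.toReal_rpow] at h2
  rw [Real.sqrt_eq_rpow]
  simpa using h2

/-- Pointwise decay of a normalized mode away from the interface: by `exp_growth` and `exp_decay` the
mode is exponentially smaller at distance at least `η` from the interface than on a ring closer
to it, and on that ring the normalization bounds it. -/
lemma IsRadialMode.norm_planarMode_le
    (h : IsRadialMode (Real.log R₀) (Real.log R₁) (Real.log R₂) cm cp n l ym pm yp pp)
    (hR₀ : 0 < R₀) (hR₀₁ : R₀ < R₁) (hR₁₂ : R₁ < R₂) (ha : 0 < a) (haR : a < R₀ ^ 2)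
    (hLa : ∀ ρ, a ≤ ρ → L ρ = Real.log ρ / 2) {η m V : ℝ} (hη : 0 < η)
    (hη₀ : η < Real.log R₁ - Real.log R₀) (hη₂ : η < Real.log R₂ - Real.log R₁)
    (hm : 0 ≤ m)
    (hqm : ∀ s ≤ Real.log R₁ - η / 2, m ^ 2 ≤ (n : ℝ) ^ 2 - l / cm * Real.exp (2 * s))
    (hqp : ∀ s ≤ Real.log R₂, m ^ 2 ≤ (n : ℝ) ^ 2 - l / cp * Real.exp (2 * s))
    (hV : 0 < V)
    (hV₁ : V ≤ √((volume : Measure Plane) (openAnnulus (Real.exp (Real.log R₁ - 3 * η / 4))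
      (Real.exp (Real.log R₁ - η / 2)))).toReal)
    (hV₂ : V ≤ √((volume : Measure Plane) (openAnnulus (Real.exp (Real.log R₁ + η / 2))
      (Real.exp (Real.log R₁ + 3 * η / 4)))).toReal)
    (hnorm : eLpNorm (planarMode R₁ n L ym yp) 2 (volume.restrict (closedAnnulus R₀ R₂)) ≤ 1)
    {x : Plane} (hx : x ∈ closedAnnulus R₀ R₂)
    (hxη : Real.log ‖x‖ ≤ Real.log R₁ - η ∨ Real.log R₁ + η ≤ Real.log ‖x‖) :
    ‖planarMode R₁ n L ym yp x‖ ≤ Real.exp (-(m * (η / 4))) / V := by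
  have hR₁ : 0 < R₁ := hR₀.trans hR₀₁
  have hR₂ : 0 < R₂ := hR₁.trans hR₁₂
  obtain ⟨hx0, hx2⟩ := mem_closedAnnulus.1 hx
  have hxpos : 0 < ‖x‖ := hR₀.trans_le hx0
  have haz : ∀ z : Plane, R₀ ≤ ‖z‖ → a ≤ ‖z‖ ^ 2 := fun z hz => haR.le.trans (by gcongr)
  have hlog0 : Real.log R₀ ≤ Real.log ‖x‖ := Real.log_le_log hR₀ hx0
  have hlog2 : Real.log ‖x‖ ≤ Real.log R₂ := Real.log_le_log hxpos hx2
  rw [le_div_iff₀ hV]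
  set c := ‖planarMode R₁ n L ym yp x‖ with hc
  have hc0 : 0 ≤ c := norm_nonneg _
  -- it is enough to find a ring on which the mode is larger than at `x` by an exponential factor
  suffices H : ∃ r r' : ℝ, R₀ ≤ r ∧ r' ≤ R₂ ∧
      V ≤ √((volume : Measure Plane) (openAnnulus r r')).toReal ∧
      ∀ z ∈ openAnnulus r r', c ≤ Real.exp (-(m * (η / 4))) * ‖planarMode R₁ n L ym yp z‖ by
    obtain ⟨r, r', hr, hr', hVr, hz⟩ := H
    have h1 := mul_sqrt_volume_le_one (f := planarMode R₁ n L ym yp)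
      (c := Real.exp (m * (η / 4)) * c) (measurableSet_openAnnulus r r')
      (B := closedAnnulus R₀ R₂)
      (fun z hz => mem_closedAnnulus.2 ⟨hr.trans (mem_openAnnulus.1 hz).1.le,
        (mem_openAnnulus.1 hz).2.le.trans hr'⟩)
      (by positivity) (fun z hzA => by
        calc Real.exp (m * (η / 4)) * c
            ≤ Real.exp (m * (η / 4)) * (Real.exp (-(m * (η / 4))) *
              ‖planarMode R₁ n L ym yp z‖) := by gcongr; exact hz z hzA
          _ = ‖planarMode R₁ n L ym yp z‖ := by
            rw [← mul_assoc, ← Real.exp_add, add_neg_cancel, Real.exp_zero, one_mul]) hnorm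
    calc c * V ≤ c * √((volume : Measure Plane) (openAnnulus r r')).toReal := by gcongr
      _ = Real.exp (-(m * (η / 4))) * (Real.exp (m * (η / 4)) * c *
          √((volume : Measure Plane) (openAnnulus r r')).toReal) := by
        rw [← mul_assoc, ← mul_assoc, ← Real.exp_add, neg_add_cancel, Real.exp_zero, one_mul]
      _ ≤ Real.exp (-(m * (η / 4))) * 1 := by gcongr
      _ = _ := mul_one _
  have hexpR : ∀ {R : ℝ}, 0 < R → Real.exp (Real.log R) = R := fun hR => Real.exp_log hR
  rcases hxη with hxη | hxη
  · have hxR : ¬ R₁ < ‖x‖ := fun hcon => by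
      have := Real.log_le_log hR₁ hcon.le
      linarith
    have hcx : c = ym (Real.log ‖x‖) := by
      rw [hc, norm_planarMode R₁ n ym yp ha hLa (haz x hx0), if_neg hxR,
        abs_of_nonneg (h.inner_nonneg _ ⟨hlog0, by linarith⟩)]
    refine ⟨_, _, ?_, ?_, hV₁, fun z hz => ?_⟩
    · rw [← hexpR hR₀]; exact Real.exp_le_exp.2 (by linarith)
    · rw [← hexpR hR₂]; exact Real.exp_le_exp.2 (by linarith)
    · obtain ⟨hz1, hz2⟩ := mem_openAnnulus.1 hz
      have hzpos : 0 < ‖z‖ := (Real.exp_pos _).trans hz1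
      have hz1' : Real.log R₁ - 3 * η / 4 < Real.log ‖z‖ := (Real.lt_log_iff_exp_lt hzpos).2 hz1
      have hz2' : Real.log ‖z‖ < Real.log R₁ - η / 2 := (Real.log_lt_iff_lt_exp hzpos).2 hz2
      have hzR : ¬ R₁ < ‖z‖ := fun hcon => by
        have := Real.log_le_log hR₁ hcon.le
        linarith
      have hz0 : R₀ ≤ ‖z‖ := by
        rw [← Real.log_le_log_iff hR₀ hzpos]; linarith
      have hnn : 0 ≤ ym (Real.log ‖z‖) := h.inner_nonneg _ ⟨by linarith, by linarith⟩
      rw [hcx, norm_planarMode R₁ n ym yp ha hLa (haz z hz0), if_neg hzR, abs_of_nonneg hnn]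
      refine (h.sol_inner.exp_growth (a := Real.log R₀) (b := Real.log R₁ - η / 2)
        (fun s hs => hqm s hs.2) (fun s hs => h.inner_nonneg s ⟨hs.1, by linarith [hs.2]⟩)
        h.inner_left h.inner_left_deriv.le hlog0 (by linarith) hz2'.le).trans ?_
      gcongr
      linarith
  · have hxR : R₁ < ‖x‖ := by
      rw [← Real.log_lt_log_iff hR₁ hxpos]; linarith
    have hcx : c = yp (Real.log ‖x‖) := by
      rw [hc, norm_planarMode R₁ n ym yp ha hLa (haz x hx0), if_pos hxR,
        abs_of_nonneg (h.outer_nonneg _ ⟨by linarith, hlog2⟩)]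
    have hpp : pp (Real.log R₂) ≤ 0 :=
      nonpos_of_hasDerivAt_of_nonneg_left (by linarith) (h.sol_outer.hasDerivAt_fst _)
        h.outer_right h.outer_nonneg
    refine ⟨_, _, ?_, ?_, hV₂, fun z hz => ?_⟩
    · rw [← hexpR hR₀]; exact Real.exp_le_exp.2 (by linarith)
    · rw [← hexpR hR₂]; exact Real.exp_le_exp.2 (by linarith)
    · obtain ⟨hz1, hz2⟩ := mem_openAnnulus.1 hz
      have hzpos : 0 < ‖z‖ := (Real.exp_pos _).trans hz1
      have hz1' : Real.log R₁ + η / 2 < Real.log ‖z‖ := (Real.lt_log_iff_exp_lt hzpos).2 hz1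
      have hz2' : Real.log ‖z‖ < Real.log R₁ + 3 * η / 4 :=
        (Real.log_lt_iff_lt_exp hzpos).2 hz2
      have hzR : R₁ < ‖z‖ := by
        rw [← Real.log_lt_log_iff hR₁ hzpos]; linarith
      have hnn : 0 ≤ yp (Real.log ‖z‖) := h.outer_nonneg _ ⟨by linarith, by linarith⟩
      rw [hcx, norm_planarMode R₁ n ym yp ha hLa (haz z (hR₀₁.trans hzR).le), if_pos hzR,
        abs_of_nonneg hnn]
      refine (h.sol_outer.exp_decay (a := Real.log R₁) (b := Real.log R₂)
        (fun s hs => hqp s hs.2) h.outer_nonneg h.outer_right hpp (by linarith)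
        (by linarith : Real.log ‖z‖ ≤ Real.log ‖x‖) hlog2).trans ?_
      gcongr
      linarith

lemma eLpNorm_planarMode_ne_top (hR₀ : 0 < R₀) (ha : 0 < a) (haR : a < R₀ ^ 2)
    (hL : Continuous L) (hLa : ∀ ρ, a ≤ ρ → L ρ = Real.log ρ / 2) (hm : Continuous ym)
    (hp : Continuous yp) :
    eLpNorm (planarMode R₁ n L ym yp) 2 (volume.restrict (closedAnnulus R₀ R₂)) ≠ ⊤ := by
  have hU : ∀ x ∈ closedAnnulus R₀ R₂, ‖x‖ ≤ R₂ := fun x hx => (mem_closedAnnulus.1 hx).2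
  have := isFiniteMeasure_restrict_of_norm_le hU
  obtain ⟨C₁, hC₁⟩ := (isCompact_Icc (a := Real.log R₀)
    (b := Real.log R₂)).exists_bound_of_continuousOn hm.continuousOn
  obtain ⟨C₂, hC₂⟩ := (isCompact_Icc (a := Real.log R₀)
    (b := Real.log R₂)).exists_bound_of_continuousOn hp.continuousOn
  refine (MemLp.of_bound (measurable_planarMode R₁ n hL hm hp).aestronglyMeasurable (max C₁ C₂)
    ?_).2.ne
  filter_upwards [ae_restrict_mem (measurableSet_closedAnnulus R₀ R₂)] with x hx
  obtain ⟨hx0, hx2⟩ := mem_closedAnnulus.1 hx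
  have hlog : Real.log ‖x‖ ∈ Set.Icc (Real.log R₀) (Real.log R₂) :=
    ⟨Real.log_le_log hR₀ hx0, Real.log_le_log (hR₀.trans_le hx0) hx2⟩
  rw [norm_planarMode R₁ n ym yp ha hLa (haR.le.trans (by gcongr))]
  split_ifs
  · exact (hC₂ _ hlog).trans (le_max_right _ _)
  · exact (hC₁ _ hlog).trans (le_max_left _ _)

lemma IsRadialMode.eLpNorm_planarMode_ne_zero
    (h : IsRadialMode (Real.log R₀) (Real.log R₁) (Real.log R₂) cm cp n l ym pm yp pp)
    (hR₀ : 0 < R₀) (hR₀₁ : R₀ < R₁) (hR₁₂ : R₁ < R₂) (ha : 0 < a) (haR : a < R₀ ^ 2)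
    (hL : Continuous L) (hLa : ∀ ρ, a ≤ ρ → L ρ = Real.log ρ / 2) :
    eLpNorm (planarMode R₁ n L ym yp) 2 (volume.restrict (closedAnnulus R₀ R₂)) ≠ 0 := by
  have hlog01 : Real.log R₀ < Real.log R₁ := Real.log_lt_log hR₀ hR₀₁
  -- since `pm (log R₀) > 0`, the mode is positive on a thin ring at the inner boundary
  have h1 : ∀ᶠ s in 𝓝[>] Real.log R₀, 0 < ym s := by
    have hs := (hasDerivWithinAt_iff_tendsto_slope' (s := Set.Ioi (Real.log R₀)) (by simp)).1
      ((h.sol_inner.hasDerivAt_fst (Real.log R₀)).hasDerivWithinAt)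
    filter_upwards [hs.eventually (lt_mem_nhds h.inner_left_deriv), self_mem_nhdsWithin] with s h2 h3
    rw [slope_def_field, h.inner_left, sub_zero] at h2
    exact (div_pos_iff_of_pos_right (sub_pos.2 h3)).1 h2
  obtain ⟨u, hu, hus⟩ := (mem_nhdsGT_iff_exists_Ioo_subset).1 h1
  have hu' : Real.log R₀ < u := hu
  set r := Real.exp (min u (Real.log R₁)) with hr
  have hr1 : r ≤ R₁ := by
    rw [hr, ← Real.exp_log (hR₀.trans hR₀₁)]
    exact Real.exp_le_exp.2 ((min_le_right _ _).trans_eq (by rw [Real.exp_log (hR₀.trans hR₀₁)]))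
  have hr0 : R₀ < r := by
    conv_lhs => rw [← Real.exp_log hR₀]
    exact Real.exp_lt_exp.2 (lt_min hu' hlog01)
  intro h0
  rw [eLpNorm_eq_zero_iff (measurable_planarMode R₁ n hL h.sol_inner.continuous_fst
    h.sol_outer.continuous_fst).aestronglyMeasurable (by norm_num)] at h0
  have hsub : openAnnulus R₀ r ⊆ closedAnnulus R₀ R₂ := fun x hx =>
    mem_closedAnnulus.2 ⟨(mem_openAnnulus.1 hx).1.le,
      ((mem_openAnnulus.1 hx).2.le.trans hr1).trans hR₁₂.le⟩
  have h2 := ae_restrict_of_ae_restrict_of_subset hsub h0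
  have h3 : ∀ᵐ x ∂(volume : Measure Plane).restrict (openAnnulus R₀ r), False := by
    filter_upwards [h2, ae_restrict_mem (measurableSet_openAnnulus R₀ r)] with x hx hxA
    obtain ⟨hx0, hxr⟩ := mem_openAnnulus.1 hxA
    have hxpos : 0 < ‖x‖ := hR₀.trans hx0
    have hlt : Real.log ‖x‖ < min u (Real.log R₁) := (Real.log_lt_iff_lt_exp hxpos).2 hxr
    have hpos : 0 < ym (Real.log ‖x‖) :=
      hus ⟨Real.log_lt_log hR₀ hx0, hlt.trans_le (min_le_left _ _)⟩
    have h4 := norm_planarMode R₁ n ym yp ha hLa (x := x) (haR.le.trans (by gcongr))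
    rw [hx, if_neg (not_lt.2 (hxr.le.trans hr1)), Pi.zero_apply, norm_zero] at h4
    exact hpos.ne' (abs_eq_zero.1 h4.symm)
  rw [ae_iff] at h3
  simp only [not_false_eq_true, Set.ofPred_true, Measure.restrict_apply_univ] at h3
  exact (volume_openAnnulus_pos hR₀.le hr0).ne' h3

end Decay

/-! ### Asymptotics of the eigenvalues -/

/-- The upper bound for the eigenvalue obtained by Sturm comparison on an interval of length
`δ n = ℓ / √(n + 2)` is asymptotic to `n²`: such a `δ` tends to `0`, while `δ⁻² = o(n²)`. -/
lemma tendsto_comparison_bound (len : ℝ) :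
    Tendsto (fun n : ℕ => Real.exp (2 * (len / √((n : ℝ) + 2))) *
      ((n : ℝ) ^ 2 + (Real.pi / (len / √((n : ℝ) + 2))) ^ 2) / (n : ℝ) ^ 2) atTop (𝓝 1) := by
  have hn : Tendsto (fun n : ℕ => (n : ℝ)) atTop atTop := tendsto_natCast_atTop_atTop
  have h1 : Tendsto (fun n : ℕ => Real.exp (2 * (len / √((n : ℝ) + 2)))) atTop (𝓝 1) := by
    have h2 : Tendsto (fun n : ℕ => len / √((n : ℝ) + 2)) atTop (𝓝 0) :=
      tendsto_const_nhds.div_atTop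
        (Real.tendsto_sqrt_atTop.comp (tendsto_atTop_add_const_right _ _ hn))
    have h3 := (Real.continuous_exp.tendsto 0).comp (by simpa using h2.const_mul 2)
    simpa [Function.comp_def] using h3
  have h2 : Tendsto (fun n : ℕ => (1 : ℝ) + (Real.pi / len) ^ 2 *
      (1 / (n : ℝ) + 2 * (1 / (n : ℝ) * (1 / (n : ℝ))))) atTop (𝓝 1) := by
    have h3 : Tendsto (fun n : ℕ => 1 / (n : ℝ)) atTop (𝓝 0) := tendsto_one_div_atTop_nhds_zero_nat
    simpa using ((h3.add ((h3.mul h3).const_mul 2)).const_mul ((Real.pi / len) ^ 2)).const_add 1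
  have h3 := h1.mul h2
  rw [mul_one] at h3
  refine h3.congr' ?_
  filter_upwards [eventually_gt_atTop 0] with n hn0
  have hn0' : (0 : ℝ) < n := by exact_mod_cast hn0
  have hs : √((n : ℝ) + 2) ^ 2 = n + 2 := Real.sq_sqrt (by positivity)
  rw [mul_div_assoc]
  congr 1
  rw [div_div_eq_mul_div, div_pow, div_pow, mul_pow, hs]
  field_simp

/-- Existence of normalized modes with the right eigenvalue asymptotics. -/
lemma exists_normalized_mode {R₀ R₁ R₂ cm cp a : ℝ} {L : ℝ → ℝ} (hR₀ : 0 < R₀) (hR₀₁ : R₀ < R₁)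
    (hR₁₂ : R₁ < R₂) (hcm : 0 < cm) (hc : cm / R₁ ^ 2 < cp / R₂ ^ 2) (ha : 0 < a)
    (haR : a < R₀ ^ 2) (hL : Continuous L) (hLa : ∀ ρ, a ≤ ρ → L ρ = Real.log ρ / 2) (n : ℕ) {δ : ℝ}
    (hδ : 0 < δ) (hδ' : δ < Real.log R₁ - Real.log R₀) :
    ∃ (l : ℝ) (ym pm yp pp : ℝ → ℝ),
      IsRadialMode (Real.log R₀) (Real.log R₁) (Real.log R₂) cm cp n l ym pm yp pp ∧
      cm / R₁ ^ 2 * (n : ℝ) ^ 2 ≤ l ∧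
      l ≤ cm / R₁ ^ 2 * (Real.exp (2 * δ) * ((n : ℝ) ^ 2 + (Real.pi / δ) ^ 2)) ∧
      eLpNorm (planarMode R₁ n L ym yp) 2 (volume.restrict (closedAnnulus R₀ R₂)) = 1 := by
  have hR₁ : 0 < R₁ := hR₀.trans hR₀₁
  have hR₂ : 0 < R₂ := hR₁.trans hR₁₂
  have hexp : ∀ {R : ℝ}, 0 < R → Real.exp (2 * Real.log R) = R ^ 2 := fun {R} hR => by
    rw [two_mul, Real.exp_add, Real.exp_log hR, sq]
  obtain ⟨l, ym, pm, yp, pp, h, hl1, hl2⟩ := exists_isRadialMode (Real.log_lt_log hR₀ hR₀₁)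
    (Real.log_lt_log hR₁ hR₁₂) hcm (by rwa [hexp hR₁, hexp hR₂]) n hδ hδ'
  rw [hexp hR₁] at hl1 hl2
  set N := eLpNorm (planarMode R₁ n L ym yp) 2 (volume.restrict (closedAnnulus R₀ R₂)) with hN
  have hN0 : N ≠ 0 := h.eLpNorm_planarMode_ne_zero hR₀ hR₀₁ hR₁₂ ha haR hL hLa
  have hNtop : N ≠ ⊤ := eLpNorm_planarMode_ne_top hR₀ ha haR hL hLa h.sol_inner.continuous_fst
    h.sol_outer.continuous_fst
  have ht : 0 < N.toReal⁻¹ := inv_pos.2 (ENNReal.toReal_pos hN0 hNtop)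
  refine ⟨l, _, _, _, _, h.const_mul ht, hl1, by rw [← mul_assoc]; exact hl2, ?_⟩
  have e : planarMode R₁ n L (fun s => N.toReal⁻¹ * ym s) (fun s => N.toReal⁻¹ * yp s) =
      N.toReal⁻¹ • planarMode R₁ n L ym yp := by
    ext x
    rw [planarMode_const_mul]
    simp
  rw [e, eLpNorm_const_smul, ← hN, enorm_inv (ENNReal.toReal_pos hN0 hNtop).ne',
    Real.enorm_of_nonneg ENNReal.toReal_nonneg, ENNReal.ofReal_toReal hNtop,
    ENNReal.inv_mul_cancel hN0 hNtop]

/-- In the variable `log r`, points at a fixed distance from the circle stay away from `log R`. -/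
lemma log_norm_le_or_le {R r : ℝ} (hR : 0 < R) (hr : 0 < r) {x : Plane} (hx : 0 < ‖x‖)
    (h : r ≤ |‖x‖ - R|) : Real.log ‖x‖ ≤ Real.log R - Real.log (1 + r / R) ∨
      Real.log R + Real.log (1 + r / R) ≤ Real.log ‖x‖ := by
  have h1 : 0 < 1 + r / R := by positivity
  rcases le_abs.1 h with h | h
  · right
    rw [← Real.log_mul hR.ne' h1.ne']
    refine Real.log_le_log (by positivity) ?_
    rw [mul_add, mul_div_cancel₀ _ hR.ne']
    linarith
  · left
    rw [le_sub_iff_add_le, ← Real.log_mul hx.ne' h1.ne']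
    refine Real.log_le_log (by positivity) ?_
    calc ‖x‖ * (1 + r / R) ≤ (R - r) * (1 + r / R) := by gcongr; linarith
      _ = R - r ^ 2 / R := by field_simp; ring
      _ ≤ R := by linarith [show 0 ≤ r ^ 2 / R by positivity]

end AnnulusTransmission

theorem theorem2p5 (R₀ R₁ R₂ cm cp : ℝ) (hR₀ : 0 < R₀) (hR₀₁ : R₀ < R₁) (hR₁₂ : R₁ < R₂)
    (hcm : 0 < cm) (hc : cm / R₁ ^ 2 < cp / R₂ ^ 2) :
    ∃ (lam : ℕ → ℝ) (u : ℕ → Plane → ℂ) (ψ : ℕ → ℝ → ℂ),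
      (∀ n, MemDomain R₀ R₁ R₂ cm cp (u n)) ∧
      (∀ n, NegDivGradEq (openAnnulus R₀ R₂) (coeff R₀ R₁ R₂ cm cp) (u n)
        (fun x => (lam n : ℂ) * u n x)) ∧
      (∀ n, ∀ r ∈ Set.Ioo R₀ R₂, ∀ θ : ℝ,
        u n (polarPoint r θ) = Complex.exp (Complex.I * n * θ) * ψ n r) ∧
      lam ~[atTop] (fun n : ℕ => cm / R₁ ^ 2 * (n : ℝ) ^ 2) ∧
      (∀ n, eLpNorm (u n) 2 (volume.restrict (closedAnnulus R₀ R₂)) = 1) ∧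
      ∀ s : Set Plane, s ⊆ closedAnnulus R₀ R₂ →
        Metric.AreSeparated (closure s) (Metric.sphere (0 : Plane) R₁) →
        ∃ C > 0, ∃ d > 0, ∀ n : ℕ,
          eLpNorm (u n) 2 (volume.restrict s) ≤ ENNReal.ofReal (C * Real.exp (-d * n)) := by
  have hR₁ : 0 < R₁ := hR₀.trans hR₀₁
  have hR₂ : 0 < R₂ := hR₁.trans hR₁₂
  have hE : 0 < cm / R₁ ^ 2 := by positivity
  have hcp : 0 < cp := by
    by_contra! h
    exact absurd (hE.trans hc) (not_lt.2 (div_nonpos_of_nonpos_of_nonneg h (sq_nonneg _)))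
  have hexp : ∀ {R : ℝ}, 0 < R → Real.exp (2 * Real.log R) = R ^ 2 := fun {R} hR => by
    rw [two_mul, Real.exp_add, Real.exp_log hR, sq]
  have ha : 0 < R₀ ^ 2 / 2 := by positivity
  have haR : R₀ ^ 2 / 2 < R₀ ^ 2 := by linarith
  obtain ⟨L, hL, hLa⟩ := exists_smooth_log ha
  have hlen : 0 < Real.log R₁ - Real.log R₀ := sub_pos.2 (Real.log_lt_log hR₀ hR₀₁)
  have hlen₂ : 0 < Real.log R₂ - Real.log R₁ := sub_pos.2 (Real.log_lt_log hR₁ hR₁₂)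
  set δ : ℕ → ℝ := fun n => (Real.log R₁ - Real.log R₀) / √((n : ℝ) + 2) with hδ
  have hδ0 : ∀ n, 0 < δ n := fun n => by positivity
  have hδ1 : ∀ n, δ n < Real.log R₁ - Real.log R₀ := fun n => by
    refine div_lt_self hlen (Real.lt_sqrt_of_sq_lt ?_)
    linarith [Nat.cast_nonneg (α := ℝ) n]
  choose lam ym pm yp pp hmode hlow hup hnorm using fun n =>
    exists_normalized_mode hR₀ hR₀₁ hR₁₂ hcm hc ha haR hL.continuous hLa n (hδ0 n) (hδ1 n)
  have hratio : Tendsto (fun n => lam n / (cm / R₁ ^ 2 * (n : ℝ) ^ 2)) atTop (𝓝 1) := by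
    refine tendsto_of_tendsto_of_tendsto_of_le_of_le' tendsto_const_nhds
      (tendsto_comparison_bound (Real.log R₁ - Real.log R₀)) ?_ ?_
    · filter_upwards [eventually_gt_atTop 0] with n hn
      have hn' : (0 : ℝ) < n := by exact_mod_cast hn
      rw [one_le_div (by positivity)]
      exact hlow n
    · filter_upwards [eventually_gt_atTop 0] with n hn
      have hn' : (0 : ℝ) < n := by exact_mod_cast hn
      rw [div_le_div_iff₀ (by positivity) (by positivity)]
      calc lam n * (n : ℝ) ^ 2 ≤ cm / R₁ ^ 2 * (Real.exp (2 * δ n) *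
            ((n : ℝ) ^ 2 + (Real.pi / δ n) ^ 2)) * (n : ℝ) ^ 2 := by gcongr; exact hup n
        _ = _ := by rw [hδ]; ring
  refine ⟨lam, fun n => planarMode R₁ n L (ym n) (yp n),
    fun n r => if R₁ < r then yp n (Real.log r) else ym n (Real.log r),
    fun n => (hmode n).memDomain hR₀ hR₀₁ hR₁₂ ha haR hL hLa,
    fun n => (hmode n).negDivGradEq hcm.ne' hcp.ne' hR₀ hR₀₁ hR₁₂ ha haR hL hLa,
    fun n r hr θ => ?_, ?_, hnorm, fun s hs hsep => ?_⟩
  · have hr0 : 0 < r := hR₀.trans hr.1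
    have har : R₀ ^ 2 / 2 ≤ r ^ 2 := haR.le.trans (by gcongr; exact hr.1.le)
    simp only [planarMode, norm_polarPoint, abs_of_pos hr0]
    split_ifs
    · exact angularFun_radialProfile_polarPoint n (yp n) ha hLa hr0 har θ
    · exact angularFun_radialProfile_polarPoint n (ym n) ha hLa hr0 har θ
  · exact isEquivalent_of_tendsto_one hratio
  · obtain ⟨r₀, hr₀, hsep⟩ := hsep
    have hr1 : min r₀ 1 ≠ ⊤ := ne_top_of_le_ne_top ENNReal.one_ne_top (min_le_right _ _)
    have hr : 0 < (min r₀ 1).toReal := ENNReal.toReal_pos (by simp [hr₀]) hr1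
    set r := (min r₀ 1).toReal
    have hdist : ∀ x ∈ s, r ≤ |‖x‖ - R₁| := fun x hx => by
      obtain ⟨z, hz, hxz⟩ := exists_norm_eq_norm_sub_eq hR₁ x
      have h1 := (min_le_left r₀ 1).trans (hsep x (subset_closure hx) z (by simpa using hz))
      rw [edist_dist, dist_eq_norm, hxz] at h1
      exact (ENNReal.le_ofReal_iff_toReal_le hr1 (abs_nonneg _)).1 h1
    have hlogr : 0 < Real.log (1 + r / R₁) := Real.log_pos (by
      have : 0 < r / R₁ := by positivity
      linarith)
    -- `η` is the width, in the variable `log r`, of the excluded neighbourhood of the interface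
    obtain ⟨η, hη, hηr, hη₀, hη₂⟩ : ∃ η > 0, η ≤ Real.log (1 + r / R₁) ∧
        η < Real.log R₁ - Real.log R₀ ∧ η < Real.log R₂ - Real.log R₁ := by
      obtain ⟨η, h1, h2⟩ := exists_between (lt_min hlogr (lt_min hlen hlen₂))
      exact ⟨η, h1, (h2.trans_le (min_le_left _ _)).le,
        h2.trans_le ((min_le_right _ _).trans (min_le_left _ _)),
        h2.trans_le ((min_le_right _ _).trans (min_le_right _ _))⟩
    -- relative to `E₀ n²`, the potential `c n² / r²` is at least `1 / q > 1` away from the interface,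
    -- so it exceeds `lam n` by a multiple of `n²` as soon as `lam n ≤ K E₀ n²` with `K q < 1`
    set q := max (Real.exp (-η)) (cm / R₁ ^ 2 * R₂ ^ 2 / cp) with hq
    have hq0 : 0 < q := (Real.exp_pos _).trans_le (le_max_left _ _)
    have hq1 : q < 1 := by
      refine max_lt ((Real.exp_lt_exp.2 (by linarith)).trans_eq Real.exp_zero) ?_
      rw [div_lt_one hcp]
      exact (lt_div_iff₀ (by positivity)).1 hc
    obtain ⟨K, hK1, hK2⟩ : ∃ K, 1 < K ∧ K < q⁻¹ := exists_between ((one_lt_inv₀ hq0).2 hq1)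
    have hKq : K * q < 1 := by
      calc K * q < q⁻¹ * q := by gcongr
        _ = 1 := inv_mul_cancel₀ hq0.ne'
    set β := √(1 - K * q) with hβ
    have hβ0 : 0 < β := Real.sqrt_pos.2 (by linarith)
    have hβ2 : β ^ 2 = 1 - K * q := Real.sq_sqrt (by linarith)
    obtain ⟨n₀, hn₀⟩ := eventually_atTop.1
      ((hratio.eventually (gt_mem_nhds hK1)).and (eventually_gt_atTop 0))
    have hvol : ∀ {r r' : ℝ}, 0 ≤ r → r < r' →
        0 < √((volume : Measure Plane) (openAnnulus r r')).toReal := fun h1 h2 =>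
      Real.sqrt_pos.2 (ENNReal.toReal_pos (volume_openAnnulus_pos h1 h2).ne'
        (volume_openAnnulus_ne_top _ _))
    obtain ⟨V, hV, hV12⟩ := exists_between (lt_min
      (hvol (Real.exp_pos (Real.log R₁ - 3 * η / 4)).le
        (Real.exp_lt_exp.2 (by linarith : _ < Real.log R₁ - η / 2)))
      (hvol (Real.exp_pos (Real.log R₁ + η / 2)).le
        (Real.exp_lt_exp.2 (by linarith : _ < Real.log R₁ + 3 * η / 4))))
    have hpoint : ∀ n, n₀ ≤ n → ∀ x ∈ s,
        ‖planarMode R₁ n L (ym n) (yp n) x‖ ≤ Real.exp (-(β * n * (η / 4))) / V := by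
      intro n hn x hx
      obtain ⟨hn1, hn2⟩ := hn₀ n hn
      have hn' : (0 : ℝ) < n := by exact_mod_cast hn2
      have hlam : lam n ≤ K * (cm / R₁ ^ 2 * (n : ℝ) ^ 2) :=
        ((div_lt_iff₀ (by positivity)).1 hn1).le
      have hlam0 : 0 ≤ lam n := (by positivity : (0 : ℝ) ≤ cm / R₁ ^ 2 * (n : ℝ) ^ 2).trans (hlow n)
      have hlogx := log_norm_le_or_le hR₁ hr
        (hR₀.trans_le (mem_closedAnnulus.1 (hs hx)).1) (hdist x hx)
      refine (hmode n).norm_planarMode_le hR₀ hR₀₁ hR₁₂ ha haR hLa hη hη₀ hη₂ (by positivity)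
        (fun s hs => ?_) (fun s hs => ?_) hV (hV12.le.trans (min_le_left _ _))
        (hV12.le.trans (min_le_right _ _)) (hnorm n).le (hs hx)
        (hlogx.imp (fun h => by linarith) (fun h => by linarith))
      · have h1 : Real.exp (2 * s) ≤ R₁ ^ 2 * Real.exp (-η) := by
          rw [← hexp hR₁, ← Real.exp_add]
          exact Real.exp_le_exp.2 (by linarith)
        have h2 : lam n / cm * Real.exp (2 * s) ≤
            K * (cm / R₁ ^ 2 * (n : ℝ) ^ 2) / cm * (R₁ ^ 2 * q) := by
          gcongr
          exact h1.trans (by gcongr; exact le_max_left _ _)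
        have h3 : K * (cm / R₁ ^ 2 * (n : ℝ) ^ 2) / cm * (R₁ ^ 2 * q) = K * q * (n : ℝ) ^ 2 := by
          field_simp
        rw [mul_pow, hβ2]
        linarith
      · have h1 : Real.exp (2 * s) ≤ R₂ ^ 2 := by
          rw [← hexp hR₂]
          exact Real.exp_le_exp.2 (by linarith)
        have h2 : lam n / cp * Real.exp (2 * s) ≤
            K * (cm / R₁ ^ 2 * (n : ℝ) ^ 2) / cp * R₂ ^ 2 := by gcongr
        have h3 : K * (cm / R₁ ^ 2 * (n : ℝ) ^ 2) / cp * R₂ ^ 2 =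
            K * (cm / R₁ ^ 2 * R₂ ^ 2 / cp) * (n : ℝ) ^ 2 := by ring
        have h4 : K * (cm / R₁ ^ 2 * R₂ ^ 2 / cp) * (n : ℝ) ^ 2 ≤ K * q * (n : ℝ) ^ 2 := by
          gcongr
          exact le_max_right _ _
        rw [mul_pow, hβ2]
        linarith
    set d := β * (η / 4) with hd
    set W := ((volume : Measure Plane) (closedAnnulus R₀ R₂) ^ (1 / 2 : ℝ)).toReal with hW
    have hvolc : (volume : Measure Plane) (closedAnnulus R₀ R₂) ≠ ⊤ :=
      ne_top_of_le_ne_top (isCompact_closedBall (0 : Plane) R₂).measure_lt_top.ne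
        (measure_mono Set.sdiff_subset)
    have hWtop : (volume : Measure Plane) (closedAnnulus R₀ R₂) ^ (1 / 2 : ℝ) ≠ ⊤ :=
      ENNReal.rpow_ne_top_of_nonneg (by norm_num) hvolc
    refine ⟨W / V + Real.exp (d * n₀), by positivity, d, by positivity, fun n => ?_⟩
    rcases lt_or_ge n n₀ with hn | hn
    · refine (eLpNorm_mono_measure _ (Measure.restrict_mono_set _ hs)).trans ?_
      rw [hnorm n]
      rw [← ENNReal.ofReal_one]
      refine ENNReal.ofReal_le_ofReal ?_
      have h1 : (n : ℝ) ≤ n₀ := by exact_mod_cast hn.le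
      calc (1 : ℝ) ≤ Real.exp (d * n₀ + -d * n) := Real.one_le_exp (by
            have : 0 ≤ d * (n₀ - n) := mul_nonneg (by positivity) (by linarith)
            linarith)
        _ = Real.exp (d * n₀) * Real.exp (-d * n) := Real.exp_add _ _
        _ ≤ (W / V + Real.exp (d * n₀)) * Real.exp (-d * n) := by
          gcongr
          have : 0 ≤ W / V := by positivity
          linarith
    · set f := planarMode R₁ n L (ym n) (yp n) with hf
      have hfm : Measurable f := measurable_planarMode R₁ n hL.continuous
        (hmode n).sol_inner.continuous_fst (hmode n).sol_outer.continuous_fst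
      have hset : MeasurableSet {x | ‖f x‖ ≤ Real.exp (-(β * n * (η / 4))) / V} :=
        measurableSet_le hfm.norm measurable_const
      have hae : ∀ᵐ x ∂(volume : Measure Plane).restrict s,
          ‖f x‖ ≤ Real.exp (-(β * n * (η / 4))) / V :=
        (ae_restrict_iff hset).2 (Eventually.of_forall (hpoint n hn))
      calc eLpNorm f 2 (volume.restrict s)
          ≤ (volume.restrict s) Set.univ ^ (2 : ℝ≥0∞).toReal⁻¹ *
            ENNReal.ofReal (Real.exp (-(β * n * (η / 4))) / V) := eLpNorm_le_of_ae_bound hae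
        _ ≤ ENNReal.ofReal W * ENNReal.ofReal (Real.exp (-(β * n * (η / 4))) / V) := by
          gcongr
          rw [hW, ENNReal.ofReal_toReal hWtop, Measure.restrict_apply_univ, ENNReal.toReal_ofNat,
            ← one_div]
          gcongr
        _ = ENNReal.ofReal (W * (Real.exp (-(β * n * (η / 4))) / V)) :=
          (ENNReal.ofReal_mul ENNReal.toReal_nonneg).symm
        _ ≤ ENNReal.ofReal ((W / V + Real.exp (d * n₀)) * Real.exp (-d * n)) := by
          refine ENNReal.ofReal_le_ofReal ?_
          have e1 : -(β * n * (η / 4)) = -d * n := by rw [hd]; ring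
          rw [e1, add_mul]
          have : W * (Real.exp (-d * n) / V) = W / V * Real.exp (-d * n) := by ring
          rw [this]
          linarith [mul_pos (Real.exp_pos (d * n₀)) (Real.exp_pos (-d * n))]
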